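/- Assume the Generalized Riemann Hypothesis for Dirichlet $L$-functions: for every primitive Dirichlet character $\chi$ (including the one modulo $1$, for which $L(s,\chi)=\zeta(s)$), every zero of $L(s,\chi)$ with $0<\operatorname{Re}s<1$ has real part $\tfrac12$. Let $W:\mathbb{R}\to\mathbb{C}$ be a $C^\infty$ function supported on $[1,2]$, and let $\hat W(1)=\int_0^\infty W(x)\,dx$ be the value at $s=1$ of its Mellin transform $\hat W(s)=\int_0^\infty W(x)x^{s-1}\,dx$. Then for every $\varepsilon>0$ and all real $Q,X\ge 1$, $$\sum_{q\ge1} \frac{W(q/Q)}{\phi(q)} \sum_{\chi \bmod q}^{*}\Big|\sum_{m\le X}\frac{\mu(m)\chi(m)}{\sqrt{m}}\Big|^2 = \hat{W}(1)\prod_p\Big(1-\frac1{p^2}-\frac{1}{p^3}\Big)\,Q\sum_{m\le X}\frac{\mu^2(m)\phi(m)}{m^2}\prod_{p\mid m}\Big(1-\frac1{p^2}-\frac{1}{p^3}\Big)^{-1}+O_{\varepsilon,W}\big(Q^{\varepsilon}\sqrt{X}\big),$$ where $\sum^{*}$ runs over the primitive Dirichlet characters modulo $q$, $\phi$ is Euler's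 function, $\mu$ is the Möbius function, $p$ runs over primes, and the implied constant depends only on $\varepsilon$ and $W$ (not on $Q$ or $X$). -/

import Mathlib

noncomputable section

namespace MoebiusSieve

/-- The Generalized Riemann Hypothesis for Dirichlet `L`-functions: for every primitive Dirichlet
character `χ`, every zero of `L(s, χ)` in the strip `0 < Re s < 1` has real part `1 / 2`. The
primitive character modulo `1` is included; its `L`-function is the Riemann zeta function. -/
def GRH : Prop :=
  ∀ (q : ℕ) [NeZero q] (χ : DirichletCharacter ℂ q), χ.IsPrimitive →
    ∀ s : ℂ, DirichletCharacter.LFunction χ s = 0 → 0 < s.re → s.re < 1 → s.re = 1 / 2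

/-- The Dirichlet polynomial `∑_{m ≤ X} μ(m) χ(m) / √m`. -/
def moebiusPoly (X : ℝ) {q : ℕ} (χ : DirichletCharacter ℂ q) : ℂ :=
  ∑ m ∈ Finset.Icc 1 ⌊X⌋₊, (ArithmeticFunction.moebius m : ℂ) * χ (m : ZMod q) / (√(m : ℝ) : ℂ)

open Classical in
/-- `∑*_{χ mod q} |∑_{m ≤ X} μ(m) χ(m) / √m|²`, the outer sum being over the primitive characters
modulo `q`. -/
def primitiveSum (X : ℝ) (q : ℕ+) : ℝ :=
  ∑ χ : DirichletCharacter ℂ (q : ℕ) with χ.IsPrimitive, ‖moebiusPoly X χ‖ ^ 2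

/-- `∑_q W(q/Q)/φ(q) ∑*_{χ mod q} |∑_{m ≤ X} μ(m) χ(m) / √m|²`, over all `q ≥ 1`. For `W` supported
on `[1, 2]` only finitely many terms are nonzero (see `finite_support_moment`). -/
def moment (W : ℝ → ℂ) (Q X : ℝ) : ℂ :=
  ∑' q : ℕ+, W ((q : ℕ) / Q) / (Nat.totient q : ℂ) * (primitiveSum X q : ℂ)

/-- The local factor `1 - p⁻² - p⁻³`. -/
def localFactor (p : ℕ) : ℝ := 1 - 1 / (p : ℝ) ^ 2 - 1 / (p : ℝ) ^ 3

/-- `∏_p (1 - p⁻² - p⁻³)`, over all primes; it converges by `multipliable_localFactor`. -/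
def eulerConst : ℝ := ∏' p : Nat.Primes, localFactor p

/-- `∑_{m ≤ X} μ(m)² φ(m) / m² ∏_{p ∣ m} (1 - p⁻² - p⁻³)⁻¹`. -/
def diagonalSum (X : ℝ) : ℝ :=
  ∑ m ∈ Finset.Icc 1 ⌊X⌋₊, (ArithmeticFunction.moebius m : ℝ) ^ 2 * (Nat.totient m : ℝ) /
    (m : ℝ) ^ 2 * ∏ p ∈ m.primeFactors, (localFactor p)⁻¹

/-- `Ŵ(1) ∏_p (1 - p⁻² - p⁻³) Q ∑_{m ≤ X} μ(m)² φ(m) / m² ∏_{p ∣ m} (1 - p⁻² - p⁻³)⁻¹`, where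
`Ŵ(s) = ∫_0^∞ W(x) x^{s-1} dx` is the Mellin transform. -/
def mainTerm (W : ℝ → ℂ) (Q X : ℝ) : ℂ :=
  mellin W 1 * (eulerConst : ℂ) * (Q : ℂ) * (diagonalSum X : ℂ)

theorem finite_support_moment (W : ℝ → ℂ) (hW : Function.support W ⊆ Set.Icc 1 2) (Q X : ℝ)
    (hQ : 1 ≤ Q) :
    (Function.support fun q : ℕ+ =>
      W ((q : ℕ) / Q) / (Nat.totient q : ℂ) * (primitiveSum X q : ℂ)).Finite := by
  apply (Set.finite_Iic (Nat.succPNat ⌊2 * Q⌋₊)).subset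
  intro q hq
  have h1 : W ((q : ℕ) / Q) ≠ 0 := fun h => hq (by simp only [h, zero_div, zero_mul])
  have h2 := (hW h1).2
  rw [div_le_iff₀ (by linarith)] at h2
  have h3 : (q : ℕ) ≤ ⌊2 * Q⌋₊ := Nat.le_floor h2
  exact PNat.coe_le_coe _ _ |>.1 (h3.trans (Nat.le_succ _))

theorem multipliable_localFactor : Multipliable fun p : Nat.Primes => localFactor p := by
  have h2 : Summable fun p : Nat.Primes => 1 / ((p : ℕ) : ℝ) ^ 2 :=
    (Real.summable_one_div_nat_pow.2 (by norm_num)).comp_injective Subtype.val_injective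
  have h3 : Summable fun p : Nat.Primes => 1 / ((p : ℕ) : ℝ) ^ 3 :=
    (Real.summable_one_div_nat_pow.2 (by norm_num)).comp_injective Subtype.val_injective
  have h : Summable fun p : Nat.Primes => -(1 / ((p : ℕ) : ℝ) ^ 2) - 1 / ((p : ℕ) : ℝ) ^ 3 :=
    h2.neg.sub h3
  refine (multipliable_one_add_of_summable h.norm).congr fun p => ?_
  simp only [localFactor]
  ring

end MoebiusSieve

end

/-! The sum over primitive characters is opened by Möbius inversion over the conductor. With q = c d
this leaves the weight μ(c) W(cd/Q) φ(d)/φ(cd), and orthogonality modulo d turns the square into a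
sum of μ(m)μ(n)/√(mn) over m ≡ n mod d with m, n coprime to cd (`moment_eq`). The pairs m = n give
the main term; the pairs m ≠ n are doubled by symmetry from n < m (`moment_eq_diag_add_off`).

Diagonal, unconditionally: for fixed m and c the sum over d is a smooth sum over multiples, replaced
by its integral. The remaining series over c is an Euler product with local factors 1 - p⁻² - p⁻³
(`tsum_singularCoeff`), and the errors add up to O(Q^ε √X) (`exists_norm_diagonal_sub_mainTerm_le`).

Off the diagonal, GRH enters through one input: sums of μ(m)χ(m)/√m up to N are O((qN)^ε) for every
character modulo q (`exists_norm_sum_moebius_char_le`). It follows from a Lindelöf-type bound for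
1/L to the right of the critical line, proved with Borel–Carathéodory and the three circles theorem,
and from a shift of contour in a Perron formula. By orthogonality again, sums over congruent pairs m
≡ n are also O of a small power (`exists_abs_pairSum_le`), for every modulus.

This is used twice for each c. Directly, with about Q/c values of d and weight about 1/c, it gives
(QX)^ε Q/c² (`exists_norm_offTerm_le`). Alternatively, the divisor e of m - n is exchanged for the
complementary divisor k = (m - n)/e, which makes the weight a smooth function of m - n at scale
about kQ/c; two-dimensional partial summation then gives (QX)^ε X/Q (`exists_norm_offTerm_le'`). The
geometric mean of Q/c² and X/Q is √X/c, and the sum over c costs only a power Q^ε. The factor X^ε is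
removed by also using the bound Q/c, which is far below √X/c when X is much larger than Q²
(`min_mul_rpow_le`). -/

namespace MoebiusSieve

open Complex Filter Topology MeasureTheory

/-! ### Complex analysis: lower bounds for zero-free functions -/

/-- Hadamard's three circles theorem. -/
theorem norm_le_of_three_circles {g : ℂ → ℂ} {r₁ r₃ R M₁ M₃ : ℝ} (h₁ : 0 < r₁) (h₁₃ : r₁ < r₃)
    (h₃ : r₃ < R) (hg : DifferentiableOn ℂ g (Metric.ball 0 R))
    (hM₁ : ∀ z, ‖z‖ = r₁ → ‖g z‖ ≤ M₁) (hM₃ : ∀ z, ‖z‖ = r₃ → ‖g z‖ ≤ M₃) {z : ℂ}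
    (hz₁ : r₁ ≤ ‖z‖) (hz₃ : ‖z‖ ≤ r₃) :
    ‖g z‖ ≤ M₁ ^ (1 - (Real.log ‖z‖ - Real.log r₁) / (Real.log r₃ - Real.log r₁)) *
      M₃ ^ ((Real.log ‖z‖ - Real.log r₁) / (Real.log r₃ - Real.log r₁)) := by
  have hr₃ : 0 < r₃ := h₁.trans h₁₃
  have hz0 : z ≠ 0 := by
    rintro rfl
    rw [norm_zero] at hz₁
    linarith
  have hlog : Real.log r₁ < Real.log r₃ := Real.log_lt_log h₁ h₁₃
  have hmaps : ∀ w : ℂ, w.re ≤ Real.log r₃ → ‖exp w‖ ≤ r₃ := fun w hw => by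
    rw [Complex.norm_exp]
    exact (Real.exp_le_exp.2 hw).trans_eq (Real.exp_log hr₃)
  have hclosed : closure (HadamardThreeLines.verticalStrip (Real.log r₁) (Real.log r₃)) ⊆
      HadamardThreeLines.verticalClosedStrip (Real.log r₁) (Real.log r₃) := by
    apply closure_minimal
    · intro w hw
      exact ⟨hw.1.le, hw.2.le⟩
    · exact isClosed_Icc.preimage continuous_re
  have hdiff : DifferentiableOn ℂ (fun w => g (exp w))
      (HadamardThreeLines.verticalClosedStrip (Real.log r₁) (Real.log r₃)) := by
    apply hg.comp differentiable_exp.differentiableOn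
    intro w hw
    rw [mem_ball_zero_iff]
    exact (hmaps w hw.2).trans_lt h₃
  -- Pulling back along `exp` turns the annulus into a vertical strip, so the three lines theorem at
  -- log z gives an exponent affine in log ‖z‖.
  have key := HadamardThreeLines.norm_le_interp_of_mem_verticalClosedStrip'
    (f := fun w => g (exp w)) (z := Complex.log z) (a := M₁) (b := M₃) hlog
    ⟨by simpa [Complex.log_re] using Real.log_le_log h₁ hz₁,
      by simpa [Complex.log_re] using Real.log_le_log (norm_pos_iff.2 hz0) hz₃⟩
    (hdiff.mono hclosed).diffContOnCl ?_ ?_ ?_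
  · simpa only [Complex.exp_log hz0, Complex.log_re] using key
  · obtain ⟨B, hB⟩ := (isCompact_closedBall (0 : ℂ) r₃).exists_bound_of_continuousOn
      (hg.continuousOn.mono (Metric.closedBall_subset_ball h₃))
    refine ⟨B, ?_⟩
    rintro _ ⟨w, hw, rfl⟩
    exact hB _ (mem_closedBall_zero_iff.2 (hmaps w hw.2))
  · intro w hw
    apply hM₁
    rw [Complex.norm_exp, show w.re = Real.log r₁ from hw, Real.exp_log h₁]
  · intro w hw
    apply hM₃
    rw [Complex.norm_exp, show w.re = Real.log r₃ from hw, Real.exp_log hr₃]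

/-- A nonvanishing holomorphic function on a disc has a holomorphic logarithm, normalized to vanish
at the centre. -/
theorem exists_log_on_ball {F : ℂ → ℂ} {R : ℝ} (hR : 0 < R)
    (hF : DifferentiableOn ℂ F (Metric.ball 0 R)) (h0 : ∀ z ∈ Metric.ball 0 R, F z ≠ 0) :
    ∃ g : ℂ → ℂ, DifferentiableOn ℂ g (Metric.ball 0 R) ∧ g 0 = 0 ∧
      ∀ z ∈ Metric.ball 0 R, F z = F 0 * exp (g z) := by
  have hd : DifferentiableOn ℂ (fun z => deriv F z / F z) (Metric.ball 0 R) :=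
    (hF.deriv Metric.isOpen_ball).div hF h0
  -- The logarithm is a primitive of F'/F; below, F · exp(-g) is shown to have zero derivative on
  -- the convex ball.
  obtain ⟨g, hg⟩ := hd.isExactOn_ball
  have hmem : (0 : ℂ) ∈ Metric.ball (0 : ℂ) R := Metric.mem_ball_self hR
  refine ⟨fun z => g z - g 0, fun z hz => ?_, sub_self _, fun z hz => ?_⟩
  · exact ((hg z hz).sub_const _).differentiableAt.differentiableWithinAt
  · have hconst : ∀ w ∈ Metric.ball (0 : ℂ) R,
        HasDerivAt (fun w => F w * exp (-(g w))) 0 w := fun w hw => by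
      have h1 : HasDerivAt F (deriv F w) w :=
        (hF.differentiableAt (Metric.isOpen_ball.mem_nhds hw)).hasDerivAt
      have h2 := h1.mul (hg w hw).neg.cexp
      have h3 : deriv F w * exp (-g w) + F w * (exp (-g w) * -(deriv F w / F w)) = 0 := by
        have := h0 w hw
        field_simp
        ring
      rw [← h3]
      exact h2
    have heq : F z * exp (-(g z)) = F 0 * exp (-(g 0)) := by
      apply (convex_ball (0 : ℂ) R).is_const_of_fderivWithin_eq_zero (𝕜 := ℂ)
        (f := fun w => F w * exp (-(g w))) _ _ hz hmem
      · exact fun w hw => (hconst w hw).differentiableAt.differentiableWithinAt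
      · intro w hw
        rw [fderivWithin_of_isOpen Metric.isOpen_ball hw]
        ext
        simp [(hconst w hw).deriv]
    have h4 : F z = F z * exp (-(g z)) * exp (g z) := by
      rw [mul_assoc, ← Complex.exp_add, neg_add_cancel, Complex.exp_zero, mul_one]
    rw [h4, heq, mul_assoc, ← Complex.exp_add]
    ring_nf

/-- If `log ‖F‖` exceeds its value at the centre by at most `M` on a disc of radius `5/2`, and by at
most `B` on the disc of radius `3/2`, then `log ‖F‖` is at least `-O(M ^ θ)` with `θ < 1` in
the interior of the larger disc. -/
theorem norm_log_le_of_ball {δ : ℝ} (hδ : 0 < δ) (hδ' : δ < 1) :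
    ∃ θ c : ℝ, 0 < θ ∧ θ < 1 ∧ 0 < c ∧ ∀ (g : ℂ → ℂ) (B M : ℝ), 1 ≤ B → B ≤ M →
      DifferentiableOn ℂ g (Metric.ball 0 (5 / 2)) → g 0 = 0 →
      (∀ z ∈ Metric.ball 0 (5 / 2), (g z).re ≤ M) →
      (∀ z ∈ Metric.ball 0 (3 / 2), (g z).re ≤ B) →
      ∀ z : ℂ, 1 ≤ ‖z‖ → ‖z‖ ≤ 5 / 2 - δ → ‖g z‖ ≤ c * B * M ^ θ := by
  set r₃ : ℝ := 5 / 2 - δ / 2 with hr₃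
  -- The circles have radii 1 and r₃. As log 1 = 0, the interpolation exponent at radius ρ is log ρ
  -- / log r₃, largest at ρ = 5/2 - δ; it stays below 1 because r₃ is strictly larger.
  set θ : ℝ := Real.log (5 / 2 - δ) / Real.log r₃ with hθ
  have hl2 : 0 < Real.log (5 / 2 - δ) := Real.log_pos (by linarith)
  have hl23 : Real.log (5 / 2 - δ) < Real.log r₃ := Real.log_lt_log (by linarith) (by linarith)
  have hl3 : 0 < Real.log r₃ := hl2.trans hl23
  -- Borel–Carathéodory gives 4B on the circle of radius 1 (inside radius 3/2), and at most (10/δ)M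
  -- on the circle of radius r₃, at distance δ/2 from the boundary.
  refine ⟨θ, max 4 (10 / δ), div_pos hl2 hl3, (div_lt_one hl3).2 hl23, by positivity, ?_⟩
  intro g B M hB hBM hg hg0 hM hB' z hz1 hz2
  set c : ℝ := max 4 (10 / δ) with hc
  have hc4 : 4 ≤ c := le_max_left _ _
  have hcδ : 10 / δ ≤ c := le_max_right _ _
  have hB0 : 0 < B := by linarith
  have hM0 : 0 < M := by linarith
  have h1 : ∀ z : ℂ, ‖z‖ = 1 → ‖g z‖ ≤ c * B := fun z hz => by
    have := borelCaratheodory_zero (z := z) hB0 (hg.mono (Metric.ball_subset_ball (by norm_num)))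
      hB' (by norm_num : (0 : ℝ) < 3 / 2) (by rw [mem_ball_zero_iff, hz]; norm_num) hg0
    rw [hz] at this
    norm_num at this
    nlinarith
  have h3 : ∀ z : ℂ, ‖z‖ = r₃ → ‖g z‖ ≤ c * M := fun z hz => by
    have := borelCaratheodory_zero (z := z) hM0 hg
      hM (by norm_num : (0 : ℝ) < 5 / 2) (by rw [mem_ball_zero_iff, hz]; linarith) hg0
    rw [hz] at this
    refine this.trans ?_
    rw [show (5 : ℝ) / 2 - r₃ = δ / 2 by rw [hr₃]; ring]
    calc 2 * M * r₃ / (δ / 2) ≤ 2 * M * (5 / 2) / (δ / 2) := by gcongr; linarith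
      _ = 10 / δ * M := by field_simp; norm_num
      _ ≤ c * M := by gcongr
  have key := norm_le_of_three_circles (r₁ := 1) (r₃ := r₃) one_pos (by linarith)
    (by linarith : r₃ < 5 / 2) hg h1 h3 hz1 (by linarith)
  rw [Real.log_one, sub_zero, sub_zero] at key
  set x : ℝ := Real.log ‖z‖ / Real.log r₃ with hx
  have hx0 : 0 ≤ x := div_nonneg (Real.log_nonneg hz1) hl3.le
  have hxθ : x ≤ θ := by
    rw [hx, hθ]
    gcongr
  have hxle : x ≤ 1 := hxθ.trans ((div_lt_one hl3).2 hl23).le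
  refine key.trans ?_
  rw [Real.mul_rpow (by positivity) hB0.le, Real.mul_rpow (by positivity) hM0.le]
  have e1 : B ^ (1 - x) ≤ B := by
    simpa using Real.rpow_le_rpow_of_exponent_le hB (by linarith : 1 - x ≤ 1)
  have e2 : M ^ x ≤ M ^ θ := Real.rpow_le_rpow_of_exponent_le (hB.trans hBM) hxθ
  have e3 : c ^ (1 - x) * c ^ x = c := by
    rw [← Real.rpow_add (by positivity)]
    simp
  calc c ^ (1 - x) * B ^ (1 - x) * (c ^ x * M ^ x)
      = (c ^ (1 - x) * c ^ x) * (B ^ (1 - x) * M ^ x) := by ring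
    _ ≤ c * (B * M ^ θ) := by
      rw [e3]
      gcongr
    _ = c * B * M ^ θ := by ring

/-- A sublinear power is dominated by any linear function. -/
theorem exists_rpow_le_linear {θ : ℝ} (hθ : 0 < θ) (hθ' : θ < 1) {a ε : ℝ} (ha : 0 ≤ a)
    (hε : 0 < ε) : ∃ C : ℝ, ∀ x : ℝ, 0 ≤ x → a * x ^ θ ≤ ε * x + C := by
  -- The constant is the value of a x^θ at the point where a x^θ = ε x.
  refine ⟨a * ((a / ε) ^ (1 / (1 - θ))) ^ θ, fun x hx => ?_⟩
  have h1θ : 0 < 1 - θ := by linarith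
  rcases le_total x ((a / ε) ^ (1 / (1 - θ))) with h | h
  · have : a * x ^ θ ≤ a * ((a / ε) ^ (1 / (1 - θ))) ^ θ := by gcongr
    nlinarith [mul_nonneg hε.le hx]
  · have h2 : a / ε ≤ x ^ (1 - θ) := by
      calc a / ε = ((a / ε) ^ (1 / (1 - θ))) ^ (1 - θ) := by
            rw [← Real.rpow_mul (by positivity), one_div_mul_cancel h1θ.ne', Real.rpow_one]
        _ ≤ x ^ (1 - θ) := by gcongr
    have h3 : a ≤ ε * x ^ (1 - θ) := by
      rw [div_le_iff₀ hε] at h2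
      linarith
    have h4 : x ^ (1 - θ) * x ^ θ = x := by
      rw [← Real.rpow_add_of_nonneg hx h1θ.le hθ.le]
      simp
    have h5 : 0 ≤ a * ((a / ε) ^ (1 / (1 - θ))) ^ θ := by positivity
    calc a * x ^ θ ≤ ε * x ^ (1 - θ) * x ^ θ := by gcongr
      _ = ε * x := by rw [mul_assoc, h4]
      _ ≤ _ := by linarith

/-- A zero-free holomorphic function of polynomial growth on `Re s > 1/2` which is bounded above and
below on `Re s > 3/2` satisfies the Lindelöf bound for its reciprocal. -/
theorem norm_inv_le_of_zero_free {δ ε b : ℝ} (hδ : 0 < δ) (hδ' : δ < 1) (hε : 0 < ε) (hb : 0 < b) :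
    ∃ C : ℝ, 0 < C ∧ ∀ (F : ℂ → ℂ) (K : ℝ), 1 ≤ K →
      DifferentiableOn ℂ F {s | 1 / 2 < s.re} →
      (∀ s : ℂ, 1 / 2 < s.re → F s ≠ 0) →
      (∀ s : ℂ, 1 / 2 < s.re → s.re < 6 → ‖F s‖ ≤ b * (K * (|s.im| + 2)) ^ 2) →
      (∀ s : ℂ, 3 / 2 < s.re → b⁻¹ ≤ ‖F s‖ ∧ ‖F s‖ ≤ b) →
      ∀ s : ℂ, 1 / 2 + δ ≤ s.re → s.re ≤ 5 / 2 → ‖F s‖⁻¹ ≤ C * (K * (|s.im| + 2)) ^ ε := by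
  obtain ⟨θ, c, hθ, hθ', hc, hball⟩ := norm_log_le_of_ball hδ hδ'
  set B : ℝ := max 1 (2 * |Real.log b|) with hB
  have hB1 : 1 ≤ B := le_max_left _ _
  have hBb : 2 * |Real.log b| ≤ B := le_max_right _ _
  -- With Λ = log(K(|t| + 2)) ≥ 1/2, the growth hypothesis gives log‖G‖ - log‖F s₀‖ ≤ 2Λ + B + 4 ≤
  -- 2Λ + (2B + 8)Λ = kΛ.
  set k : ℝ := 2 * (B + 5) with hk
  obtain ⟨C, hC⟩ := exists_rpow_le_linear hθ hθ' (a := c * B * k ^ θ) (ε := ε) (by positivity) hε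
  refine ⟨max b (b * Real.exp C), lt_max_of_lt_left hb, ?_⟩
  intro F K hK hF hF0 hFp hFb s hs1 hs2
  have hT : 2 ≤ K * (|s.im| + 2) := by nlinarith [abs_nonneg s.im]
  have hΛ : 1 / 2 ≤ Real.log (K * (|s.im| + 2)) := by
    have := Real.log_le_log (by norm_num) hT
    have := Real.log_two_gt_d9
    linarith
  by_cases hs : 3 / 2 < s.re
  · have h1 : ‖F s‖⁻¹ ≤ b := inv_le_of_inv_le₀ hb (hFb s hs).1
    have h2 : 1 ≤ (K * (|s.im| + 2)) ^ ε := Real.one_le_rpow (by linarith) hε.le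
    calc ‖F s‖⁻¹ ≤ b * 1 := by linarith
      _ ≤ max b (b * Real.exp C) * (K * (|s.im| + 2)) ^ ε := by
        gcongr
        exact le_max_left _ _
  · push Not at hs
    set Λ : ℝ := Real.log (K * (|s.im| + 2)) with hΛdef
    -- Around 3 + it, the disc of radius 5/2 just fills the zero-free half plane and stays in Re <
    -- 6, while the disc of radius 3/2 stays where F is bounded above and below.
    set s₀ : ℂ := 3 + s.im * I with hs₀
    have hre : ∀ z : ℂ, (s₀ + z).re = 3 + z.re := fun z => by simp [hs₀]
    have him : ∀ z : ℂ, (s₀ + z).im = s.im + z.im := fun z => by simp [hs₀]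
    have hrez : ∀ z : ℂ, -‖z‖ ≤ z.re ∧ z.re ≤ ‖z‖ := fun z =>
      abs_le.1 (Complex.abs_re_le_norm z)
    set G : ℂ → ℂ := fun z => F (s₀ + z) with hG
    have hGd : DifferentiableOn ℂ G (Metric.ball 0 (5 / 2)) := by
      apply hF.comp (by fun_prop)
      intro z hz
      rw [mem_ball_zero_iff] at hz
      show 1 / 2 < (s₀ + z).re
      rw [hre]
      linarith [(hrez z).1]
    have hG0 : ∀ z ∈ Metric.ball (0 : ℂ) (5 / 2), G z ≠ 0 := fun z hz => by
      rw [mem_ball_zero_iff] at hz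
      apply hF0
      rw [hre]
      linarith [(hrez z).1]
    obtain ⟨g, hg, hg0, hgF⟩ := exists_log_on_ball (by norm_num) hGd hG0
    have hcen := hFb s₀ (by simp [hs₀])
    have hGcen : G 0 = F s₀ := by simp [hG]
    have hpos : 0 < ‖F s₀‖ := lt_of_lt_of_le (by positivity) hcen.1
    have hregen : ∀ z ∈ Metric.ball (0 : ℂ) (5 / 2),
        (g z).re = Real.log ‖G z‖ - Real.log ‖F s₀‖ := fun z hz => by
      rw [hgF z hz, norm_mul, hGcen, Complex.norm_exp, Real.log_mul hpos.ne' (Real.exp_ne_zero _),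
        Real.log_exp]
      ring
    have hlogc : -Real.log ‖F s₀‖ ≤ |Real.log b| := by
      have := Real.log_le_log (by positivity) hcen.1
      rw [Real.log_inv] at this
      linarith [le_abs_self (Real.log b)]
    have hlog2 : (0 : ℝ) ≤ Real.log 3 ∧ Real.log 3 ≤ 2 :=
      ⟨Real.log_nonneg (by norm_num), by
        have := Real.log_le_sub_one_of_pos (show (0 : ℝ) < 3 by norm_num)
        linarith⟩
    have hM : ∀ z ∈ Metric.ball (0 : ℂ) (5 / 2), (g z).re ≤ k * Λ := fun z hz => by
      rw [hregen z hz]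
      have hz' := hz
      rw [mem_ball_zero_iff] at hz'
      have hGpos : 0 < ‖G z‖ := norm_pos_iff.2 (hG0 z hz)
      have hfp : ‖G z‖ ≤ b * (3 * (K * (|s.im| + 2))) ^ 2 := by
        refine (hFp (s₀ + z) (by rw [hre]; linarith [(hrez z).1])
          (by rw [hre]; linarith [(hrez z).2])).trans ?_
        have : |(s₀ + z).im| ≤ |s.im| + 5 / 2 := by
          rw [him]
          exact (abs_add_le _ _).trans (by linarith [Complex.abs_im_le_norm z])
        have h0 := abs_nonneg s.im
        have hle : K * (|(s₀ + z).im| + 2) ≤ 3 * (K * (|s.im| + 2)) := by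
          rw [mul_left_comm]
          gcongr
          linarith
        gcongr
      have h1 := Real.log_le_log hGpos hfp
      rw [Real.log_mul hb.ne' (by positivity), Real.log_pow,
        Real.log_mul (by norm_num) (by positivity)] at h1
      push_cast at h1
      have h2 := le_abs_self (Real.log b)
      have : k * Λ = 2 * Λ + (2 * B + 8) * Λ := by rw [hk]; ring
      have h3 := mul_le_mul_of_nonneg_left hΛ (by linarith : 0 ≤ 2 * B + 8)
      linarith
    have hBz : ∀ z ∈ Metric.ball (0 : ℂ) (3 / 2), (g z).re ≤ B := fun z hz => by
      rw [hregen z (Metric.ball_subset_ball (by norm_num) hz)]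
      rw [mem_ball_zero_iff] at hz
      have hz' := hFb (s₀ + z) (by rw [hre]; linarith [(hrez z).1])
      have h1 := Real.log_le_log (lt_of_lt_of_le (by positivity) hz'.1) hz'.2
      have h2 := le_abs_self (Real.log b)
      simp only [hG]
      linarith
    have hnorm : ‖((s.re - 3 : ℝ) : ℂ)‖ = 3 - s.re := by
      rw [Complex.norm_real, Real.norm_eq_abs, abs_of_nonpos (by linarith)]
      ring
    have hBk : B ≤ k * Λ := by
      have h3 := mul_le_mul_of_nonneg_left hΛ (by linarith : 0 ≤ k)
      linarith
    have hfin := hball g B (k * Λ) hB1 hBk hg hg0 hM hBz ((s.re - 3 : ℝ) : ℂ)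
      (by rw [hnorm]; linarith) (by rw [hnorm]; linarith)
    have hsum : s₀ + ((s.re - 3 : ℝ) : ℂ) = s := by
      apply Complex.ext <;> simp [hs₀]
    have hreg := hregen ((s.re - 3 : ℝ) : ℂ) (by rw [mem_ball_zero_iff, hnorm]; linarith)
    simp only [hG, hsum] at hreg
    have hspos : 0 < ‖F s‖ := norm_pos_iff.2 (hF0 s (by linarith))
    have h4 : -(g ((s.re - 3 : ℝ) : ℂ)).re ≤ ε * Λ + C := by
      refine ((neg_le_abs _).trans (Complex.abs_re_le_norm _)).trans (hfin.trans ?_)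
      refine le_trans (le_of_eq ?_) (hC Λ (by linarith))
      rw [Real.mul_rpow (by positivity) (by linarith)]
      ring
    have h5 : -Real.log ‖F s‖ ≤ ε * Λ + C + Real.log b := by
      have h6 := Real.log_le_log (by positivity) hcen.1
      have h7 : Real.log b⁻¹ = -Real.log b := Real.log_inv b
      linarith
    calc ‖F s‖⁻¹ = Real.exp (-Real.log ‖F s‖) := by rw [Real.exp_neg, Real.exp_log hspos]
      _ ≤ Real.exp (ε * Λ + C + Real.log b) := Real.exp_le_exp.2 h5
      _ = b * Real.exp C * (K * (|s.im| + 2)) ^ ε := by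
        rw [Real.exp_add, Real.exp_add, Real.exp_log hb, Real.rpow_def_of_pos (by linarith)]
        rw [mul_comm ε]
        ring
      _ ≤ _ := by
        gcongr
        exact le_max_right _ _

/-! ### Growth of L-functions and the bound for 1/L under GRH -/

/-- The Dirichlet-type integral of a bounded function is holomorphic in the right half plane. -/
theorem differentiableOn_integral_bounded {S : ℝ → ℂ} {B : ℝ} (hS : Measurable S)
    (hB : ∀ t, ‖S t‖ ≤ B) :
    DifferentiableOn ℂ (fun s : ℂ => ∫ t in Set.Ioi (1 : ℝ), S t * (t : ℂ) ^ (-(s + 1)))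
      {s | 0 < s.re} := by
  have hI : (fun s : ℂ => ∫ t in Set.Ioi (1 : ℝ), S t * (t : ℂ) ^ (-(s + 1))) =
      fun s => mellin ((Set.Ioi (1 : ℝ)).indicator S) (-s) := by
    funext s
    rw [mellin]
    have h1 : ∀ t : ℝ, (t : ℂ) ^ (-s - 1) • (Set.Ioi (1 : ℝ)).indicator S t =
        (Set.Ioi (1 : ℝ)).indicator (fun t : ℝ => S t * (t : ℂ) ^ (-(s + 1))) t := fun t => by
      by_cases ht : t ∈ Set.Ioi (1 : ℝ)
      · rw [Set.indicator_of_mem ht, Set.indicator_of_mem ht, smul_eq_mul, mul_comm]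
        ring_nf
      · rw [Set.indicator_of_notMem ht, Set.indicator_of_notMem ht, smul_zero]
    simp only [h1]
    rw [setIntegral_indicator measurableSet_Ioi]
    congr 2
    ext t
    simp only [Set.mem_inter_iff, Set.mem_Ioi]
    exact ⟨fun h => ⟨by linarith, h⟩, fun h => h.2⟩
  rw [hI]
  have hB' : ∀ t, ‖(Set.Ioi (1 : ℝ)).indicator S t‖ ≤ B := fun t =>
    (norm_indicator_le_norm_self S t).trans (hB t)
  have hm : Measurable ((Set.Ioi (1 : ℝ)).indicator S) := hS.indicator measurableSet_Ioi
  intro s hs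
  have hloc : LocallyIntegrable ((Set.Ioi (1 : ℝ)).indicator S) := by
    apply (locallyIntegrable_const B).mono hm.aestronglyMeasurable
    exact Eventually.of_forall fun t => (hB' t).trans (le_abs_self B)
  -- Boundedness at infinity is the exponent a = 0, which is where Re s > 0 is needed. The function
  -- vanishes near 0, so any b below Re(-s) serves.
  have h := mellin_differentiableAt_of_isBigO_rpow (a := 0) (b := -(s.re) - 1) (s := -s)
    (f := (Set.Ioi (1 : ℝ)).indicator S) (hloc.locallyIntegrableOn _) ?_ ?_ ?_ ?_
  · exact (h.comp s differentiable_neg.differentiableAt).differentiableWithinAt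
  · apply Asymptotics.IsBigO.of_bound B
    filter_upwards with t
    simpa using hB' t
  · simpa using hs
  · apply Asymptotics.IsBigO.of_bound 0
    filter_upwards [nhdsWithin_le_nhds (eventually_lt_nhds (zero_lt_one (α := ℝ)))] with t ht
    rw [Set.indicator_of_notMem (by simpa using ht.le)]
    simp
  · simp

/-- The trivial bound for the Dirichlet-type integral of a bounded function. -/
theorem norm_integral_bounded_le {S : ℝ → ℂ} {B : ℝ} (hB : ∀ t, ‖S t‖ ≤ B) {s : ℂ}
    (hs : 0 < s.re) :
    ‖∫ t in Set.Ioi (1 : ℝ), S t * (t : ℂ) ^ (-(s + 1))‖ ≤ B / s.re := by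
  have hint : IntegrableOn (fun t : ℝ => B * t ^ (-(s.re + 1))) (Set.Ioi 1) :=
    (integrableOn_Ioi_rpow_of_lt (by linarith) one_pos).const_mul B
  refine (norm_integral_le_of_norm_le hint ?_).trans (le_of_eq ?_)
  · filter_upwards [ae_restrict_mem measurableSet_Ioi] with t ht
    rw [norm_mul, Complex.norm_cpow_eq_rpow_re_of_pos (zero_lt_one.trans ht),
      show (-(s + 1)).re = -(s.re + 1) by simp]
    have : 0 ≤ t ^ (-(s.re + 1)) := Real.rpow_nonneg (zero_lt_one.trans ht).le _
    gcongr
    exact hB t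
  · rw [integral_const_mul, integral_Ioi_rpow_of_lt (by linarith) one_pos]
    simp
    field_simp

/-- The partial sums of a nontrivial Dirichlet character are bounded by its modulus. -/
theorem norm_sum_char_le {q : ℕ} [NeZero q] {χ : DirichletCharacter ℂ q} (hχ : χ ≠ 1) (n : ℕ) :
    ‖∑ k ∈ Finset.Icc 1 n, χ k‖ ≤ q := by
  have hq : 0 < q := NeZero.pos q
  have hper : ∀ n, ∑ k ∈ Finset.range (n + q), χ k = ∑ k ∈ Finset.range n, χ k := fun n => by
    rw [Finset.sum_range_add]
    have h0 : ∑ k ∈ Finset.range q, χ ((n + k : ℕ) : ZMod q) = 0 := by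
      rw [← MulChar.sum_eq_zero_of_ne_one hχ, ← Equiv.sum_comp (Equiv.addLeft (n : ZMod q))]
      refine Finset.sum_bij (fun k _ => (k : ZMod q)) (fun _ _ => Finset.mem_univ _) ?_ ?_ ?_
      · intro a ha b hb hab
        rw [ZMod.natCast_eq_natCast_iff] at hab
        exact Nat.ModEq.eq_of_lt_of_lt hab (Finset.mem_range.1 ha) (Finset.mem_range.1 hb)
      · intro b _
        exact ⟨b.val, Finset.mem_range.2 b.val_lt, ZMod.natCast_zmod_val b⟩
      · intro k _
        simp
    rw [h0, add_zero]
  have hmod : ∀ n, ∑ k ∈ Finset.range n, χ k = ∑ k ∈ Finset.range (n % q), χ k := fun n => by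
    induction n using Nat.strong_induction_on with
    | _ n ih =>
      rcases lt_or_ge n q with h | h
      · rw [Nat.mod_eq_of_lt h]
      · rw [← Nat.sub_add_cancel h, hper, ih (n - q) (by omega), Nat.add_mod_right]
  have hchi0 : χ ((0 : ℕ) : ZMod q) = 0 := by
    rw [Nat.cast_zero]
    apply DirichletCharacter.map_zero'
    rintro rfl
    exact hχ (DirichletCharacter.level_one χ)
  have heq : ∑ k ∈ Finset.Icc 1 n, χ k = ∑ k ∈ Finset.range (n + 1), χ k := by
    rw [Finset.range_eq_Ico, Finset.sum_eq_sum_Ico_succ_bot (by omega), hchi0, zero_add]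
    rfl
  rw [heq, hmod]
  refine (norm_sum_le_of_le _ fun k _ => χ.norm_le_one _).trans ?_
  simp only [Finset.sum_const, Finset.card_range, nsmul_eq_mul, mul_one, Nat.cast_le]
  exact (Nat.mod_lt _ hq).le

/-- Convexity-type bound for `L(s, χ)` with `χ` nontrivial. -/
theorem norm_LFunction_le {q : ℕ} [NeZero q] {χ : DirichletCharacter ℂ q} (hχ : χ ≠ 1) {s : ℂ}
    (hs : 0 < s.re) : ‖DirichletCharacter.LFunction χ s‖ ≤ ‖s‖ * (q / s.re) := by
  set S : ℝ → ℂ := fun t => ∑ k ∈ Finset.Icc 1 ⌊t⌋₊, χ k with hSdef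
  have hB : ∀ t, ‖S t‖ ≤ q := fun t => norm_sum_char_le hχ _
  have hSm : Measurable S :=
    (measurable_from_nat (f := fun n => ∑ k ∈ Finset.Icc 1 n, χ k)).comp Nat.measurable_floor
  have hU : IsOpen {s : ℂ | 0 < s.re} := isOpen_lt continuous_const continuous_re
  -- Partial summation gives the identity for Re s > 1; both sides are holomorphic for Re s > 0, so
  -- it persists there.
  have hEq : Set.EqOn (DirichletCharacter.LFunction χ)
      (fun s => s * ∫ t in Set.Ioi (1 : ℝ), S t * (t : ℂ) ^ (-(s + 1))) {s | 0 < s.re} := by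
    refine AnalyticOnNhd.eqOn_of_preconnected_of_eventuallyEq (𝕜 := ℂ) (z₀ := 2) ?_ ?_ ?_ ?_ ?_
    · exact (DirichletCharacter.differentiable_LFunction hχ).differentiableOn.analyticOnNhd hU
    · exact (differentiableOn_id.mul (differentiableOn_integral_bounded hSm hB)).analyticOnNhd hU
    · exact (convex_halfSpace_re_gt 0).isPreconnected
    · simp
    · have : {s : ℂ | 1 < s.re} ∈ 𝓝 (2 : ℂ) :=
        (isOpen_lt continuous_const continuous_re).mem_nhds (by simp)
      filter_upwards [this] with w hw
      have hw' : 1 < w.re := hw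
      rw [DirichletCharacter.LFunction_eq_LSeries χ hw']
      apply LSeries_eq_mul_integral _ le_rfl (zero_lt_one.trans hw')
      · exact DirichletCharacter.LSeriesSummable_of_one_lt_re χ hw'
      · apply Asymptotics.IsBigO.of_bound q
        filter_upwards with n
        simpa using norm_sum_char_le hχ n
  rw [hEq hs, norm_mul]
  gcongr
  exact norm_integral_bounded_le hB hs

/-- Convexity-type bound for `(s - 1) ζ(s)`. -/
theorem norm_sub_one_mul_riemannZeta_le {s : ℂ} (hs : 0 < s.re) (hs1 : s ≠ 1) :
    ‖(s - 1) * riemannZeta s‖ ≤ ‖s‖ + ‖s - 1‖ * ‖s‖ / s.re := by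
  set S : ℝ → ℂ := fun t => ((Int.fract t : ℝ) : ℂ) with hSdef
  have hB : ∀ t, ‖S t‖ ≤ 1 := fun t => by
    rw [hSdef]
    simp only [Complex.norm_real, Real.norm_eq_abs, abs_of_nonneg (Int.fract_nonneg t)]
    exact (Int.fract_lt_one t).le
  have hSm : Measurable S := Complex.measurable_ofReal.comp measurable_fract
  have hU : IsOpen {s : ℂ | 0 < s.re} := isOpen_lt continuous_const continuous_re
  -- Here partial summation uses ⌊t⌋ = t - {t}; the part from t produces the pole, which the factor
  -- s - 1 cancels.
  have hEq : Set.EqOn (DirichletCharacter.LFunctionTrivChar₁ 1)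
      (fun s => s - (s - 1) * (s * ∫ t in Set.Ioi (1 : ℝ), S t * (t : ℂ) ^ (-(s + 1))))
      {s | 0 < s.re} := by
    refine AnalyticOnNhd.eqOn_of_preconnected_of_eventuallyEq (𝕜 := ℂ) (z₀ := 2) ?_ ?_ ?_ ?_ ?_
    · exact (DirichletCharacter.differentiable_LFunctionTrivChar₁ 1).differentiableOn.analyticOnNhd
        hU
    · exact (differentiableOn_id.sub ((differentiableOn_id.sub_const 1).mul
        (differentiableOn_id.mul (differentiableOn_integral_bounded hSm hB)))).analyticOnNhd hU
    · exact (convex_halfSpace_re_gt 0).isPreconnected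
    · simp
    · have : {s : ℂ | 1 < s.re} ∈ 𝓝 (2 : ℂ) :=
        (isOpen_lt continuous_const continuous_re).mem_nhds (by simp)
      filter_upwards [this] with w hw
      have hw' : 1 < w.re := hw
      have hw1 : w ≠ 1 := by
        rintro rfl
        simp at hw'
      have hw10 : w - 1 ≠ 0 := sub_ne_zero.2 hw1
      rw [DirichletCharacter.LFunctionTrivChar₁, Function.update_of_ne hw1,
        DirichletCharacter.LFunctionTrivChar_eq_mul_riemannZeta hw1]
      simp only [Nat.primeFactors_one, Finset.prod_empty, one_mul]
      have h1 := LSeries_eq_mul_integral' (fun _ => 1) zero_le_one hw' (by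
        apply Asymptotics.IsBigO.of_bound 1
        filter_upwards with n
        simp)
      have h2 : LSeries (fun _ => 1) w = riemannZeta w := LSeries_one_eq_riemannZeta hw'
      rw [← h2, h1]
      have h3 : ∫ t in Set.Ioi (1 : ℝ), (∑ k ∈ Finset.Icc 1 ⌊t⌋₊, (1 : ℂ)) * (t : ℂ) ^ (-(w + 1)) =
          (∫ t in Set.Ioi (1 : ℝ), (t : ℂ) ^ (-w)) -
          ∫ t in Set.Ioi (1 : ℝ), S t * (t : ℂ) ^ (-(w + 1)) := by
        rw [← integral_sub]
        · apply setIntegral_congr_fun measurableSet_Ioi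
          intro t ht
          have ht0 : (0 : ℝ) < t := zero_lt_one.trans ht
          have ht0' : (t : ℂ) ≠ 0 := ofReal_ne_zero.2 ht0.ne'
          have h4 : (t : ℂ) ^ (-w) = t * (t : ℂ) ^ (-(w + 1)) := by
            rw [show -w = 1 + -(w + 1) by ring, Complex.cpow_add _ _ ht0', Complex.cpow_one]
          have h5 : ((⌊t⌋₊ : ℕ) : ℂ) = t - S t := by
            have h6 : ((⌊t⌋₊ : ℕ) : ℝ) = t - Int.fract t := by
              rw [natCast_floor_eq_intCast_floor ht0.le, Int.self_sub_fract]
            rw [hSdef]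
            simp only
            exact_mod_cast congrArg (fun x : ℝ => (x : ℂ)) h6
          simp only [Finset.sum_const, Nat.card_Icc, add_tsub_cancel_right, nsmul_eq_mul, mul_one]
          rw [h4, h5]
          ring
        · exact integrableOn_Ioi_cpow_of_lt (by simpa using hw') one_pos
        · apply Integrable.mono' (g := fun t : ℝ => t ^ (-(w.re + 1)))
            (integrableOn_Ioi_rpow_of_lt (by linarith) one_pos)
          · apply (hSm.aestronglyMeasurable).mul
            apply (ContinuousOn.aestronglyMeasurable _ measurableSet_Ioi)
            intro t ht
            exact (continuousAt_ofReal_cpow_const _ _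
              (Or.inr (zero_lt_one.trans ht).ne')).continuousWithinAt
          · filter_upwards [ae_restrict_mem measurableSet_Ioi] with t ht
            rw [norm_mul, Complex.norm_cpow_eq_rpow_re_of_pos (zero_lt_one.trans ht)]
            have : 0 ≤ t ^ (-(w + 1)).re := Real.rpow_nonneg (zero_lt_one.trans ht).le _
            calc ‖S t‖ * t ^ (-(w + 1)).re ≤ 1 * t ^ (-(w + 1)).re := by gcongr; exact hB t
              _ = _ := by simp
      rw [h3, integral_Ioi_cpow_of_lt (by simpa using hw') one_pos]
      simp only [ofReal_one, one_cpow]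
      have h7 : -w + 1 ≠ 0 := by
        intro h
        apply hw10
        linear_combination -h
      field_simp
      ring
  have h := hEq hs
  rw [DirichletCharacter.LFunctionTrivChar₁, Function.update_of_ne hs1,
    DirichletCharacter.LFunctionTrivChar_eq_mul_riemannZeta hs1] at h
  simp only [Nat.primeFactors_one, Finset.prod_empty, one_mul] at h
  rw [h]
  refine (norm_sub_le _ _).trans ?_
  rw [norm_mul, norm_mul, mul_div_assoc]
  have := norm_integral_bounded_le hB hs
  gcongr
  calc ‖s‖ * ‖∫ t in Set.Ioi (1 : ℝ), S t * (t : ℂ) ^ (-(s + 1))‖ ≤ ‖s‖ * (1 / s.re) := by gcongr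
    _ = ‖s‖ / s.re := by ring

theorem norm_cpow_neg_lt_one {p : ℕ} (hp : 1 < p) {s : ℂ} (hs : 0 < s.re) :
    ‖(p : ℂ) ^ (-s)‖ < 1 := by
  rw [Complex.norm_natCast_cpow_of_pos (by omega)]
  exact Real.rpow_lt_one_of_one_lt_of_neg (by exact_mod_cast hp) (by simpa using hs)

/-- Under GRH, the `L`-function of any Dirichlet character is zero-free on `Re s > 1/2`. -/
theorem LFunction_ne_zero_of_GRH (hGRH : GRH) {q : ℕ} [NeZero q] (χ : DirichletCharacter ℂ q)
    {s : ℂ} (hs : 1 / 2 < s.re) (h : χ ≠ 1 ∨ s ≠ 1) : DirichletCharacter.LFunction χ s ≠ 0 := by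
  rcases le_or_gt 1 s.re with h1 | h1
  · exact DirichletCharacter.LFunction_ne_zero_of_one_le_re χ h h1
  · have hs1 : s ≠ 1 := by
      rintro rfl
      simp at h1
    have : NeZero χ.conductor := ⟨χ.conductor_ne_zero⟩
    -- GRH concerns primitive characters only. Passing to the inducing character removes Euler
    -- factors 1 - χ(p)p^(-s), which cannot vanish because |χ(p)p^(-s)| < 1.
    rw [← DirichletCharacter.changeLevel_primitiveCharacter χ,
      DirichletCharacter.LFunction_changeLevel _ _ (Or.inr hs1)]
    apply mul_ne_zero
    · intro h0
      have := hGRH _ _ χ.primitiveCharacter_isPrimitive s h0 (by linarith) h1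
      linarith
    · refine Finset.prod_ne_zero_iff.2 fun p hp h0 => ?_
      have hp' := (Nat.prime_of_mem_primeFactors hp).one_lt
      have h2 : ‖χ.primitiveCharacter p * (p : ℂ) ^ (-s)‖ < 1 := by
        rw [norm_mul]
        have h3 := norm_cpow_neg_lt_one hp' (by linarith : 0 < s.re)
        have h4 := χ.primitiveCharacter.norm_le_one p
        nlinarith [norm_nonneg ((p : ℂ) ^ (-s))]
      rw [← sub_eq_zero.1 h0] at h2
      simp at h2

/-- Each factor has norm below 2 ≤ p, and the product of the primes dividing q divides q. This
controls the Euler factors separating ζ from the L-function of the trivial character. -/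
theorem norm_prod_one_sub_cpow_le {q : ℕ} (hq : q ≠ 0) {s : ℂ} (hs : 0 < s.re) :
    ‖∏ p ∈ q.primeFactors, (1 - (p : ℂ) ^ (-s))‖ ≤ q := by
  rw [norm_prod]
  calc ∏ p ∈ q.primeFactors, ‖1 - (p : ℂ) ^ (-s)‖ ≤ ∏ p ∈ q.primeFactors, (p : ℝ) := by
        apply Finset.prod_le_prod (fun _ _ => norm_nonneg _)
        intro p hp
        have hp' := (Nat.prime_of_mem_primeFactors hp).two_le
        have h1 := norm_cpow_neg_lt_one (show 1 < p by omega) hs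
        have h2 := norm_sub_le (1 : ℂ) ((p : ℂ) ^ (-s))
        rw [norm_one] at h2
        have h3 : (2 : ℝ) ≤ p := by exact_mod_cast hp'
        linarith
    _ ≤ q := by
        rw [← Nat.cast_prod]
        exact Nat.cast_le.2 (Nat.le_of_dvd (Nat.pos_of_ne_zero hq) (Nat.prod_primeFactors_dvd q))

/-- Comparison with the series of n^(-3/2). Applied to χ it bounds L from above, applied to χμ it
bounds 1/L, uniformly in the modulus. -/
theorem exists_norm_LSeries_le :
    ∃ b : ℝ, 1 ≤ b ∧ ∀ f : ℕ → ℂ, (∀ n, ‖f n‖ ≤ 1) → ∀ s : ℂ, 3 / 2 < s.re → ‖LSeries f s‖ ≤ b := by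
  have hsum : Summable fun n : ℕ => 1 / (n : ℝ) ^ (3 / 2 : ℝ) :=
    Real.summable_one_div_nat_rpow.2 (by norm_num)
  refine ⟨max 1 (∑' n : ℕ, 1 / (n : ℝ) ^ (3 / 2 : ℝ)), le_max_left _ _, fun f hf s hs => ?_⟩
  refine le_max_of_le_right (tsum_of_norm_bounded hsum.hasSum fun n => ?_)
  rcases eq_or_ne n 0 with rfl | hn
  · simp
  · rw [LSeries.norm_term_eq, if_neg hn]
    have h1 : (1 : ℝ) ≤ n := by exact_mod_cast Nat.one_le_iff_ne_zero.2 hn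
    have h2 : (n : ℝ) ^ (3 / 2 : ℝ) ≤ (n : ℝ) ^ s.re := Real.rpow_le_rpow_of_exponent_le h1 hs.le
    have h3 : 0 < (n : ℝ) ^ (3 / 2 : ℝ) := by positivity
    gcongr
    exact hf n

theorem norm_moebius_mul_char_le {q : ℕ} (χ : DirichletCharacter ℂ q) (n : ℕ) :
    ‖χ n * (ArithmeticFunction.moebius n : ℂ)‖ ≤ 1 := by
  rw [norm_mul]
  have h1 := χ.norm_le_one n
  have h2 : ‖(ArithmeticFunction.moebius n : ℂ)‖ ≤ 1 := by
    rw [Complex.norm_intCast]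
    exact_mod_cast ArithmeticFunction.abs_moebius_le_one
  nlinarith [norm_nonneg (χ n)]

theorem LFunction_mul_LSeries_moebius {q : ℕ} [NeZero q] (χ : DirichletCharacter ℂ q) {s : ℂ}
    (hs : 1 < s.re) :
    DirichletCharacter.LFunction χ s *
      LSeries (fun n => χ n * (ArithmeticFunction.moebius n : ℂ)) s = 1 := by
  rw [DirichletCharacter.LFunction_eq_LSeries χ hs]
  exact DirichletCharacter.LSeries.mul_mu_eq_one χ hs

/-- Under GRH, `1 / L(s, χ)` continues holomorphically to `Re s > 1/2` with a Lindelöf bound that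
is uniform in the modulus. -/
theorem exists_inv_LFunction_bound (hGRH : GRH) {δ ε : ℝ} (hδ : 0 < δ) (hδ' : δ < 1)
    (hε : 0 < ε) :
    ∃ C : ℝ, 0 < C ∧ ∀ (q : ℕ) [NeZero q] (χ : DirichletCharacter ℂ q), ∃ G : ℂ → ℂ,
      DifferentiableOn ℂ G {s | 1 / 2 < s.re} ∧
      (∀ s : ℂ, 1 < s.re → G s = LSeries (fun n => χ n * (ArithmeticFunction.moebius n : ℂ)) s) ∧
      ∀ s : ℂ, 1 / 2 + δ ≤ s.re → s.re ≤ 5 / 2 → ‖G s‖ ≤ C * (q * (|s.im| + 2)) ^ ε := by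
  obtain ⟨b, hb1, hb⟩ := exists_norm_LSeries_le
  -- The factor 10 leaves room for the polynomial bounds 7q(|t| + 2) and 6q(|t| + 2) below and for
  -- the loss of 5 in comparing s - 1 with s + 1.
  obtain ⟨C, hC, hmain⟩ := norm_inv_le_of_zero_free (b := 10 * b) hδ hδ' hε (by linarith)
  have hnorm : ∀ s : ℂ, 1 / 2 < s.re → s.re < 6 → ‖s‖ ≤ 3 * (|s.im| + 2) := fun s h1 h2 => by
    have h3 := Complex.norm_le_abs_re_add_abs_im s
    rw [abs_of_pos (by linarith)] at h3
    linarith [abs_nonneg s.im]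
  have hq1 : ∀ (q : ℕ) [NeZero q], (1 : ℝ) ≤ q := fun q _ => by
    exact_mod_cast NeZero.one_le
  have hL : ∀ (q : ℕ) [NeZero q] (χ : DirichletCharacter ℂ q) (s : ℂ), 3 / 2 < s.re →
      b⁻¹ ≤ ‖DirichletCharacter.LFunction χ s‖ ∧ ‖DirichletCharacter.LFunction χ s‖ ≤ b := by
    intro q _ χ s hs
    constructor
    · have h1 := LFunction_mul_LSeries_moebius χ (by linarith : 1 < s.re)
      have h2 := hb _ (norm_moebius_mul_char_le χ) s hs
      have h3 := congrArg norm h1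
      rw [norm_mul, norm_one] at h3
      rw [inv_le_iff_one_le_mul₀ (by linarith)]
      have := norm_nonneg (DirichletCharacter.LFunction χ s)
      nlinarith
    · rw [DirichletCharacter.LFunction_eq_LSeries χ (by linarith)]
      exact hb _ (fun n => χ.norm_le_one n) s hs
  have hbinv : (10 * b)⁻¹ ≤ b⁻¹ / 5 := by
    rw [mul_inv]
    have : 0 < b⁻¹ := by positivity
    norm_num
    linarith
  refine ⟨C, hC, fun q _ χ => ?_⟩
  by_cases hχ : χ = 1
  · subst hχ
    -- For the trivial character, F continues (s - 1)L(s)/(s + 1): the pole is gone, and F is still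
    -- bounded above and below for Re s > 3/2. Since |s - 1| ≤ |s + 1|, a bound for 1/F bounds 1/L.
    set F : ℂ → ℂ := fun s => DirichletCharacter.LFunctionTrivChar₁ q s / (s + 1) with hF
    have hs1 : ∀ s : ℂ, 1 / 2 < s.re → s + 1 ≠ 0 := fun s hs h => by
      have := congrArg Complex.re h
      simp at this
      linarith
    have hne : ∀ s : ℂ, s ≠ 1 → DirichletCharacter.LFunctionTrivChar₁ q s =
        (s - 1) * DirichletCharacter.LFunction (1 : DirichletCharacter ℂ q) s := fun s hs => by
      rw [DirichletCharacter.LFunctionTrivChar₁, Function.update_of_ne hs]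
    have hnz : ∀ s : ℂ, 1 / 2 < s.re → DirichletCharacter.LFunctionTrivChar₁ q s ≠ 0 := by
      intro s hs
      rcases eq_or_ne s 1 with rfl | h1
      · exact DirichletCharacter.LFunctionTrivChar₁_apply_one_ne_zero q
      · rw [hne s h1]
        exact mul_ne_zero (sub_ne_zero.2 h1) (LFunction_ne_zero_of_GRH hGRH _ hs (Or.inr h1))
    have hquot : ∀ s : ℂ, 0 ≤ s.re → ‖s - 1‖ ≤ ‖s + 1‖ := fun s hs => by
      rw [← sq_le_sq₀ (norm_nonneg _) (norm_nonneg _), Complex.sq_norm, Complex.sq_norm,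
        Complex.normSq_apply, Complex.normSq_apply]
      simp
      nlinarith
    have hquot' : ∀ s : ℂ, 0 ≤ s.re → ‖s‖ ≤ ‖s + 1‖ := fun s hs => by
      rw [← sq_le_sq₀ (norm_nonneg _) (norm_nonneg _), Complex.sq_norm, Complex.sq_norm,
        Complex.normSq_apply, Complex.normSq_apply]
      simp
      nlinarith
    have hFd : DifferentiableOn ℂ F {s | 1 / 2 < s.re} :=
      (DirichletCharacter.differentiable_LFunctionTrivChar₁ q).differentiableOn.div (by fun_prop)
        hs1
    refine ⟨fun s => (s - 1) / DirichletCharacter.LFunctionTrivChar₁ q s, ?_, ?_, ?_⟩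
    · exact DifferentiableOn.div (by fun_prop)
        (DirichletCharacter.differentiable_LFunctionTrivChar₁ q).differentiableOn hnz
    · intro s hs
      have h1 : s ≠ 1 := by
        rintro rfl
        simp at hs
      have h2 := LFunction_mul_LSeries_moebius (1 : DirichletCharacter ℂ q) hs
      have h3 := sub_ne_zero.2 h1
      have h4 := LFunction_ne_zero_of_GRH hGRH (1 : DirichletCharacter ℂ q)
        (by linarith : 1 / 2 < s.re) (Or.inr h1)
      change (s - 1) / DirichletCharacter.LFunctionTrivChar₁ q s = _
      rw [hne s h1, div_mul_cancel_left₀ h3, inv_eq_of_mul_eq_one_right h2]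
    · intro s hs hs'
      have h := hmain F q (hq1 q) hFd (fun s hs => div_ne_zero (hnz s hs) (hs1 s hs)) ?_ ?_ s hs hs'
      · refine le_trans ?_ h
        have h1 := hquot s (by linarith)
        have h2 : 0 < ‖s + 1‖ := norm_pos_iff.2 (hs1 s (by linarith))
        simp only [hF, norm_div, inv_div]
        gcongr
      · intro s hs hs6
        have hqr : (1 : ℝ) ≤ q := hq1 q
        have hT : 2 ≤ |s.im| + 2 := by linarith [abs_nonneg s.im]
        have hqT : (q : ℝ) * (|s.im| + 2) ≤ (q * (|s.im| + 2)) ^ 2 := by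
          rw [sq]
          have : 1 ≤ (q : ℝ) * (|s.im| + 2) := by nlinarith
          nlinarith
        have hn1 : 0 < ‖s + 1‖ := norm_pos_iff.2 (hs1 s hs)
        have hX : ‖F s‖ ≤ q * (7 * (|s.im| + 2)) := by
          simp only [hF, norm_div]
          rw [div_le_iff₀ hn1]
          rcases eq_or_ne s 1 with rfl | h1
          · have h2 := norm_prod_one_sub_cpow_le (NeZero.ne q) (s := 1) (by simp)
            simp only [Complex.cpow_neg_one] at h2
            rw [DirichletCharacter.LFunctionTrivChar₁, Function.update_self]
            refine h2.trans ?_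
            norm_num
            linarith
          · rw [hne s h1]
            have h2 := DirichletCharacter.LFunctionTrivChar_eq_mul_riemannZeta (N := q) h1
            rw [DirichletCharacter.LFunctionTrivChar] at h2
            rw [h2, mul_left_comm, norm_mul, mul_assoc]
            have h3 := norm_prod_one_sub_cpow_le (NeZero.ne q) (s := s) (by linarith)
            have h4 := norm_sub_one_mul_riemannZeta_le (s := s) (by linarith) h1
            have h5 := hnorm s hs hs6
            have h6 := hquot s (by linarith)
            have h7 := hquot' s (by linarith)
            gcongr
            refine h4.trans ?_
            calc ‖s‖ + ‖s - 1‖ * ‖s‖ / s.re ≤ ‖s + 1‖ + ‖s + 1‖ * (3 * (|s.im| + 2)) / (1 / 2) := by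
                  gcongr
              _ = (1 + 6 * (|s.im| + 2)) * ‖s + 1‖ := by ring
              _ ≤ 7 * (|s.im| + 2) * ‖s + 1‖ := by
                gcongr
                linarith
        calc ‖F s‖ ≤ 7 * (q * (|s.im| + 2)) := by linarith
          _ ≤ 10 * b * (q * (|s.im| + 2)) ^ 2 := by
            gcongr
            linarith
      · intro s hs
        have h1 : s ≠ 1 := by
          rintro rfl
          norm_num at hs
        have hn1 : 0 < ‖s + 1‖ := norm_pos_iff.2 (hs1 s (by linarith))
        have h2 := hL q 1 s hs
        have h3 := hquot s (by linarith)
        have h4 : 1 / 2 ≤ ‖s - 1‖ := by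
          have := Complex.abs_re_le_norm (s - 1)
          simp only [sub_re, one_re] at this
          linarith [le_abs_self (s.re - 1)]
        have h5 : ‖s + 1‖ ≤ 5 * ‖s - 1‖ := by
          have := norm_add_le (s - 1) 2
          norm_num at this
          rw [show s - 1 + 2 = s + 1 by ring] at this
          linarith
        have hbi : 0 < b⁻¹ := by positivity
        simp only [hF, hne s h1, norm_div, norm_mul]
        constructor
        · rw [le_div_iff₀ hn1]
          calc (10 * b)⁻¹ * ‖s + 1‖ ≤ b⁻¹ / 5 * (5 * ‖s - 1‖) := by gcongr
            _ = ‖s - 1‖ * b⁻¹ := by ring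
            _ ≤ _ := by gcongr; exact h2.1
        · rw [div_le_iff₀ hn1]
          calc _ ≤ ‖s + 1‖ * b := by gcongr; exact h2.2
            _ ≤ 10 * b * ‖s + 1‖ := by nlinarith
  · have hnz : ∀ s : ℂ, 1 / 2 < s.re → DirichletCharacter.LFunction χ s ≠ 0 := fun s hs =>
      LFunction_ne_zero_of_GRH hGRH χ hs (Or.inl hχ)
    have hd : DifferentiableOn ℂ (DirichletCharacter.LFunction χ) {s | 1 / 2 < s.re} :=
      (DirichletCharacter.differentiable_LFunction hχ).differentiableOn
    refine ⟨fun s => (DirichletCharacter.LFunction χ s)⁻¹, hd.inv hnz, ?_, ?_⟩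
    · intro s hs
      exact inv_eq_of_mul_eq_one_right (LFunction_mul_LSeries_moebius χ hs)
    · intro s hs hs'
      rw [norm_inv]
      refine hmain _ q (hq1 q) hd hnz ?_ ?_ s hs hs'
      · intro s hs hs6
        have h1 := norm_LFunction_le hχ (s := s) (by linarith)
        have h2 := hnorm s hs hs6
        have hqr : (1 : ℝ) ≤ q := hq1 q
        have hT : 2 ≤ |s.im| + 2 := by linarith [abs_nonneg s.im]
        have hqT : (q : ℝ) * (|s.im| + 2) ≤ (q * (|s.im| + 2)) ^ 2 := by
          rw [sq]
          have : 1 ≤ (q : ℝ) * (|s.im| + 2) := by nlinarith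
          nlinarith
        calc _ ≤ ‖s‖ * (q / s.re) := h1
          _ ≤ 3 * (|s.im| + 2) * (q / (1 / 2)) := by gcongr
          _ = 6 * (q * (|s.im| + 2)) := by ring
          _ ≤ 10 * b * (q * (|s.im| + 2)) ^ 2 := by
            gcongr
            linarith
      · intro s hs
        have h1 := hL q χ s hs
        have hbi : 0 < b⁻¹ := by positivity
        exact ⟨by linarith [h1.1], by linarith [h1.2]⟩

/-! ### Perron's formula and Möbius sums twisted by characters -/

/-- The triangular cutoff `max (1 - t) 0`, whose Mellin transform is `1 / (s (s + 1))`. -/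
noncomputable def rieszWeight (t : ℝ) : ℂ := ((max (1 - t) 0 : ℝ) : ℂ)

/-- On (0, ∞) the weight is the indicator of (0, 1] minus t times it, so the transform is 1/s - 1/(s
+ 1). The quadratic decay makes Mellin inversion absolutely convergent. -/
theorem hasMellin_rieszWeight {s : ℂ} (hs : 0 < s.re) :
    HasMellin rieszWeight s (1 / (s * (s + 1))) := by
  have h1 := hasMellin_one_Ioc hs
  have h2 := hasMellin_cpow_Ioc 1 (s := s) (by simp; linarith)
  have h := hasMellin_sub h1.1 h2.1
  have hs0 : s ≠ 0 := by
    rintro rfl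
    simp at hs
  have hs1 : s + 1 ≠ 0 := fun h => by
    have := congrArg Complex.re h
    simp at this
    linarith
  have hval : 1 / s - 1 / (s + 1) = 1 / (s * (s + 1)) := by
    field_simp
    ring
  rw [h1.2, h2.2, hval] at h
  have heq : Set.EqOn rieszWeight (fun t => (Set.Ioc 0 1).indicator (fun _ => (1 : ℂ)) t -
      (Set.Ioc 0 1).indicator (fun t : ℝ => (t : ℂ) ^ (1 : ℂ)) t) (Set.Ioi 0) := fun t ht => by
    by_cases h1 : t ≤ 1
    · have hm : t ∈ Set.Ioc (0 : ℝ) 1 := ⟨ht, h1⟩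
      simp only [Set.indicator_of_mem hm, rieszWeight, Complex.cpow_one]
      rw [max_eq_left (by linarith)]
      push_cast
      rfl
    · have hm : t ∉ Set.Ioc (0 : ℝ) 1 := fun h => h1 h.2
      simp only [Set.indicator_of_notMem hm, rieszWeight]
      rw [max_eq_right (by linarith)]
      simp
  constructor
  · refine h.1.congr_fun (fun t ht => ?_) measurableSet_Ioi
    simp only [heq ht]
  · rw [← h.2]
    refine setIntegral_congr_fun measurableSet_Ioi (fun t ht => ?_)
    simp only [heq ht]

theorem one_add_abs_le_norm {a : ℝ} (ha : 0 < a) (ha1 : a ≤ 1) {s : ℂ} (hs : a ≤ s.re) :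
    a / 2 * (1 + |s.im|) ≤ ‖s‖ := by
  have h1 := Complex.abs_im_le_norm s
  have h2 := (le_abs_self _).trans (Complex.abs_re_le_norm s)
  nlinarith [abs_nonneg s.im]

theorem integrable_one_add_abs_rpow {p : ℝ} (hp : 1 < p) :
    Integrable fun t : ℝ => (1 + |t|) ^ (-p) := by
  simpa using integrable_one_add_norm (E := ℝ) (μ := volume) (r := p) (by simpa using hp)

theorem integrable_riesz_kernel :
    Integrable fun t : ℝ => 1 / (((2 : ℝ) + t * I : ℂ) * ((2 : ℝ) + t * I + 1)) := by
  have hne : ∀ t : ℝ, ((2 : ℝ) + t * I : ℂ) * ((2 : ℝ) + t * I + 1) ≠ 0 := fun t => by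
    apply mul_ne_zero <;> intro h <;> have := congrArg Complex.re h <;> norm_num at this
  have hc : Continuous fun t : ℝ => 1 / (((2 : ℝ) + t * I : ℂ) * ((2 : ℝ) + t * I + 1)) :=
    continuous_const.div (by fun_prop) hne
  refine ((integrable_one_add_abs_rpow (p := 2) (by norm_num)).const_mul 4).mono'
    hc.aestronglyMeasurable (Eventually.of_forall fun t => ?_)
  have h1 := one_add_abs_le_norm one_pos le_rfl (s := (2 : ℝ) + t * I) (by simp)
  have h2 := one_add_abs_le_norm one_pos le_rfl (s := (2 : ℝ) + t * I + 1) (by simp)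
  simp only [add_im, ofReal_im, mul_im, ofReal_re, I_im, I_re, one_im, mul_one, mul_zero, add_zero,
    zero_add] at h1 h2
  have h0 : 0 < 1 + |t| := by positivity
  rw [norm_div, norm_one, norm_mul, Real.rpow_neg h0.le, Real.rpow_ofNat, div_le_iff₀ (by
    rw [← norm_mul]
    exact norm_pos_iff.2 (hne t))]
  have h3 : (1 / 2 * (1 + |t|)) * (1 / 2 * (1 + |t|)) ≤
      ‖((2 : ℝ) + t * I : ℂ)‖ * ‖((2 : ℝ) + t * I + 1 : ℂ)‖ := by gcongr
  calc (1 : ℝ) = 4 * ((1 + |t|) ^ 2)⁻¹ * ((1 / 2 * (1 + |t|)) * (1 / 2 * (1 + |t|))) := by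
        field_simp
        norm_num
    _ ≤ _ := by gcongr

/-- Perron's formula for the triangular cutoff. -/
theorem rieszWeight_eq_integral {u : ℝ} (hu : 0 < u) :
    rieszWeight u = (1 / (2 * Real.pi) : ℂ) * ∫ t : ℝ, (u : ℂ) ^ (-((2 : ℝ) + t * I : ℂ)) *
      (1 / (((2 : ℝ) + t * I : ℂ) * ((2 : ℝ) + t * I + 1))) := by
  have hm : ∀ t : ℝ, mellin rieszWeight ((2 : ℝ) + t * I) =
      1 / (((2 : ℝ) + t * I : ℂ) * ((2 : ℝ) + t * I + 1)) := fun t =>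
    (hasMellin_rieszWeight (by simp)).2
  have h := mellinInv_mellin_eq 2 rieszWeight hu (hasMellin_rieszWeight (by simp)).1
    (by
      rw [VerticalIntegrable]
      simp only [hm]
      exact integrable_riesz_kernel)
    (by
      unfold rieszWeight
      fun_prop)
  rw [← h, mellinInv]
  simp only [hm, smul_eq_mul]
  rw [Complex.real_smul]
  push_cast
  rfl

/-- Riesz means of a Dirichlet series with bounded coefficients. -/
theorem riesz_mean_eq_integral {b : ℕ → ℂ} (hb : ∀ n, ‖b n‖ ≤ 1) (hb0 : b 0 = 0) {x : ℝ}
    (hx : 0 < x) {G : ℂ → ℂ} (hG : ∀ s : ℂ, 1 < s.re → G s = LSeries b s) :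
    HasSum (fun m : ℕ => b m / (√(m : ℝ) : ℂ) * (max (x - m) 0 : ℝ))
      ((1 / (2 * Real.pi) : ℂ) * ∫ t : ℝ, G ((2 : ℝ) + t * I + 1 / 2) *
        ((x : ℂ) ^ ((2 : ℝ) + t * I + 1) / (((2 : ℝ) + t * I : ℂ) * ((2 : ℝ) + t * I + 1)))) := by
  have hxc : (x : ℂ) ≠ 0 := ofReal_ne_zero.2 hx.ne'
  set k : ℝ → ℂ := fun t => 1 / (((2 : ℝ) + t * I : ℂ) * ((2 : ℝ) + t * I + 1)) with hk
  set F : ℕ → ℝ → ℂ := fun m t => b m / (√(m : ℝ) : ℂ) * x *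
    ((((m / x : ℝ) : ℂ)) ^ (-((2 : ℝ) + t * I : ℂ)) * k t) with hF
  have hnorm : ∀ (m : ℕ) (t : ℝ), m ≠ 0 →
      ‖(((m / x : ℝ) : ℂ)) ^ (-((2 : ℝ) + t * I : ℂ)) * k t‖ = (m / x) ^ (-2 : ℝ) * ‖k t‖ := by
    intro m t hm
    have : 0 < (m / x : ℝ) := by positivity
    rw [norm_mul, Complex.norm_cpow_eq_rpow_re_of_pos this]
    simp
  have hFint : ∀ m, Integrable (F m) := fun m => by
    rcases eq_or_ne m 0 with rfl | hm
    · simp [hF, hb0]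
    · apply Integrable.const_mul
      have hmx : (((m / x : ℝ) : ℂ)) ≠ 0 := ofReal_ne_zero.2 (by positivity)
      have hc : Continuous fun t : ℝ => (((m / x : ℝ) : ℂ)) ^ (-((2 : ℝ) + t * I : ℂ)) :=
        Continuous.const_cpow (by fun_prop) (Or.inl hmx)
      refine (integrable_riesz_kernel.norm.const_mul ((m / x : ℝ) ^ (-2 : ℝ))).mono'
        (hc.aestronglyMeasurable.mul integrable_riesz_kernel.aestronglyMeasurable)
        (Eventually.of_forall fun t => ?_)
      exact (hnorm m t hm).le
  have hsum : Summable fun m => ∫ t, ‖F m t‖ := by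
    have h2 : Summable fun m : ℕ => 1 / (m : ℝ) ^ (2 : ℝ) :=
      Real.summable_one_div_nat_rpow.2 (by norm_num)
    refine Summable.of_nonneg_of_le (fun m => integral_nonneg fun t => norm_nonneg _) (fun m => ?_)
      (h2.mul_left (x * x ^ (2 : ℝ) * ∫ t, ‖k t‖))
    rcases eq_or_ne m 0 with rfl | hm
    · simp [hF, hb0]
    · simp only [hF, norm_mul (b m / _ * _), hnorm m _ hm]
      rw [integral_const_mul, integral_const_mul]
      have h3 : ‖b m / (√(m : ℝ) : ℂ) * x‖ ≤ x := by
        rw [norm_mul, norm_div, Complex.norm_real, Complex.norm_real, Real.norm_of_nonneg hx.le,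
          Real.norm_of_nonneg (Real.sqrt_nonneg _)]
        have h4 : 1 ≤ √(m : ℝ) := Real.one_le_sqrt.2 (by exact_mod_cast Nat.one_le_iff_ne_zero.2 hm)
        have h5 : ‖b m‖ / √(m : ℝ) ≤ 1 := by
          rw [div_le_one (by linarith)]
          exact (hb m).trans h4
        nlinarith
      have h6 : (m / x : ℝ) ^ (-2 : ℝ) = x ^ (2 : ℝ) * (1 / (m : ℝ) ^ (2 : ℝ)) := by
        rw [Real.rpow_neg (by positivity), Real.div_rpow (by positivity) hx.le]
        field_simp
      rw [h6]
      have h7 : 0 ≤ ∫ t, ‖k t‖ := integral_nonneg fun t => norm_nonneg _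
      calc _ ≤ x * (x ^ (2 : ℝ) * (1 / (m : ℝ) ^ (2 : ℝ)) * ∫ t, ‖k t‖) := by gcongr
        _ = _ := by ring
  have key := hasSum_integral_of_summable_integral_norm hFint hsum
  have key2 := key.mul_left (1 / (2 * Real.pi) : ℂ)
  have hterm : (fun m : ℕ => b m / (√(m : ℝ) : ℂ) * (max (x - m) 0 : ℝ)) =
      fun m => (1 / (2 * Real.pi) : ℂ) * ∫ t, F m t := by
    funext m
    rcases eq_or_ne m 0 with rfl | hm
    · simp [hF, hb0]
    · simp only [hF]
      rw [integral_const_mul, mul_left_comm, ← rieszWeight_eq_integral (by positivity), rieszWeight,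
        mul_assoc]
      congr 1
      rw [← ofReal_mul, mul_max_of_nonneg _ _ hx.le]
      congr 2
      · field_simp
      · simp
  -- The shift by 1/2 in the argument of G accounts for the weight 1/√m.
  have hintegrand : (fun t : ℝ => G ((2 : ℝ) + t * I + 1 / 2) *
      ((x : ℂ) ^ ((2 : ℝ) + t * I + 1) / (((2 : ℝ) + t * I : ℂ) * ((2 : ℝ) + t * I + 1)))) =
      fun t => ∑' m, F m t := by
    funext t
    rw [hG _ (by simp; norm_num), LSeries, ← tsum_mul_right]
    congr 1
    funext m
    rcases eq_or_ne m 0 with rfl | hm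
    · simp [hF, hb0]
    · have hmc : (m : ℂ) ≠ 0 := Nat.cast_ne_zero.2 hm
      have hm0 : (0 : ℝ) < m := by positivity
      have hsq : (√(m : ℝ) : ℂ) = (m : ℂ) ^ (1 / 2 : ℂ) := by
        rw [Real.sqrt_eq_rpow, ofReal_cpow hm0.le]
        simp
      simp only [hF, hk]
      rw [LSeries.term_of_ne_zero hm, Complex.cpow_add _ _ hmc, hsq, Complex.cpow_add _ _ hxc,
        Complex.cpow_one, Complex.cpow_neg, ofReal_div, Complex.div_cpow_ofReal_nonneg hm0.le hx.le]
      simp only [ofReal_natCast]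
      have h1 : (m : ℂ) ^ (((2 : ℝ) : ℂ) + t * I) ≠ 0 := by simp [Complex.cpow_eq_zero_iff, hmc]
      have h2 : (x : ℂ) ^ (((2 : ℝ) : ℂ) + t * I) ≠ 0 := by simp [Complex.cpow_eq_zero_iff, hxc]
      have h3 : (m : ℂ) ^ (1 / 2 : ℂ) ≠ 0 := by simp [Complex.cpow_eq_zero_iff, hmc]
      field_simp
  rw [hterm, hintegrand]
  exact key2

/-- Shifting a vertical line of integration. -/
theorem integral_vertical_eq {f : ℂ → ℂ} {a b B p : ℝ} (hab : a ≤ b) (hp : 1 < p)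
    (hf : DifferentiableOn ℂ f (Set.Icc a b ×ℂ Set.univ))
    (hB : ∀ s : ℂ, a ≤ s.re → s.re ≤ b → ‖f s‖ ≤ B * (1 + |s.im|) ^ (-p)) :
    ∫ t : ℝ, f (a + t * I) = ∫ t : ℝ, f (b + t * I) := by
  have hline : ∀ c : ℝ, a ≤ c → c ≤ b → Integrable fun t : ℝ => f (c + t * I) := by
    intro c hac hcb
    have hc : Continuous fun t : ℝ => f (c + t * I) := by
      apply hf.continuousOn.comp_continuous (by fun_prop)
      intro t
      simp [mem_reProdIm, hac, hcb]
    refine ((integrable_one_add_abs_rpow hp).const_mul B).mono' hc.aestronglyMeasurable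
      (Eventually.of_forall fun t => ?_)
    simpa using hB (c + t * I) (by simpa using hac) (by simpa using hcb)
  have hlim : ∀ c : ℝ, a ≤ c → c ≤ b →
      Tendsto (fun T : ℝ => ∫ t in (-T)..T, f (c + t * I)) atTop (𝓝 (∫ t : ℝ, f (c + t * I))) :=
    fun c h1 h2 => intervalIntegral_tendsto_integral (hline c h1 h2) tendsto_neg_atTop_atBot
      tendsto_id
  have hdecay : Tendsto (fun T : ℝ => B * (1 + |T|) ^ (-p) * |b - a|) atTop (𝓝 0) := by
    have h1 : Tendsto (fun T : ℝ => (1 + |T|) ^ (-p)) atTop (𝓝 0) :=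
      (tendsto_rpow_neg_atTop (by linarith)).comp
        (tendsto_atTop_add_const_left _ _ tendsto_abs_atTop_atTop)
    simpa using (h1.const_mul B).mul_const |b - a|
  have hhor : ∀ y : ℝ, ‖∫ x in a..b, f (x + y * I)‖ ≤ B * (1 + |y|) ^ (-p) * |b - a| := by
    intro y
    apply intervalIntegral.norm_integral_le_of_norm_le_const
    intro x hx
    rw [Set.uIoc_of_le hab] at hx
    simpa using hB (x + y * I) (by simpa using hx.1.le) (by simpa using hx.2)
  have hdiff : Tendsto (fun T : ℝ => (∫ t in (-T)..T, f (b + t * I)) -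
      ∫ t in (-T)..T, f (a + t * I)) atTop (𝓝 0) := by
    rw [tendsto_zero_iff_norm_tendsto_zero]
    refine squeeze_zero (fun _ => norm_nonneg _) (fun T => ?_)
      (by simpa using hdecay.add hdecay)
    have h := integral_boundary_rect_eq_zero_of_differentiableOn f (a + (-T : ℝ) * I) (b + T * I)
      (hf.mono fun s hs => by
        simp [mem_reProdIm] at hs ⊢
        rw [Set.uIcc_of_le hab] at hs
        exact hs.1)
    simp only [add_re, ofReal_re, mul_re, I_re, mul_zero, ofReal_im, I_im, mul_one, sub_self,
      add_zero, add_im, mul_im, zero_add, smul_eq_mul] at h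
    have h2 : I * ((∫ t in (-T)..T, f (b + t * I)) - ∫ t in (-T)..T, f (a + t * I)) =
        (∫ x in a..b, f (x + T * I)) - ∫ x in a..b, f (x + (-T : ℝ) * I) := by
      linear_combination h
    have h3 := congrArg norm h2
    rw [norm_mul, norm_I, one_mul] at h3
    rw [h3]
    refine (norm_sub_le _ _).trans (add_le_add (hhor T) ?_)
    simpa using hhor (-T)
  have := (hlim b hab le_rfl).sub (hlim a le_rfl hab)
  exact (sub_eq_zero.1 (tendsto_nhds_unique this hdiff)).symm

/-- The Mellin transform of the sharp cutoff at the integer `N`, linearly interpolated on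
`[N, N + 1]`. -/
noncomputable def cutoffKernel (N : ℕ) (s : ℂ) : ℂ :=
  (((N : ℂ) + 1) ^ (s + 1) - (N : ℂ) ^ (s + 1)) / (s * (s + 1))

/-- The mean value theorem bounds the kernel by (N + 1)^σ/|s|, with σ = Re s, and the triangle
inequality gives the same bound times R = 4(N + 1)/(1 + |t|). Hence it holds with R^κ: an extra
decay |t|^(-κ), which makes the integral converge, costs only N^κ. -/
theorem norm_cutoffKernel_le {N : ℕ} (hN : 1 ≤ N) {a κ : ℝ} (ha : 0 < a) (ha1 : a ≤ 1) (hκ : 0 < κ)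
    (hκ1 : κ ≤ 1) {s : ℂ} (hs : a ≤ s.re) :
    ‖cutoffKernel N s‖ ≤
      ((N : ℝ) + 1) ^ s.re * (4 * ((N : ℝ) + 1)) ^ κ * (2 / a) * (1 + |s.im|) ^ (-(1 + κ)) := by
  have hN0 : (0 : ℝ) < N := by exact_mod_cast hN
  have ht : 0 < 1 + |s.im| := by positivity
  have hs0 := one_add_abs_le_norm ha ha1 hs
  have hs1 : 1 / 2 * (1 + |s.im|) ≤ ‖s + 1‖ := by
    have := one_add_abs_le_norm one_pos le_rfl (s := s + 1) (by simp; linarith)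
    simpa using this
  have hsp : 0 < ‖s‖ := lt_of_lt_of_le (by positivity) hs0
  have hs1p : 0 < ‖s + 1‖ := lt_of_lt_of_le (by positivity) hs1
  have hn1 : ‖((N : ℂ) + 1) ^ (s + 1)‖ = ((N : ℝ) + 1) ^ s.re * ((N : ℝ) + 1) := by
    have h := Complex.norm_cpow_eq_rpow_re_of_pos (show (0 : ℝ) < (N : ℝ) + 1 by positivity) (s + 1)
    push_cast at h
    rw [h, add_re, one_re, Real.rpow_add_one (by positivity)]
  have hn2 : ‖(N : ℂ) ^ (s + 1)‖ ≤ ((N : ℝ) + 1) ^ s.re * ((N : ℝ) + 1) := by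
    have h := Complex.norm_cpow_eq_rpow_re_of_pos hN0 (s + 1)
    push_cast at h
    rw [h, add_re, one_re, Real.rpow_add_one (by positivity)]
    have : 0 ≤ s.re := by linarith
    gcongr <;> linarith
  have hA : ‖cutoffKernel N s‖ ≤ ((N : ℝ) + 1) ^ s.re / ‖s‖ := by
    have hder : ∀ u ∈ Set.Icc (N : ℝ) (N + 1), HasDerivWithinAt (fun u : ℝ => (u : ℂ) ^ (s + 1))
        ((s + 1) * (u : ℂ) ^ s) (Set.Icc (N : ℝ) (N + 1)) u := fun u hu => by
      have hu0 : u ≠ 0 := by linarith [hu.1]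
      have h := hasDerivAt_ofReal_cpow_const hu0 (norm_pos_iff.1 hs1p)
      rw [add_sub_cancel_right] at h
      exact h.hasDerivWithinAt
    have h := (convex_Icc (N : ℝ) (N + 1)).norm_image_sub_le_of_norm_hasDerivWithin_le
      (C := ‖s + 1‖ * ((N : ℝ) + 1) ^ s.re) hder ?_
      (Set.left_mem_Icc.2 (by linarith)) (Set.right_mem_Icc.2 (by linarith))
    · rw [cutoffKernel, norm_div, norm_mul, div_le_div_iff₀ (by positivity) hsp]
      have h' : ‖((N : ℂ) + 1) ^ (s + 1) - (N : ℂ) ^ (s + 1)‖ ≤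
          ‖s + 1‖ * ((N : ℝ) + 1) ^ s.re := by simpa using h
      calc _ ≤ ‖s + 1‖ * ((N : ℝ) + 1) ^ s.re * ‖s‖ := by gcongr
        _ = _ := by ring
    · intro u hu
      have hu0 : 0 < u := by linarith [hu.1]
      rw [norm_mul, Complex.norm_cpow_eq_rpow_re_of_pos hu0]
      have : 0 ≤ s.re := by linarith
      gcongr
      exact hu.2
  set R : ℝ := 4 * ((N : ℝ) + 1) / (1 + |s.im|) with hR
  have hR0 : 0 < R := by positivity
  have hAR : ‖cutoffKernel N s‖ ≤ ((N : ℝ) + 1) ^ s.re / ‖s‖ * R := by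
    rw [cutoffKernel, norm_div, norm_mul]
    calc _ ≤ (((N : ℝ) + 1) ^ s.re * ((N : ℝ) + 1) + ((N : ℝ) + 1) ^ s.re * ((N : ℝ) + 1)) /
          (‖s‖ * (1 / 2 * (1 + |s.im|))) := by
          gcongr
          exact (norm_sub_le _ _).trans (add_le_add hn1.le hn2)
      _ = _ := by
        rw [hR]
        field_simp
        norm_num
  have hmain : ‖cutoffKernel N s‖ ≤ ((N : ℝ) + 1) ^ s.re / ‖s‖ * R ^ κ := by
    rcases le_total 1 R with h | h
    · refine hA.trans (le_mul_of_one_le_right (by positivity) (Real.one_le_rpow h hκ.le))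
    · refine hAR.trans ?_
      gcongr
      simpa using Real.rpow_le_rpow_of_exponent_ge hR0 h hκ1
  refine hmain.trans ?_
  rw [hR, Real.div_rpow (by positivity) ht.le, Real.rpow_neg ht.le, Real.rpow_add ht, Real.rpow_one]
  calc _ ≤ ((N : ℝ) + 1) ^ s.re / (a / 2 * (1 + |s.im|)) *
        ((4 * ((N : ℝ) + 1)) ^ κ / (1 + |s.im|) ^ κ) := by gcongr
    _ = _ := by
      field_simp

/-- Perron's formula with the sharp cutoff at an integer. -/
theorem sum_eq_integral_cutoffKernel {b : ℕ → ℂ} (hb : ∀ n, ‖b n‖ ≤ 1) (hb0 : b 0 = 0) {N : ℕ}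
    (hN : 1 ≤ N) {G : ℂ → ℂ} (hG : ∀ s : ℂ, 1 < s.re → G s = LSeries b s)
    (hi : ∀ x : ℝ, 0 < x → Integrable fun t : ℝ => G ((2 : ℝ) + t * I + 1 / 2) *
        ((x : ℂ) ^ ((2 : ℝ) + t * I + 1) / (((2 : ℝ) + t * I : ℂ) * ((2 : ℝ) + t * I + 1)))) :
    ∑ m ∈ Finset.Icc 1 N, b m / (√(m : ℝ) : ℂ) = (1 / (2 * Real.pi) : ℂ) *
      ∫ t : ℝ, G ((2 : ℝ) + t * I + 1 / 2) * cutoffKernel N ((2 : ℝ) + t * I) := by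
  have hN0 : (0 : ℝ) < N := by exact_mod_cast hN
  have h1 := riesz_mean_eq_integral hb hb0 (show (0 : ℝ) < N + 1 by positivity) hG
  have h2 := riesz_mean_eq_integral hb hb0 hN0 hG
  have h3 := h1.sub h2
  rw [← mul_sub, ← integral_sub (hi _ (by positivity)) (hi _ hN0)] at h3
  have h4 : HasSum (fun m : ℕ => b m / (√(m : ℝ) : ℂ) * (max ((N : ℝ) + 1 - m) 0 : ℝ) -
      b m / (√(m : ℝ) : ℂ) * (max ((N : ℝ) - m) 0 : ℝ))
      (∑ m ∈ Finset.Icc 1 N, b m / (√(m : ℝ) : ℂ)) := by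
    -- The difference of the Riesz weights at N + 1 and N is exactly 1 for m ≤ N and 0 for m ≥ N +
    -- 1, so the cutoff is sharp on integers.
    have h5 : ∀ m : ℕ, b m / (√(m : ℝ) : ℂ) * (max ((N : ℝ) + 1 - m) 0 : ℝ) -
        b m / (√(m : ℝ) : ℂ) * (max ((N : ℝ) - m) 0 : ℝ) =
        if m ∈ Finset.Icc 1 N then b m / (√(m : ℝ) : ℂ) else 0 := fun m => by
      rcases eq_or_ne m 0 with rfl | hm
      · simp [hb0]
      · rw [← mul_sub, ← ofReal_sub]
        by_cases hmN : m ≤ N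
        · have h6 : (m : ℝ) ≤ N := by exact_mod_cast hmN
          rw [if_pos (Finset.mem_Icc.2 ⟨by omega, hmN⟩), max_eq_left (by linarith),
            max_eq_left (by linarith), show (N : ℝ) + 1 - m - (N - m) = 1 by ring]
          simp
        · have h6 : (N : ℝ) + 1 ≤ m := by exact_mod_cast Nat.lt_of_not_le hmN
          rw [if_neg (fun h => hmN (Finset.mem_Icc.1 h).2), max_eq_right (by linarith),
            max_eq_right (by linarith)]
          simp
    simp only [h5]
    have h6 := hasSum_sum_of_ne_finset_zero (L := SummationFilter.unconditional ℕ)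
      (f := fun m : ℕ => if m ∈ Finset.Icc 1 N then b m / (√(m : ℝ) : ℂ) else 0)
      (s := Finset.Icc 1 N)
      (fun m hm => if_neg hm)
    rwa [Finset.sum_congr rfl fun m hm => if_pos hm] at h6
  rw [h4.unique h3]
  congr 2
  funext t
  rw [cutoffKernel]
  push_cast
  ring

/-- Under GRH, `∑_{m ≤ N} μ(m) χ(m) / √m ≪ (q N)^ε` for every Dirichlet character modulo `q`. -/
theorem exists_norm_sum_moebius_char_le (hGRH : GRH) {ε : ℝ} (hε : 0 < ε) :
    ∃ C : ℝ, 0 < C ∧ ∀ (q : ℕ) [NeZero q] (χ : DirichletCharacter ℂ q) (N : ℕ), 1 ≤ N →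
      ‖∑ m ∈ Finset.Icc 1 N, χ m * (ArithmeticFunction.moebius m : ℂ) / (√(m : ℝ) : ℂ)‖ ≤
        C * ((q : ℝ) * N) ^ ε := by
  -- The final power of N is 3η, which must be at most ε.
  set η : ℝ := min ε 1 / 4 with hη
  have hη0 : 0 < η := by positivity
  have hη1 : η ≤ 1 / 4 := by
    have := min_le_right ε 1
    linarith
  have hηε : 3 * η ≤ ε := by
    have := min_le_left ε 1
    linarith
  obtain ⟨C, hC, hmain⟩ := exists_inv_LFunction_bound hGRH hη0 (by linarith) hη0
  obtain ⟨b, hb1, hb⟩ := exists_norm_LSeries_le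
  set J : ℝ := ∫ t : ℝ, (1 + |t|) ^ (-(1 + η)) with hJ
  have hJ0 : 0 ≤ J := integral_nonneg fun t => by positivity
  set D : ℝ := C * 2 * (4 ^ (2 * η)) * (2 / η) with hD
  have hD0 : 0 < D := by positivity
  refine ⟨D * J * 2 + 1, by positivity, fun q _ χ N hN => ?_⟩
  obtain ⟨G, hGd, hGL, hGb⟩ := hmain q χ
  have hq1 : (1 : ℝ) ≤ q := by exact_mod_cast NeZero.one_le
  have hN1 : (1 : ℝ) ≤ N := by exact_mod_cast hN
  have hmem : ∀ s : ℂ, 0 < s.re → 1 / 2 < (s + 1 / 2).re := fun s hs => by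
    simp
    linarith
  have hGd' : DifferentiableOn ℂ (fun s => G (s + 1 / 2)) {s | 0 < s.re} :=
    hGd.comp (by fun_prop) hmem
  have hKd : DifferentiableOn ℂ (cutoffKernel N) {s | 0 < s.re} := by
    have hs0 : ∀ s : ℂ, 0 < s.re → s * (s + 1) ≠ 0 := fun s hs => by
      apply mul_ne_zero <;> intro h <;> have := congrArg Complex.re h <;> simp at this <;> linarith
    intro s hs
    have h1 : ((N : ℂ) + 1) ≠ 0 := by exact_mod_cast Nat.succ_ne_zero N
    have h2 : (N : ℂ) ≠ 0 := by exact_mod_cast (by omega : N ≠ 0)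
    apply DifferentiableAt.differentiableWithinAt
    unfold cutoffKernel
    refine DifferentiableAt.fun_div ?_ (by fun_prop)
      (show (fun s : ℂ => s * (s + 1)) s ≠ 0 from hs0 s hs)
    exact ((differentiableAt_id.add_const 1).const_cpow (Or.inl h1)).sub
      ((differentiableAt_id.add_const 1).const_cpow (Or.inl h2))
  have hbound : ∀ s : ℂ, η ≤ s.re → s.re ≤ 2 → ‖G (s + 1 / 2) * cutoffKernel N s‖ ≤
      D * (q : ℝ) ^ η * ((N : ℝ) + 1) ^ (s.re + 2 * η) * (1 + |s.im|) ^ (-(1 + η)) := by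
    intro s hs1 hs2
    have h1 := hGb (s + 1 / 2) (by simp; linarith) (by simp; linarith)
    -- With κ = 2η, the growth |t|^η of 1/L still leaves the integrable decay (1 + |t|)^(-1-η).
    have h2 := norm_cutoffKernel_le hN hη0 (by linarith) (κ := 2 * η) (by linarith)
      (by linarith) hs1
    have him : (s + 1 / 2).im = s.im := by simp
    rw [him] at h1
    have ht : 0 < 1 + |s.im| := by positivity
    have h3 : ((q : ℝ) * (|s.im| + 2)) ^ η ≤ (q : ℝ) ^ η * (2 * (1 + |s.im|) ^ η) := by
      rw [Real.mul_rpow (by positivity) (by positivity)]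
      gcongr
      calc (|s.im| + 2) ^ η ≤ (2 * (1 + |s.im|)) ^ η := by
            gcongr
            linarith [abs_nonneg s.im]
        _ = 2 ^ η * (1 + |s.im|) ^ η := Real.mul_rpow (by norm_num) ht.le
        _ ≤ 2 * (1 + |s.im|) ^ η := by
            gcongr
            simpa using Real.rpow_le_rpow_of_exponent_le (by norm_num : (1 : ℝ) ≤ 2)
              (by linarith : η ≤ 1)
    have h4 : (1 + |s.im|) ^ η * (1 + |s.im|) ^ (-(1 + 2 * η)) = (1 + |s.im|) ^ (-(1 + η)) := by
      rw [← Real.rpow_add ht]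
      ring_nf
    rw [norm_mul]
    calc _ ≤ (C * ((q : ℝ) ^ η * (2 * (1 + |s.im|) ^ η))) * (((N : ℝ) + 1) ^ s.re *
          (4 * ((N : ℝ) + 1)) ^ (2 * η) * (2 / η) * (1 + |s.im|) ^ (-(1 + 2 * η))) := by
          gcongr
          exact h1.trans (by gcongr)
      _ = D * (q : ℝ) ^ η * (((N : ℝ) + 1) ^ s.re * ((N : ℝ) + 1) ^ (2 * η)) *
          ((1 + |s.im|) ^ η * (1 + |s.im|) ^ (-(1 + 2 * η))) := by
          rw [Real.mul_rpow (by norm_num) (by positivity), hD]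
          ring
      _ = _ := by rw [h4, ← Real.rpow_add (by positivity)]
  -- No pole is crossed between Re s = η and Re s = 2: G is holomorphic to the right of 1/2, and s(s
  -- + 1) does not vanish for Re s > 0.
  have hshift := integral_vertical_eq (f := fun s => G (s + 1 / 2) * cutoffKernel N s) (a := η)
    (b := 2) (B := D * (q : ℝ) ^ η * ((N : ℝ) + 1) ^ (2 + 2 * η)) (p := 1 + η)
    (by linarith) (by linarith)
    ((hGd'.mul hKd).mono fun s hs => lt_of_lt_of_le hη0 hs.1.1) (fun s hs1 hs2 => by
      refine (hbound s hs1 hs2).trans ?_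
      gcongr
      linarith)
  have hi : ∀ x : ℝ, 0 < x → Integrable fun t : ℝ => G ((2 : ℝ) + t * I + 1 / 2) *
      ((x : ℂ) ^ ((2 : ℝ) + t * I + 1) / (((2 : ℝ) + t * I : ℂ) * ((2 : ℝ) + t * I + 1))) := by
    intro x hx
    have hxc : (x : ℂ) ≠ 0 := ofReal_ne_zero.2 hx.ne'
    have hc1 : Continuous fun t : ℝ => G ((2 : ℝ) + t * I + 1 / 2) :=
      hGd'.continuousOn.comp_continuous (f := fun t : ℝ => (2 : ℝ) + t * I) (by fun_prop)
        (fun t => by simp)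
    have hc2 : Continuous fun t : ℝ => (x : ℂ) ^ ((2 : ℝ) + t * I + 1) :=
      Continuous.const_cpow (by fun_prop) (Or.inl hxc)
    have heq : (fun t : ℝ => G ((2 : ℝ) + t * I + 1 / 2) *
        ((x : ℂ) ^ ((2 : ℝ) + t * I + 1) / (((2 : ℝ) + t * I : ℂ) * ((2 : ℝ) + t * I + 1)))) =
        fun t : ℝ => (G ((2 : ℝ) + t * I + 1 / 2) * (x : ℂ) ^ ((2 : ℝ) + t * I + 1)) *
          (1 / (((2 : ℝ) + t * I : ℂ) * ((2 : ℝ) + t * I + 1))) := by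
      funext t
      ring
    rw [heq]
    apply integrable_riesz_kernel.bdd_mul (c := b * x ^ (3 : ℝ)) (hc1.mul hc2).aestronglyMeasurable
    refine Eventually.of_forall fun t => ?_
    rw [Pi.mul_apply, norm_mul, Complex.norm_cpow_eq_rpow_re_of_pos hx, hGL _ (by simp; norm_num)]
    have h1 := hb _ (norm_moebius_mul_char_le χ) ((2 : ℝ) + t * I + 1 / 2) (by simp; norm_num)
    have h2 : ((2 : ℝ) + t * I + 1 : ℂ).re = 3 := by
      simp
      norm_num
    rw [h2]
    gcongr
  have hperron := sum_eq_integral_cutoffKernel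
    (b := fun n => χ n * (ArithmeticFunction.moebius n : ℂ)) (norm_moebius_mul_char_le χ)
    (by simp) hN hGL hi
  rw [hperron, ← hshift]
  have hint : ‖∫ t : ℝ, G ((η : ℂ) + t * I + 1 / 2) * cutoffKernel N ((η : ℂ) + t * I)‖ ≤
      D * (q : ℝ) ^ η * ((N : ℝ) + 1) ^ (3 * η) * J := by
    rw [hJ, ← integral_const_mul]
    apply norm_integral_le_of_norm_le
      ((integrable_one_add_abs_rpow (by linarith : 1 < 1 + η)).const_mul _)
    refine Eventually.of_forall fun t => ?_
    have h := hbound ((η : ℂ) + t * I) (by simp) (by simp; linarith)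
    have h1 : ((η : ℂ) + t * I).re = η := by simp
    have h2 : ((η : ℂ) + t * I).im = t := by simp
    rw [h1, h2, show η + 2 * η = 3 * η by ring] at h
    exact h
  have hpi : ‖(1 / (2 * Real.pi) : ℂ)‖ ≤ 1 := by
    rw [norm_div, norm_one, norm_mul, Complex.norm_real, Real.norm_of_nonneg Real.pi_pos.le,
      div_le_one (by simpa using Real.pi_pos)]
    have := Real.pi_gt_three
    norm_num
    linarith
  rw [norm_mul]
  have hN2 : ((N : ℝ) + 1) ^ (3 * η) ≤ 2 * (N : ℝ) ^ ε := by
    calc ((N : ℝ) + 1) ^ (3 * η) ≤ (2 * N : ℝ) ^ (3 * η) := by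
          gcongr
          linarith
      _ = 2 ^ (3 * η) * (N : ℝ) ^ (3 * η) := Real.mul_rpow (by norm_num) (by positivity)
      _ ≤ 2 * (N : ℝ) ^ ε := by
          gcongr
          · simpa using Real.rpow_le_rpow_of_exponent_le (by norm_num : (1 : ℝ) ≤ 2)
              (by linarith : 3 * η ≤ 1)
  have hq2 : (q : ℝ) ^ η ≤ (q : ℝ) ^ ε := Real.rpow_le_rpow_of_exponent_le hq1 (by linarith)
  calc _ ≤ 1 * (D * (q : ℝ) ^ ε * (2 * (N : ℝ) ^ ε) * J) := by
        gcongr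
        exact hint.trans (by gcongr)
    _ = D * J * 2 * ((q : ℝ) * N) ^ ε := by
        rw [Real.mul_rpow (by positivity) (by positivity)]
        ring
    _ ≤ _ := by
        gcongr
        linarith

/-! ### Elementary arithmetic bounds -/

/-- The divisor bound `d(n) ≪ n^ε`. -/
theorem exists_card_divisors_le {ε : ℝ} (hε : 0 < ε) :
    ∃ C : ℝ, 1 ≤ C ∧ ∀ n : ℕ, n ≠ 0 → (n.divisors.card : ℝ) ≤ C * (n : ℝ) ^ ε := by
  have hl2 : 0 < Real.log 2 := Real.log_pos (by norm_num)
  set K : ℝ := 1 / (ε * Real.log 2) + 1 with hK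
  have hK1 : 1 ≤ K := by
    rw [hK]
    have : 0 < 1 / (ε * Real.log 2) := by positivity
    linarith
  -- For p ≥ P one has p^ε ≥ 2, so k + 1 ≤ 2^k ≤ p^(kε) without loss. Each of the at most P smaller
  -- primes costs a factor K.
  set P : ℕ := ⌈(2 : ℝ) ^ (1 / ε)⌉₊ with hP
  refine ⟨K ^ P, one_le_pow₀ hK1, fun n hn => ?_⟩
  rw [Nat.card_divisors hn]
  have hterm : ∀ p ∈ n.primeFactors, ((n.factorization p + 1 : ℕ) : ℝ) ≤
      (if p < P then K else 1) * ((p : ℝ) ^ n.factorization p) ^ ε := by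
    intro p hp
    have hp2 : (2 : ℝ) ≤ p := by exact_mod_cast (Nat.prime_of_mem_primeFactors hp).two_le
    set k := n.factorization p
    rw [← Real.rpow_natCast, ← Real.rpow_mul (by positivity), mul_comm (k : ℝ) ε,
      Real.rpow_mul (by positivity), Real.rpow_natCast]
    split_ifs with h
    · have h1 : 1 + k * (ε * Real.log 2) ≤ ((p : ℝ) ^ ε) ^ k := by
        calc 1 + k * (ε * Real.log 2) ≤ Real.exp (k * (ε * Real.log 2)) := by
              linarith [Real.add_one_le_exp (k * (ε * Real.log 2))]
          _ = ((2 : ℝ) ^ ε) ^ k := by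
              rw [Real.exp_nat_mul, Real.rpow_def_of_pos (by norm_num), mul_comm ε]
          _ ≤ ((p : ℝ) ^ ε) ^ k := by gcongr
      have h2 : ((k + 1 : ℕ) : ℝ) ≤ K * (1 + k * (ε * Real.log 2)) := by
        rw [hK]
        push_cast
        have h3 : 1 / (ε * Real.log 2) * (k * (ε * Real.log 2)) = k := by field_simp
        have h4 : 0 < 1 / (ε * Real.log 2) := by positivity
        have h5 : 0 ≤ k * (ε * Real.log 2) := by positivity
        nlinarith
      exact h2.trans (by gcongr)
    · push Not at h
      have h1 : (2 : ℝ) ≤ (p : ℝ) ^ ε := by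
        have h2 : (2 : ℝ) ^ (1 / ε) ≤ p := (Nat.le_ceil _).trans (by exact_mod_cast h)
        calc (2 : ℝ) = ((2 : ℝ) ^ (1 / ε)) ^ ε := by
              rw [← Real.rpow_mul (by norm_num), one_div_mul_cancel hε.ne', Real.rpow_one]
          _ ≤ _ := by gcongr
      rw [one_mul]
      calc ((k + 1 : ℕ) : ℝ) ≤ ((2 ^ k : ℕ) : ℝ) := by
            exact_mod_cast Nat.lt_two_pow_self
        _ = (2 : ℝ) ^ k := by push_cast; rfl
        _ ≤ _ := by gcongr
  have hprod : (n : ℝ) ^ ε = ∏ p ∈ n.primeFactors, ((p : ℝ) ^ n.factorization p) ^ ε := by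
    rw [Real.finsetProd_rpow _ _ (fun i _ => by positivity)]
    congr 1
    have h := Nat.prod_factorization_pow_eq_self hn
    rw [Finsupp.prod, Nat.support_factorization] at h
    exact_mod_cast h.symm
  have hc : ∏ p ∈ n.primeFactors, (if p < P then K else 1) ≤ K ^ P := by
    rw [Finset.prod_ite, Finset.prod_const, Finset.prod_const_one, mul_one]
    apply pow_le_pow_right₀ hK1
    calc _ ≤ (Finset.range P).card := Finset.card_le_card fun p hp => by
          simpa using (Finset.mem_filter.1 hp).2
      _ = P := Finset.card_range P
  push_cast
  calc ∏ p ∈ n.primeFactors, ((n.factorization p : ℝ) + 1)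
      ≤ ∏ p ∈ n.primeFactors, ((if p < P then K else 1) * ((p : ℝ) ^ n.factorization p) ^ ε) :=
        Finset.prod_le_prod (fun _ _ => by positivity) fun p hp => by simpa using hterm p hp
    _ = (∏ p ∈ n.primeFactors, (if p < P then K else 1)) * (n : ℝ) ^ ε := by
        rw [Finset.prod_mul_distrib, hprod]
    _ ≤ _ := by gcongr

/-- In n = ∑ φ(d) over d ∣ n, every term is at most φ(n). This reduces lower bounds for φ to the
divisor bound. -/
theorem le_totient_mul_card_divisors (n : ℕ) : n ≤ n.totient * n.divisors.card := by
  rcases Nat.eq_zero_or_pos n with rfl | hn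
  · simp
  · calc n = ∑ d ∈ n.divisors, d.totient := (Nat.sum_totient n).symm
      _ ≤ ∑ _d ∈ n.divisors, n.totient := Finset.sum_le_sum fun d hd =>
          Nat.le_of_dvd (Nat.totient_pos.2 hn) (Nat.totient_dvd_of_dvd (Nat.dvd_of_mem_divisors hd))
      _ = _ := by rw [Finset.sum_const, smul_eq_mul, mul_comm]

/-- `1 / φ(n) ≪ n^(ε - 1)`. -/
theorem exists_inv_totient_le {ε : ℝ} (hε : 0 < ε) :
    ∃ C : ℝ, 1 ≤ C ∧ ∀ n : ℕ, n ≠ 0 → (1 : ℝ) / n.totient ≤ C * (n : ℝ) ^ ε / n := by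
  obtain ⟨C, hC, h⟩ := exists_card_divisors_le hε
  refine ⟨C, hC, fun n hn => ?_⟩
  have hn0 : (0 : ℝ) < n := by positivity
  have ht : (0 : ℝ) < n.totient := by exact_mod_cast Nat.totient_pos.2 (Nat.pos_of_ne_zero hn)
  rw [div_le_div_iff₀ ht hn0, one_mul]
  have h1 : (n : ℝ) ≤ n.totient * n.divisors.card := by
    exact_mod_cast le_totient_mul_card_divisors n
  calc (n : ℝ) ≤ n.totient * n.divisors.card := h1
    _ ≤ n.totient * (C * (n : ℝ) ^ ε) := by gcongr; exact h n hn
    _ = _ := by ring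

/-- `∑_{n ≤ N} 1 / n ≪ N^ε`. -/
theorem exists_sum_inv_le {ε : ℝ} (hε : 0 < ε) :
    ∃ C : ℝ, 1 ≤ C ∧ ∀ x : ℝ, 1 ≤ x → ∀ N : ℕ, (N : ℝ) ≤ x →
      ∑ n ∈ Finset.Icc 1 N, (1 : ℝ) / n ≤ C * x ^ ε := by
  refine ⟨1 + 1 / ε, by linarith [show 0 < 1 / ε by positivity], fun x hx N hN => ?_⟩
  have h1 : ∑ n ∈ Finset.Icc 1 N, (1 : ℝ) / n ≤ 1 + Real.log N := by
    have h := harmonic_le_one_add_log N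
    rw [harmonic_eq_sum_Icc] at h
    push_cast at h
    simpa using h
  have h2 : Real.log N ≤ Real.log x := by
    rcases Nat.eq_zero_or_pos N with rfl | h
    · simpa using Real.log_nonneg hx
    · exact Real.log_le_log (by exact_mod_cast h) hN
  have h3 := Real.log_le_rpow_div (by linarith : 0 ≤ x) hε
  have h4 : 1 ≤ x ^ ε := Real.one_le_rpow hx hε.le
  calc _ ≤ 1 + Real.log x := by linarith
    _ ≤ 1 * x ^ ε + x ^ ε / ε := by linarith
    _ = _ := by ring

/-! ### Sums over congruent pairs -/

/-- `μ(m) / √m`, restricted to `m` coprime to `r`. -/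
noncomputable def coef (r m : ℕ) : ℝ :=
  if m.Coprime r then (ArithmeticFunction.moebius m : ℝ) / √(m : ℝ) else 0

/-- `∑ μ(m) μ(n) / √(m n)` over `m ≤ M`, `n ≤ N` coprime to `r` and congruent modulo `d`. -/
noncomputable def pairSum (d r M N : ℕ) : ℝ :=
  ∑ m ∈ Finset.Icc 1 M, ∑ n ∈ Finset.Icc 1 N, if m ≡ n [MOD d] then coef r m * coef r n else 0

/-- The part `n < m` of `pairSum d r N N`. -/
noncomputable def upperPairSum (d r N : ℕ) : ℝ :=
  ∑ m ∈ Finset.Icc 1 N, ∑ n ∈ Finset.Icc 1 N,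
    if n < m ∧ m ≡ n [MOD d] then coef r m * coef r n else 0

/-- `∑_{m ≤ N} χ(m) μ(m) / √m`. -/
noncomputable def charSum (N : ℕ) {q : ℕ} (χ : DirichletCharacter ℂ q) : ℂ :=
  ∑ m ∈ Finset.Icc 1 N, χ m * (ArithmeticFunction.moebius m : ℂ) / (√(m : ℝ) : ℂ)

/-- When g and m share a factor, μ(gm) = 0, which the new condition that m be coprime to g records.
No coprimality hypothesis is therefore needed. -/
theorem coef_mul (r g m : ℕ) : coef r (g * m) = coef r g * coef (r * g) m := by
  unfold coef
  by_cases hg : g.Coprime r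
  · by_cases hm : m.Coprime r
    · by_cases hgm : m.Coprime g
      · rw [if_pos (Nat.Coprime.mul_left hg hm), if_pos hg, if_pos (Nat.Coprime.mul_right hm hgm),
          ArithmeticFunction.isMultiplicative_moebius.map_mul_of_coprime hgm.symm]
        push_cast
        rw [Real.sqrt_mul (Nat.cast_nonneg g), mul_div_mul_comm]
      · have h1 : ¬ m.Coprime (r * g) := fun h => hgm (Nat.Coprime.coprime_mul_left_right h)
        rw [if_neg h1, mul_zero]
        have h2 : ArithmeticFunction.moebius (g * m) = 0 := by
          apply ArithmeticFunction.moebius_eq_zero_of_not_squarefree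
          intro h
          exact hgm (Nat.squarefree_mul_iff.1 h).1.symm
        simp [h2]
    · have h1 : ¬ m.Coprime (r * g) := fun h => hm (Nat.Coprime.coprime_mul_right_right h)
      have h2 : ¬ (g * m).Coprime r := fun h => hm (Nat.Coprime.coprime_mul_left h)
      rw [if_neg h1, if_neg h2, mul_zero]
  · have h2 : ¬ (g * m).Coprime r := fun h => hg (Nat.Coprime.coprime_mul_right h)
    rw [if_neg h2, if_neg hg, zero_mul]

theorem coef_mul_modulus (r s m : ℕ) : coef (r * s) m = if m.Coprime s then coef r m else 0 := by
  unfold coef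
  by_cases h : m.Coprime s
  · rw [if_pos h]
    exact if_congr (by rw [Nat.coprime_mul_iff_right]; exact and_iff_left h) rfl rfl
  · rw [if_neg h, if_neg fun h' => h (Nat.coprime_mul_iff_right.1 h').2]

theorem sum_divisors_moebius {n : ℕ} :
    ∑ f ∈ n.divisors, ArithmeticFunction.moebius f = if n = 1 then 1 else 0 := by
  rw [← ArithmeticFunction.coe_mul_zeta_apply, ArithmeticFunction.moebius_mul_coe_zeta,
    ArithmeticFunction.one_apply]

theorem coef_sq_le (r m : ℕ) : coef r m ^ 2 ≤ 1 / m := by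
  unfold coef
  split_ifs
  · rw [div_pow, Real.sq_sqrt (Nat.cast_nonneg m)]
    have h : ((ArithmeticFunction.moebius m : ℤ) : ℝ) ^ 2 ≤ 1 := by
      rw [sq_le_one_iff_abs_le_one]
      exact_mod_cast ArithmeticFunction.abs_moebius_le_one
    gcongr
  · rw [zero_pow two_ne_zero]
    positivity

theorem sum_Icc_ite_dvd {E : Type*} [AddCommMonoid E] {g : ℕ} (hg : 0 < g) (M : ℕ) (F : ℕ → E) :
    ∑ m ∈ Finset.Icc 1 M, (if g ∣ m then F m else 0) = ∑ m ∈ Finset.Icc 1 (M / g), F (g * m) := by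
  rw [← Finset.sum_filter]
  symm
  refine Finset.sum_bij (fun m _ => g * m) ?_ ?_ ?_ (fun _ _ => rfl)
  · intro m hm
    rw [Finset.mem_Icc, Nat.le_div_iff_mul_le hg] at hm
    rw [Finset.mem_filter, Finset.mem_Icc]
    exact ⟨⟨Nat.mul_pos hg hm.1, by linarith [mul_comm m g]⟩, dvd_mul_right _ _⟩
  · intro a _ b _ h
    exact Nat.eq_of_mul_eq_mul_left hg h
  · intro b hb
    rw [Finset.mem_filter, Finset.mem_Icc] at hb
    obtain ⟨k, rfl⟩ := hb.2
    refine ⟨k, ?_, rfl⟩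
    rw [Finset.mem_Icc, Nat.le_div_iff_mul_le hg]
    exact ⟨Nat.pos_of_mul_pos_left hb.1.1 |> fun _ => by
      rcases Nat.eq_zero_or_pos k with rfl | h
      · simp at hb
      · exact h, by linarith [hb.1.2, mul_comm k g]⟩

theorem sum_sum_Icc_ite_dvd {E : Type*} [AddCommMonoid E] {g : ℕ} (hg : 0 < g) (M N : ℕ)
    (F : ℕ → ℕ → E) :
    ∑ m ∈ Finset.Icc 1 M, ∑ n ∈ Finset.Icc 1 N, (if g ∣ m ∧ g ∣ n then F m n else 0) =
      ∑ m ∈ Finset.Icc 1 (M / g), ∑ n ∈ Finset.Icc 1 (N / g), F (g * m) (g * n) := by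
  rw [← sum_Icc_ite_dvd hg M fun m => ∑ n ∈ Finset.Icc 1 (N / g), F m (g * n)]
  refine Finset.sum_congr rfl fun m _ => ?_
  by_cases h : g ∣ m
  · simp only [h, true_and, if_true]
    exact sum_Icc_ite_dvd hg N fun n => F m n
  · simp [h]

theorem gcd_eq_of_modEq {m n d : ℕ} (h : m ≡ n [MOD d]) : m.gcd d = n.gcd d := by
  exact Nat.ModEq.gcd_eq h

/-- Congruent m and n have the same gcd g with d. Dividing both by g leaves variables coprime to
d/g, and the accumulated conditions amount to coprimality to r d. The new modulus d/g divides r d,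
as orthogonality of characters requires. -/
theorem pairSum_eq_sum_divisors {d : ℕ} (hd : 0 < d) (r M N : ℕ) :
    pairSum d r M N =
      ∑ g ∈ d.divisors, coef r g ^ 2 * pairSum (d / g) (r * d) (M / g) (N / g) := by
  have h1 : ∀ m n : ℕ, (if m ≡ n [MOD d] then coef r m * coef r n else 0) =
      ∑ g ∈ d.divisors, if g ∣ m ∧ g ∣ n then
        (if m ≡ n [MOD d] ∧ m.gcd d = g then coef r m * coef r n else 0) else 0 := by
    intro m n
    rw [Finset.sum_eq_single (m.gcd d)]
    · by_cases h : m ≡ n [MOD d]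
      · have h2 : m.gcd d ∣ n := by
          rw [gcd_eq_of_modEq h]
          exact Nat.gcd_dvd_left _ _
        simp [h, Nat.gcd_dvd_left, h2]
      · simp [h]
    · intro g _ hne
      simp [Ne.symm hne]
    · intro h
      exact absurd (Nat.mem_divisors.2 ⟨Nat.gcd_dvd_right m d, hd.ne'⟩) h
  unfold pairSum
  simp only [h1]
  have h2 : ∀ m : ℕ, (∑ n ∈ Finset.Icc 1 N, ∑ g ∈ d.divisors, if g ∣ m ∧ g ∣ n then
        (if m ≡ n [MOD d] ∧ m.gcd d = g then coef r m * coef r n else 0) else 0) =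
      ∑ g ∈ d.divisors, ∑ n ∈ Finset.Icc 1 N, if g ∣ m ∧ g ∣ n then
        (if m ≡ n [MOD d] ∧ m.gcd d = g then coef r m * coef r n else 0) else 0 :=
    fun m => Finset.sum_comm
  simp only [h2]
  rw [Finset.sum_comm]
  refine Finset.sum_congr rfl fun g hg => ?_
  obtain ⟨e, rfl⟩ := Nat.dvd_of_mem_divisors hg
  have hg0 : 0 < g := Nat.pos_of_mul_pos_right hd |> fun _ => Nat.pos_of_mem_divisors hg
  rw [sum_sum_Icc_ite_dvd hg0 M N
    (fun m n => if m ≡ n [MOD g * e] ∧ m.gcd (g * e) = g then coef r m * coef r n else 0),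
    Nat.mul_div_cancel_left e hg0, Finset.mul_sum]
  refine Finset.sum_congr rfl fun m _ => ?_
  rw [Finset.mul_sum]
  refine Finset.sum_congr rfl fun n _ => ?_
  have h3 : (g * m).gcd (g * e) = g ↔ m.Coprime e := by
    rw [Nat.gcd_mul_left, Nat.Coprime]
    constructor
    · intro h
      exact Nat.eq_of_mul_eq_mul_left hg0 (by rw [h, mul_one])
    · intro h
      rw [h, mul_one]
  have h4 : g * m ≡ g * n [MOD g * e] ↔ m ≡ n [MOD e] :=
    Nat.ModEq.mul_left_cancel_iff' hg0.ne'
  simp only [h3, h4]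
  rw [← mul_assoc r g e, coef_mul_modulus (r * g), coef_mul_modulus (r * g), coef_mul,
    coef_mul]
  by_cases h5 : m ≡ n [MOD e]
  · have h6 : m.Coprime e ↔ n.Coprime e := by
      rw [Nat.Coprime, Nat.Coprime, gcd_eq_of_modEq h5]
    by_cases h7 : n.Coprime e
    · simp only [h5, h6, true_and, if_pos h7, if_true]
      ring
    · simp [h6, h7]
  · simp [h5]

/-- For m ≡ n mod d, coprimality to d is one condition, detected by ∑ μ(f) over f ∣ gcd(m, d), and
each such f divides n too. Afterwards the coefficients no longer depend on the modulus d/f, which is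
what allows it to be exchanged for a complementary divisor. -/
theorem upperPairSum_eq_sum_divisors {d : ℕ} (hd : 0 < d) (c N : ℕ) :
    upperPairSum d (c * d) N =
      ∑ f ∈ d.divisors, (ArithmeticFunction.moebius f : ℝ) * coef c f ^ 2 *
        upperPairSum (d / f) (c * f) (N / f) := by
  have h1 : ∀ m n : ℕ, (if n < m ∧ m ≡ n [MOD d] then coef (c * d) m * coef (c * d) n else 0) =
      ∑ f ∈ d.divisors, if f ∣ m ∧ f ∣ n then (ArithmeticFunction.moebius f : ℝ) *
        (if n < m ∧ m ≡ n [MOD d] then coef c m * coef c n else 0) else 0 := by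
    intro m n
    by_cases h : n < m ∧ m ≡ n [MOD d]
    · have h2 : n.Coprime d ↔ m.Coprime d := by
        rw [Nat.Coprime, Nat.Coprime, gcd_eq_of_modEq h.2]
      have h3 : ∀ f ∈ d.divisors, (f ∣ m ∧ f ∣ n ↔ f ∣ m.gcd d) := fun f hf => by
        have hfd := Nat.dvd_of_mem_divisors hf
        constructor
        · intro h4
          exact Nat.dvd_gcd h4.1 hfd
        · intro h4
          refine ⟨h4.trans (Nat.gcd_dvd_left _ _), ?_⟩
          rw [gcd_eq_of_modEq h.2] at h4
          exact h4.trans (Nat.gcd_dvd_left _ _)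
      have h4 : (∑ f ∈ d.divisors, if f ∣ m ∧ f ∣ n then (ArithmeticFunction.moebius f : ℝ) *
          (coef c m * coef c n) else 0) =
          (∑ f ∈ (m.gcd d).divisors, (ArithmeticFunction.moebius f : ℝ)) *
            (coef c m * coef c n) := by
        rw [Finset.sum_mul, ← Finset.sum_filter]
        refine Finset.sum_congr ?_ fun _ _ => rfl
        ext f
        rw [Finset.mem_filter]
        constructor
        · intro hf
          exact Nat.mem_divisors.2 ⟨(h3 f hf.1).1 hf.2, (Nat.gcd_pos_of_pos_right m hd).ne'⟩
        · intro hf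
          have hf1 := Nat.dvd_of_mem_divisors hf
          have hf2 : f ∈ d.divisors :=
            Nat.mem_divisors.2 ⟨hf1.trans (Nat.gcd_dvd_right _ _), hd.ne'⟩
          exact ⟨hf2, (h3 f hf2).2 hf1⟩
      have h5 : (∑ f ∈ (m.gcd d).divisors, (ArithmeticFunction.moebius f : ℝ)) =
          if m.Coprime d then 1 else 0 := by
        have h6 := sum_divisors_moebius (n := m.gcd d)
        have h7 := congrArg (Int.cast : ℤ → ℝ) h6
        push_cast at h7
        rw [h7]
      simp only [h, and_self, if_true]
      rw [h4, h5, coef_mul_modulus, coef_mul_modulus]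
      by_cases h7 : m.Coprime d <;> simp [h2, h7]
    · simp [h]
  unfold upperPairSum
  simp only [h1]
  have h2 : ∀ m : ℕ, (∑ n ∈ Finset.Icc 1 N, ∑ f ∈ d.divisors,
      if f ∣ m ∧ f ∣ n then (ArithmeticFunction.moebius f : ℝ) *
        (if n < m ∧ m ≡ n [MOD d] then coef c m * coef c n else 0) else 0) =
      ∑ f ∈ d.divisors, ∑ n ∈ Finset.Icc 1 N,
      if f ∣ m ∧ f ∣ n then (ArithmeticFunction.moebius f : ℝ) *
        (if n < m ∧ m ≡ n [MOD d] then coef c m * coef c n else 0) else 0 :=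
    fun m => Finset.sum_comm
  simp only [h2]
  rw [Finset.sum_comm]
  refine Finset.sum_congr rfl fun f hf => ?_
  have hf0 : 0 < f := Nat.pos_of_mem_divisors hf
  obtain ⟨e, rfl⟩ := Nat.dvd_of_mem_divisors hf
  rw [sum_sum_Icc_ite_dvd hf0 N N
    (fun m n => (ArithmeticFunction.moebius f : ℝ) *
        (if n < m ∧ m ≡ n [MOD f * e] then coef c m * coef c n else 0)),
    Nat.mul_div_cancel_left e hf0, Finset.mul_sum]
  refine Finset.sum_congr rfl fun m _ => ?_
  rw [Finset.mul_sum]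
  refine Finset.sum_congr rfl fun n _ => ?_
  have h4 : f * m ≡ f * n [MOD f * e] ↔ m ≡ n [MOD e] :=
    Nat.ModEq.mul_left_cancel_iff' hf0.ne'
  have h5 : f * n < f * m ↔ n < m := Nat.mul_lt_mul_left hf0
  simp only [h4, h5]
  rw [coef_mul, coef_mul]
  split_ifs <;> ring

theorem changeLevel_natCast {d r : ℕ} (h : d ∣ r) (χ : DirichletCharacter ℂ d) (m : ℕ) :
    DirichletCharacter.changeLevel h χ (m : ZMod r) = if m.Coprime r then χ m else 0 := by
  split_ifs with hm
  · have := DirichletCharacter.changeLevel_eq_cast_of_dvd' χ h (a := (m : ℤ))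
      (Nat.isCoprime_iff_coprime.2 hm)
    simpa using this
  · apply MulChar.map_nonunit
    rwa [ZMod.isUnit_iff_coprime]

theorem charSum_changeLevel {d r : ℕ} (h : d ∣ r) (χ : DirichletCharacter ℂ d) (N : ℕ) :
    charSum N (DirichletCharacter.changeLevel h χ) =
      ∑ m ∈ Finset.Icc 1 N, χ m * (coef r m : ℂ) := by
  refine Finset.sum_congr rfl fun m _ => ?_
  rw [changeLevel_natCast, coef]
  split_ifs
  · push_cast
    ring
  · simp

theorem sum_char_mul_conj {d : ℕ} [NeZero d] {m n : ℕ} (hn : n.Coprime d) :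
    ∑ χ : DirichletCharacter ℂ d, χ m * (starRingEnd ℂ) (χ n) =
      if m ≡ n [MOD d] then (d.totient : ℂ) else 0 := by
  have hu : IsUnit (n : ZMod d) := (ZMod.isUnit_iff_coprime n d).2 hn
  have h := DirichletCharacter.sum_char_inv_mul_char_eq ℂ hu (m : ZMod d)
  have h1 : ∀ χ : DirichletCharacter ℂ d, (starRingEnd ℂ) (χ n) = χ (n : ZMod d)⁻¹ := fun χ => by
    rw [starRingEnd_apply, ← MulChar.star_apply, MulChar.star_eq_inv, MulChar.inv_apply]
    congr 1
    obtain ⟨u, hu'⟩ := hu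
    rw [← hu', Ring.inverse_unit, ZMod.inv_coe_unit]
  rw [Finset.sum_congr rfl fun χ _ => by rw [h1 χ, mul_comm], h]
  simp only [ZMod.natCast_eq_natCast_iff, Nat.ModEq.comm]

/-- The orthogonality relation behind the large sieve. -/
theorem sum_charSum_mul_conj {d r : ℕ} [NeZero d] (h : d ∣ r) (M N : ℕ) :
    ∑ χ : DirichletCharacter ℂ d, charSum M (DirichletCharacter.changeLevel h χ) *
      (starRingEnd ℂ) (charSum N (DirichletCharacter.changeLevel h χ)) =
      (d.totient : ℂ) * (pairSum d r M N : ℂ) := by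
  simp only [charSum_changeLevel, map_sum, Finset.sum_mul_sum]
  rw [Finset.sum_comm, pairSum]
  push_cast
  rw [Finset.mul_sum]
  refine Finset.sum_congr rfl fun m _ => ?_
  rw [Finset.sum_comm, Finset.mul_sum]
  refine Finset.sum_congr rfl fun n _ => ?_
  by_cases hn : n.Coprime r
  · have hnd : n.Coprime d := Nat.Coprime.coprime_dvd_right h hn
    have h1 := sum_char_mul_conj (m := m) hnd
    calc _ = (∑ χ : DirichletCharacter ℂ d, χ m * (starRingEnd ℂ) (χ n)) *
          ((coef r m : ℂ) * (coef r n : ℂ)) := by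
          rw [Finset.sum_mul]
          refine Finset.sum_congr rfl fun χ _ => ?_
          rw [map_mul, Complex.conj_ofReal]
          ring
      _ = _ := by
          rw [h1]
          split_ifs <;> simp
  · have : coef r n = 0 := if_neg hn
    simp [this]

theorem card_dirichletCharacter (d : ℕ) [NeZero d] :
    (Fintype.card (DirichletCharacter ℂ d) : ℝ) = d.totient := by
  rw [← DirichletCharacter.card_eq_totient_of_hasEnoughRootsOfUnity ℂ d, Nat.card_eq_fintype_card]

/-- By orthogonality the pair sum is an average, over the φ(d) characters modulo d, of products of
two character sums taken at level r. -/
theorem abs_pairSum_le_of_dvd {d r : ℕ} [NeZero d] (h : d ∣ r) {M N : ℕ} {B : ℝ} (hB : 0 ≤ B)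
    (hM : ∀ χ : DirichletCharacter ℂ r, ‖charSum M χ‖ ≤ B)
    (hN : ∀ χ : DirichletCharacter ℂ r, ‖charSum N χ‖ ≤ B) : |pairSum d r M N| ≤ B * B := by
  have h1 := congrArg norm (sum_charSum_mul_conj h M N)
  have ht : (0 : ℝ) < d.totient := by exact_mod_cast Nat.totient_pos.2 (NeZero.pos d)
  rw [norm_mul, Complex.norm_real, Complex.norm_natCast, Real.norm_eq_abs] at h1
  have h2 : (d.totient : ℝ) * |pairSum d r M N| ≤ d.totient * (B * B) := by
    rw [← h1, ← card_dirichletCharacter]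
    refine (norm_sum_le_of_le _ (n := fun _ => B * B) fun χ _ => ?_).trans (le_of_eq ?_)
    · rw [norm_mul, RCLike.norm_conj]
      gcongr
      · exact hM _
      · exact hN _
    · simp
  exact le_of_mul_le_mul_left h2 ht

/-- Under GRH, the sums of `μ(m) μ(n) / √(m n)` over `m ≡ n` modulo `d` are bounded by an
arbitrarily small power of the parameters. -/
theorem exists_abs_pairSum_le (hGRH : GRH) {ε : ℝ} (hε : 0 < ε) :
    ∃ C : ℝ, 0 < C ∧ ∀ (d r M N : ℕ) (x y : ℝ), 0 < d → 0 < r → (d : ℝ) * (r * d) ≤ x → 1 ≤ y →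
      (M : ℝ) ≤ y → (N : ℝ) ≤ y → |pairSum d r M N| ≤ C * (x ^ ε * y ^ ε) := by
  obtain ⟨C, hC, hmain⟩ := exists_norm_sum_moebius_char_le hGRH (half_pos hε)
  obtain ⟨C', hC', hdiv⟩ := exists_card_divisors_le (half_pos hε)
  have hε2 : ε / 2 + ε / 2 = ε := by ring
  have hchar : ∀ (q : ℕ) (χ : DirichletCharacter ℂ q) (N : ℕ) (y : ℝ), 0 < q → 1 ≤ y →
      (N : ℝ) ≤ y → ‖charSum N χ‖ ≤ C * ((q : ℝ) * y) ^ (ε / 2) := by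
    intro q χ N y hq hy hN
    have : NeZero q := ⟨hq.ne'⟩
    rcases Nat.eq_zero_or_pos N with rfl | hN0
    · simp only [charSum, Finset.Icc_eq_empty_of_lt zero_lt_one, Finset.sum_empty, norm_zero]
      positivity
    · refine (hmain q χ N hN0).trans ?_
      gcongr
  refine ⟨C' * (C * C), by positivity, fun d r M N x y hd hr hx hy hM hN => ?_⟩
  have hd1 : (1 : ℝ) ≤ d := by exact_mod_cast hd
  have hr1 : (1 : ℝ) ≤ r := by exact_mod_cast hr
  -- The modulus need not divide r, so the pairs are first split by their gcd with d; this costs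
  -- only the number of divisors of d.
  rw [pairSum_eq_sum_divisors hd]
  have hterm : ∀ g ∈ d.divisors,
      |coef r g ^ 2 * pairSum (d / g) (r * d) (M / g) (N / g)| ≤
        (C * (((r * d : ℕ) : ℝ) * y) ^ (ε / 2)) * (C * (((r * d : ℕ) : ℝ) * y) ^ (ε / 2)) := by
    intro g hg
    have hg0 : 0 < g := Nat.pos_of_mem_divisors hg
    have hgd := Nat.dvd_of_mem_divisors hg
    have hdg : NeZero (d / g) := ⟨(Nat.div_pos (Nat.le_of_dvd hd hgd) hg0).ne'⟩
    have hdvd : d / g ∣ r * d := (Nat.div_dvd_of_dvd hgd).trans (dvd_mul_left _ _)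
    have hle : ∀ K : ℕ, (K : ℝ) ≤ y → ((K / g : ℕ) : ℝ) ≤ y := fun K hK =>
      le_trans (by exact_mod_cast Nat.div_le_self K g) hK
    have h1 := abs_pairSum_le_of_dvd hdvd (M := M / g) (N := N / g)
      (B := C * (((r * d : ℕ) : ℝ) * y) ^ (ε / 2)) (by positivity)
      (fun χ => hchar _ χ _ y (by positivity) hy (hle M hM))
      (fun χ => hchar _ χ _ y (by positivity) hy (hle N hN))
    have h2 : coef r g ^ 2 ≤ 1 := by
      refine (coef_sq_le r g).trans ?_
      rw [div_le_one (by positivity)]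
      exact_mod_cast hg0
    rw [abs_mul, abs_of_nonneg (sq_nonneg _)]
    calc _ ≤ 1 * |pairSum (d / g) (r * d) (M / g) (N / g)| := by gcongr
      _ ≤ _ := by rw [one_mul]; exact h1
  refine (Finset.abs_sum_le_sum_abs _ _).trans ((Finset.sum_le_sum hterm).trans ?_)
  rw [Finset.sum_const, nsmul_eq_mul]
  have hrd : (0 : ℝ) < ((r * d : ℕ) : ℝ) * y := by positivity
  have hx0 : 0 < x := lt_of_lt_of_le (by positivity) hx
  calc _ ≤ (C' * (d : ℝ) ^ (ε / 2)) *
        ((C * (((r * d : ℕ) : ℝ) * y) ^ (ε / 2)) * (C * (((r * d : ℕ) : ℝ) * y) ^ (ε / 2))) := by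
        gcongr
        exact hdiv d hd.ne'
    _ = C' * (C * C) * ((d : ℝ) ^ (ε / 2) * (((r * d : ℕ) : ℝ) * y) ^ ε) := by
        have : (((r * d : ℕ) : ℝ) * y) ^ ε =
            (((r * d : ℕ) : ℝ) * y) ^ (ε / 2) * (((r * d : ℕ) : ℝ) * y) ^ (ε / 2) := by
          rw [← Real.rpow_add hrd, hε2]
        rw [this]
        ring
    _ ≤ C' * (C * C) * ((d : ℝ) ^ ε * (((r * d : ℕ) : ℝ) * y) ^ ε) := by
        gcongr
        linarith
    _ = C' * (C * C) * (((d : ℝ) * ((r * d : ℕ) : ℝ)) ^ ε * y ^ ε) := by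
        rw [Real.mul_rpow (by positivity) (by linarith), Real.mul_rpow (by positivity)
          (by positivity)]
        ring
    _ ≤ _ := by
        push_cast
        gcongr

/-! ### Opening the sum over primitive characters -/

theorem sum_moebius_of_dvd {q k : ℕ} (hq : 0 < q) (hk : k ∣ q) :
    ∑ d ∈ q.divisors, (if k ∣ d then ArithmeticFunction.moebius (q / d) else 0) =
      if k = q then 1 else 0 := by
  have hk0 : 0 < k := Nat.pos_of_dvd_of_pos hk hq
  rw [← Nat.sum_div_divisors q fun d => if k ∣ d then ArithmeticFunction.moebius (q / d) else 0]
  have h1 : ∀ e ∈ q.divisors, (if k ∣ q / e then ArithmeticFunction.moebius (q / (q / e)) else 0) =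
      if k ∣ q / e then ArithmeticFunction.moebius e else 0 := fun e he => by
    rw [Nat.div_div_self (Nat.dvd_of_mem_divisors he) hq.ne']
  rw [Finset.sum_congr rfl h1, ← Finset.sum_filter]
  have h2 : q.divisors.filter (fun e => k ∣ q / e) = (q / k).divisors := by
    ext e
    rw [Finset.mem_filter, Nat.mem_divisors, Nat.mem_divisors]
    constructor
    · rintro ⟨⟨he, _⟩, h⟩
      refine ⟨?_, (Nat.div_pos (Nat.le_of_dvd hq hk) hk0).ne'⟩
      rw [Nat.dvd_div_iff_mul_dvd hk, mul_comm, ← Nat.dvd_div_iff_mul_dvd he]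
      exact h
    · rintro ⟨he, _⟩
      have h3 : e ∣ q := he.trans (Nat.div_dvd_of_dvd hk)
      rw [Nat.dvd_div_iff_mul_dvd hk, mul_comm, ← Nat.dvd_div_iff_mul_dvd h3] at he
      exact ⟨⟨h3, hq.ne'⟩, he⟩
  rw [h2, sum_divisors_moebius]
  refine if_congr ?_ rfl rfl
  constructor
  · intro h
    exact (Nat.eq_of_dvd_of_div_eq_one hk h)
  · rintro rfl
    exact Nat.div_self hk0

/-- Sums over the characters whose conductor divides `d`, as sums over the characters modulo `d`. -/
theorem sum_conductor_dvd {E : Type*} [AddCommMonoid E] {d q : ℕ} [NeZero d] [NeZero q] (h : d ∣ q)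
    (F : DirichletCharacter ℂ q → E) :
    ∑ χ : DirichletCharacter ℂ q, (if χ.conductor ∣ d then F χ else 0) =
      ∑ ψ : DirichletCharacter ℂ d, F (DirichletCharacter.changeLevel h ψ) := by
  classical
  rw [← Finset.sum_filter]
  symm
  refine Finset.sum_bij (fun ψ _ => DirichletCharacter.changeLevel h ψ) ?_ ?_ ?_ (fun _ _ => rfl)
  · intro ψ _
    rw [Finset.mem_filter]
    exact ⟨Finset.mem_univ _, (DirichletCharacter.mem_conductorSet_iff_conductor_dvd _ h).1
      (DirichletCharacter.changeLevel_factorsThrough ψ h)⟩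
  · intro a _ b _ hab
    exact DirichletCharacter.changeLevel_injective h hab
  · intro χ hχ
    obtain ⟨_, ψ, hψ⟩ := (DirichletCharacter.mem_conductorSet_iff_conductor_dvd χ h).2
      (Finset.mem_filter.1 hχ).2
    exact ⟨ψ, Finset.mem_univ _, hψ.symm⟩

theorem moebiusPoly_eq_charSum (X : ℝ) {q : ℕ} (χ : DirichletCharacter ℂ q) :
    moebiusPoly X χ = charSum ⌊X⌋₊ χ := by
  refine Finset.sum_congr rfl fun m _ => ?_
  rw [mul_comm (χ _)]

theorem sum_norm_charSum_sq {d r : ℕ} [NeZero d] (h : d ∣ r) (N : ℕ) :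
    ∑ χ : DirichletCharacter ℂ d, ‖charSum N (DirichletCharacter.changeLevel h χ)‖ ^ 2 =
      (d.totient : ℝ) * pairSum d r N N := by
  have h1 := sum_charSum_mul_conj h N N
  simp only [Complex.mul_conj'] at h1
  exact_mod_cast h1

/-- A character is primitive when its conductor k equals q, and ∑ μ(q/d) over k ∣ d ∣ q detects
this. Characters with conductor dividing d are those lifted from level d, to which orthogonality
applies. -/
theorem primitiveSum_eq (X : ℝ) (q : ℕ+) :
    primitiveSum X q = ∑ d ∈ (q : ℕ).divisors,
      (ArithmeticFunction.moebius ((q : ℕ) / d) : ℝ) * d.totient *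
        pairSum d q ⌊X⌋₊ ⌊X⌋₊ := by
  classical
  have hq : 0 < (q : ℕ) := q.pos
  have : NeZero (q : ℕ) := ⟨hq.ne'⟩
  rw [primitiveSum, Finset.sum_filter]
  simp only [moebiusPoly_eq_charSum]
  have h1 : ∀ χ : DirichletCharacter ℂ (q : ℕ),
      (if χ.IsPrimitive then ‖charSum ⌊X⌋₊ χ‖ ^ 2 else 0) =
      ∑ d ∈ (q : ℕ).divisors, (ArithmeticFunction.moebius ((q : ℕ) / d) : ℝ) *
        (if χ.conductor ∣ d then ‖charSum ⌊X⌋₊ χ‖ ^ 2 else 0) := fun χ => by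
    have h2 := congrArg (Int.cast : ℤ → ℝ) (sum_moebius_of_dvd hq χ.conductor_dvd_level)
    push_cast at h2
    have h3 : (if χ.IsPrimitive then ‖charSum ⌊X⌋₊ χ‖ ^ 2 else 0) =
        (if χ.conductor = (q : ℕ) then (1 : ℝ) else 0) * ‖charSum ⌊X⌋₊ χ‖ ^ 2 := by
      rw [DirichletCharacter.isPrimitive_def]
      split_ifs <;> simp
    rw [h3, ← h2, Finset.sum_mul]
    refine Finset.sum_congr rfl fun d _ => ?_
    split_ifs <;> simp
  simp only [h1]
  rw [Finset.sum_comm]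
  refine Finset.sum_congr rfl fun d hd => ?_
  have hdq := Nat.dvd_of_mem_divisors hd
  have : NeZero d := ⟨(Nat.pos_of_mem_divisors hd).ne'⟩
  rw [← Finset.mul_sum, sum_conductor_dvd hdq, sum_norm_charSum_sq, mul_assoc]

theorem sum_Icc_sum_divisors {E : Type*} [AddCommMonoid E] (L : ℕ) (H : ℕ → ℕ → E)
    (hH : ∀ c d, L < c * d → H c d = 0) :
    ∑ q ∈ Finset.Icc 1 L, ∑ d ∈ q.divisors, H (q / d) d =
      ∑ c ∈ Finset.Icc 1 L, ∑ d ∈ Finset.Icc 1 L, H c d := by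
  rw [← Finset.sum_product']
  have h1 : ∑ x ∈ Finset.Icc 1 L ×ˢ Finset.Icc 1 L, H x.1 x.2 =
      ∑ x ∈ (Finset.Icc 1 L ×ˢ Finset.Icc 1 L : Finset (ℕ × ℕ)).filter
        (fun x => x.1 * x.2 ≤ L), H x.1 x.2 := by
    symm
    apply Finset.sum_filter_of_ne
    intro x _ hx
    by_contra h
    exact hx (hH _ _ (not_le.1 h))
  rw [h1, ← Finset.sum_fiberwise_of_maps_to (t := Finset.Icc 1 L) (g := fun x : ℕ × ℕ => x.1 * x.2)]
  · refine Finset.sum_congr rfl fun q hq => ?_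
    rw [Finset.mem_Icc] at hq
    rw [← Nat.sum_divisorsAntidiagonal' fun c d => H c d]
    refine Finset.sum_congr ?_ fun _ _ => rfl
    ext x
    simp only [Nat.mem_divisorsAntidiagonal, Finset.mem_filter, Finset.mem_product, Finset.mem_Icc]
    constructor
    · rintro ⟨rfl, h⟩
      have h1 : 0 < x.1 := Nat.pos_of_ne_zero fun h0 => h (by simp [h0])
      have h2 : 0 < x.2 := Nat.pos_of_ne_zero fun h0 => h (by simp [h0])
      exact ⟨⟨⟨⟨h1, (Nat.le_mul_of_pos_right _ h2).trans hq.2⟩, h2,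
        (Nat.le_mul_of_pos_left _ h1).trans hq.2⟩, hq.2⟩, rfl⟩
    · rintro ⟨_, rfl⟩
      exact ⟨rfl, by omega⟩
  · intro x hx
    simp only [Finset.mem_filter, Finset.mem_product, Finset.mem_Icc] at hx ⊢
    exact ⟨Nat.mul_pos hx.1.1.1 hx.1.2.1, hx.2⟩

/-- The weight of the pair `(c, d)` after opening the sum over primitive characters. -/
noncomputable def divisorWeight (W : ℝ → ℂ) (Q : ℝ) (c d : ℕ) : ℂ :=
  (ArithmeticFunction.moebius c : ℂ) * W ((c * d : ℕ) / Q) *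
    ((d.totient : ℂ) / ((c * d).totient : ℂ))

theorem weight_eq_zero {W : ℝ → ℂ} (hsupp : Function.support W ⊆ Set.Icc 1 2) {Q : ℝ} (hQ : 1 ≤ Q)
    {n : ℕ} (hn : ⌊2 * Q⌋₊ < n) : W (n / Q) = 0 := by
  by_contra h
  have h1 := (hsupp h).2
  rw [div_le_iff₀ (by linarith)] at h1
  exact absurd (Nat.le_floor h1) (not_le.2 hn)

theorem moment_eq {W : ℝ → ℂ} (hsupp : Function.support W ⊆ Set.Icc 1 2) {Q : ℝ} (X : ℝ)
    (hQ : 1 ≤ Q) :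
    moment W Q X = ∑ c ∈ Finset.Icc 1 ⌊2 * Q⌋₊, ∑ d ∈ Finset.Icc 1 ⌊2 * Q⌋₊,
      divisorWeight W Q c d * (pairSum d (c * d) ⌊X⌋₊ ⌊X⌋₊ : ℂ) := by
  set L := ⌊2 * Q⌋₊ with hL
  have hL1 : 0 < L := Nat.floor_pos.2 (by linarith)
  rw [← sum_Icc_sum_divisors L
    (fun c d => divisorWeight W Q c d * (pairSum d (c * d) ⌊X⌋₊ ⌊X⌋₊ : ℂ))]
  · obtain ⟨P, hP⟩ : ∃ P : ℕ+, (P : ℕ) = L := ⟨⟨L, hL1⟩, rfl⟩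
    rw [moment, tsum_eq_sum (s := Finset.Icc (1 : ℕ+) P)]
    · have h1 : Finset.Icc 1 L = (Finset.Icc (1 : ℕ+) P).map
          (Function.Embedding.subtype _) := by
        rw [PNat.map_subtype_embedding_Icc, hP, PNat.one_coe]
      rw [h1]
      refine Eq.trans ?_ (Finset.sum_map _ _ _).symm
      refine Finset.sum_congr rfl fun q _ => ?_
      rw [primitiveSum_eq]
      push_cast
      rw [Finset.mul_sum]
      refine Finset.sum_congr rfl fun d hd => ?_
      have hdq : (q : ℕ) / d * d = q := Nat.div_mul_cancel (Nat.dvd_of_mem_divisors hd)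
      change _ = divisorWeight W Q ((q : ℕ) / d) d * (pairSum d ((q : ℕ) / d * d) ⌊X⌋₊ ⌊X⌋₊ : ℂ)
      rw [divisorWeight, hdq]
      ring
    · intro q hq
      have h2 : L < (q : ℕ) := by
        by_contra h
        exact hq (Finset.mem_Icc.2 ⟨one_le, by
          rw [← PNat.coe_le_coe, hP]
          exact not_lt.1 h⟩)
      rw [weight_eq_zero hsupp hQ h2, zero_div, zero_mul]
  · intro c d hcd
    rw [divisorWeight, weight_eq_zero hsupp hQ hcd, mul_zero, zero_mul, zero_mul]

/-! ### Diagonal part and singular series -/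

/-- `∑_{m ≤ N, (m, r) = 1} μ(m)² / m`. -/
noncomputable def diagSum (r N : ℕ) : ℝ := ∑ m ∈ Finset.Icc 1 N, coef r m ^ 2

theorem pairSum_eq_diag_add_upper (d r N : ℕ) :
    pairSum d r N N = diagSum r N + 2 * upperPairSum d r N := by
  have h1 : ∀ m n : ℕ, (if m ≡ n [MOD d] then coef r m * coef r n else 0) =
      (if m = n then coef r m * coef r n else 0) +
      ((if n < m ∧ m ≡ n [MOD d] then coef r m * coef r n else 0) +
      (if m < n ∧ n ≡ m [MOD d] then coef r n * coef r m else 0)) := by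
    intro m n
    have hc : n ≡ m [MOD d] ↔ m ≡ n [MOD d] := Nat.ModEq.comm
    rcases lt_trichotomy m n with h | h | h
    · simp [h, h.ne, h.not_gt, hc, mul_comm]
    · subst h
      simp [Nat.ModEq.refl]
    · simp [h, h.ne', h.not_gt]
  unfold pairSum upperPairSum diagSum
  simp only [h1, Finset.sum_add_distrib]
  rw [two_mul]
  congr 1
  · refine Finset.sum_congr rfl fun m hm => ?_
    rw [Finset.sum_ite_eq, if_pos hm, sq]
  · congr 1
    exact Finset.sum_comm

theorem sum_moebius_div (n : ℕ) (hn : 0 < n) :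
    ∑ b ∈ n.divisors, (ArithmeticFunction.moebius b : ℝ) / b = (n.totient : ℝ) / n := by
  have h := (ArithmeticFunction.sum_eq_iff_sum_mul_moebius_eq (R := ℝ)
    (f := fun n => (n.totient : ℝ)) (g := fun n => (n : ℝ))).1
    (fun n _ => by exact_mod_cast Nat.sum_totient n) n hn
  rw [Nat.sum_divisorsAntidiagonal (f := fun a b => (ArithmeticFunction.moebius a : ℝ) * (b : ℝ))]
    at h
  rw [← h, Finset.sum_div]
  refine Finset.sum_congr rfl fun b hb => ?_
  have hb0 : (b : ℝ) ≠ 0 := by exact_mod_cast (Nat.pos_of_mem_divisors hb).ne'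
  have hn0 : (n : ℝ) ≠ 0 := by exact_mod_cast hn.ne'
  rw [Nat.cast_div (Nat.dvd_of_mem_divisors hb) hb0]
  field_simp

/-- With g = gcd(c, d), φ(d)/φ(cd) = φ(g)/(g φ(c)), and φ(g)/g is expanded over the divisors of g.
The dependence on d is reduced to conditions b ∣ d. -/
theorem totient_div_totient_mul {c d : ℕ} (hc : 0 < c) (hd : 0 < d) :
    (d.totient : ℝ) / (c * d).totient =
      1 / c.totient * ∑ b ∈ (c.gcd d).divisors, (ArithmeticFunction.moebius b : ℝ) / b := by
  have hg := Nat.gcd_pos_of_pos_left d hc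
  rw [sum_moebius_div _ hg]
  have h := Nat.totient_gcd_mul_totient_mul c d
  have h' : ((c.gcd d).totient : ℝ) * (c * d).totient = c.totient * d.totient * (c.gcd d) := by
    exact_mod_cast h
  have h1 : ((c * d).totient : ℝ) ≠ 0 := by
    exact_mod_cast (Nat.totient_pos.2 (Nat.mul_pos hc hd)).ne'
  have h2 : (c.totient : ℝ) ≠ 0 := by exact_mod_cast (Nat.totient_pos.2 hc).ne'
  have h3 : ((c.gcd d : ℕ) : ℝ) ≠ 0 := by exact_mod_cast hg.ne'
  field_simp
  linarith

theorem totient_div_totient_mul_le {c d : ℕ} (hc : 0 < c) (hd : 0 < d) :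
    (d.totient : ℝ) / (c * d).totient ≤ 1 / c.totient := by
  have h1 : c.totient * d.totient ≤ (c * d).totient := Nat.totient_super_multiplicative c d
  have h2 : (0 : ℝ) < c.totient := by exact_mod_cast Nat.totient_pos.2 hc
  have h3 : (0 : ℝ) < (c * d).totient := by exact_mod_cast Nat.totient_pos.2 (Nat.mul_pos hc hd)
  rw [div_le_div_iff₀ h3 h2, one_mul, mul_comm]
  exact_mod_cast h1

/-- The coefficients of the singular series. -/
noncomputable def singularCoeff (m c : ℕ) : ℝ :=
  if c.Coprime m then (ArithmeticFunction.moebius c : ℝ) / (c * c.totient) *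
    ∑ b ∈ c.divisors, (ArithmeticFunction.moebius b : ℝ) / b ^ 2 else 0

theorem singularCoeff_eq (m c : ℕ) :
    singularCoeff m c = if c.Coprime m then (ArithmeticFunction.moebius c : ℝ) / (c * c.totient) *
      ∏ p ∈ c.primeFactors, (1 - 1 / (p : ℝ) ^ 2) else 0 := by
  unfold singularCoeff
  split_ifs with h
  · by_cases hc : Squarefree c
    · congr 1
      set f : ArithmeticFunction ℝ := ⟨fun n => ((n : ℝ) ^ 2)⁻¹, by simp⟩ with hf
      have hfm : f.IsMultiplicative := by
        refine ⟨by simp [hf], fun {a b} _ => ?_⟩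
        simp only [hf, ArithmeticFunction.coe_mk]
        push_cast
        rw [mul_pow, mul_inv]
      have h1 := ArithmeticFunction.IsMultiplicative.prodPrimeFactors_one_sub_of_squarefree f hfm hc
      simp only [hf, ArithmeticFunction.coe_mk] at h1
      simp only [div_eq_mul_inv, one_mul, h1]
    · rw [ArithmeticFunction.moebius_eq_zero_of_not_squarefree hc]
      simp
  · rfl

theorem abs_sum_moebius_div_le {c : ℕ} (k : ℕ) :
    ∑ b ∈ c.divisors, |(ArithmeticFunction.moebius b : ℝ)| / (b : ℝ) ^ k ≤ c.divisors.card := by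
  calc _ ≤ ∑ b ∈ c.divisors, (1 : ℝ) := by
        refine Finset.sum_le_sum fun b hb => ?_
        have hb1 : (1 : ℝ) ≤ b := by exact_mod_cast Nat.pos_of_mem_divisors hb
        have h2 : |(ArithmeticFunction.moebius b : ℝ)| ≤ 1 := by
          exact_mod_cast ArithmeticFunction.abs_moebius_le_one
        rw [div_le_one (by positivity)]
        exact h2.trans (one_le_pow₀ hb1)
    _ = _ := by simp

/-- `∑ d(c) / (φ(c) c^ε)` converges. -/
theorem summable_card_divisors_div {ε : ℝ} (hε : 0 < ε) :
    Summable fun c : ℕ => (c.divisors.card : ℝ) / (c.totient * (c : ℝ) ^ ε) := by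
  obtain ⟨C₁, hC₁, h₁⟩ := exists_card_divisors_le (show 0 < ε / 4 by positivity)
  obtain ⟨C₂, hC₂, h₂⟩ := exists_inv_totient_le (show 0 < ε / 4 by positivity)
  have hs : Summable fun c : ℕ => C₁ * C₂ * (1 / (c : ℝ) ^ (1 + ε / 2)) :=
    (Real.summable_one_div_nat_rpow.2 (by linarith)).mul_left _
  refine Summable.of_nonneg_of_le (fun c => by positivity) (fun c => ?_) hs
  rcases Nat.eq_zero_or_pos c with rfl | hc
  · simp
    positivity
  · have hc0 : (0 : ℝ) < c := by exact_mod_cast hc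
    calc (c.divisors.card : ℝ) / (c.totient * (c : ℝ) ^ ε)
        = c.divisors.card * (1 / c.totient) * (1 / (c : ℝ) ^ ε) := by
          rw [div_mul_eq_div_div]
          ring
      _ ≤ (C₁ * (c : ℝ) ^ (ε / 4)) * (C₂ * (c : ℝ) ^ (ε / 4) / c) * (1 / (c : ℝ) ^ ε) := by
          refine mul_le_mul_of_nonneg_right ?_ (by positivity)
          exact mul_le_mul (h₁ c hc.ne') (h₂ c hc.ne') (by positivity) (by positivity)
      _ = C₁ * C₂ * (1 / (c : ℝ) ^ (1 + ε / 2)) := by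
          have : (c : ℝ) ^ ε = (c : ℝ) ^ (ε / 4) * (c : ℝ) ^ (ε / 4) * (c : ℝ) ^ (ε / 2) := by
            rw [← Real.rpow_add hc0, ← Real.rpow_add hc0]
            ring_nf
          rw [this, Real.rpow_add hc0, Real.rpow_one]
          field_simp

theorem abs_singularCoeff_le (m c : ℕ) :
    |singularCoeff m c| ≤ (c.divisors.card : ℝ) / (c.totient * (c : ℝ) ^ (1 : ℝ)) := by
  unfold singularCoeff
  split_ifs
  · rw [abs_mul, abs_div, Real.rpow_one, abs_of_nonneg (show (0 : ℝ) ≤ c * c.totient by positivity)]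
    have h1 : |∑ b ∈ c.divisors, (ArithmeticFunction.moebius b : ℝ) / (b : ℝ) ^ 2| ≤
        c.divisors.card := by
      refine (Finset.abs_sum_le_sum_abs _ _).trans (le_trans (le_of_eq ?_)
        (abs_sum_moebius_div_le 2))
      refine Finset.sum_congr rfl fun b _ => ?_
      rw [abs_div, abs_of_nonneg (show (0 : ℝ) ≤ (b : ℝ) ^ 2 by positivity)]
    have h2 : |(ArithmeticFunction.moebius c : ℝ)| ≤ 1 := by
      exact_mod_cast ArithmeticFunction.abs_moebius_le_one
    calc _ ≤ 1 / (c * c.totient : ℝ) * c.divisors.card := by gcongr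
      _ = _ := by ring
  · rw [abs_zero]
    positivity

theorem summable_singularCoeff (m : ℕ) : Summable fun c => ‖singularCoeff m c‖ :=
  Summable.of_nonneg_of_le (fun _ => norm_nonneg _) (fun c => abs_singularCoeff_le m c)
    (summable_card_divisors_div one_pos)

theorem localFactor_pos {p : ℕ} (hp : p.Prime) : 0 < localFactor p := by
  have h2 : (2 : ℝ) ≤ p := by exact_mod_cast hp.two_le
  have h3 : 1 / (p : ℝ) ^ 2 ≤ 1 / 2 ^ 2 := by gcongr
  have h4 : 1 / (p : ℝ) ^ 3 ≤ 1 / 2 ^ 3 := by gcongr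
  unfold localFactor
  norm_num at h3 h4 ⊢
  linarith

/-- The singular series as an Euler product. -/
theorem tsum_singularCoeff {m : ℕ} (hm : 0 < m) :
    ∑' c, singularCoeff m c = eulerConst * ∏ p ∈ m.primeFactors, (localFactor p)⁻¹ := by
  have h0 : singularCoeff m 0 = 0 := by
    unfold singularCoeff
    simp
  have h1 : singularCoeff m 1 = 1 := by
    unfold singularCoeff
    simp
  have hmul : ∀ {a b : ℕ}, a.Coprime b →
      singularCoeff m (a * b) = singularCoeff m a * singularCoeff m b := by
    intro a b hab
    simp only [singularCoeff_eq]
    by_cases ha : a.Coprime m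
    · by_cases hb : b.Coprime m
      · rw [if_pos ha, if_pos hb, if_pos (Nat.Coprime.mul_left ha hb),
          ArithmeticFunction.isMultiplicative_moebius.map_mul_of_coprime hab,
          Nat.totient_mul hab, hab.primeFactors_mul,
          Finset.prod_union hab.disjoint_primeFactors]
        push_cast
        ring
      · rw [if_neg hb, if_neg fun h => hb (Nat.Coprime.coprime_mul_left h), mul_zero]
    · rw [if_neg ha, if_neg fun h => ha (Nat.Coprime.coprime_mul_right h), zero_mul]
  have hprod := EulerProduct.eulerProduct_hasProd (f := singularCoeff m) h1 hmul
    (summable_singularCoeff m) h0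
  -- The Möbius factor leaves exponents 0 and 1 only. For p not dividing m the sum is 1 - (1 -
  -- p⁻²)/(p(p - 1)) = 1 - (p + 1)/p³.
  have hlocal : ∀ p : Nat.Primes, ∑' e : ℕ, singularCoeff m ((p : ℕ) ^ e) =
      if (p : ℕ) ∣ m then 1 else localFactor p := by
    intro p
    have hp := p.2
    rw [tsum_eq_sum (s := {0, 1})]
    · rw [Finset.sum_pair zero_ne_one, pow_zero, pow_one, h1, singularCoeff_eq]
      have hcop : (p : ℕ).Coprime m ↔ ¬ (p : ℕ) ∣ m := hp.coprime_iff_not_dvd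
      by_cases hpm : (p : ℕ) ∣ m
      · rw [if_neg (by rw [hcop]; exact not_not.2 hpm), if_pos hpm, add_zero]
      · rw [if_pos (hcop.2 hpm), if_neg hpm, ArithmeticFunction.moebius_apply_prime hp,
          Nat.totient_prime hp, Nat.Prime.primeFactors hp, Finset.prod_singleton, localFactor,
          Nat.cast_sub hp.one_le]
        have h2 : (2 : ℝ) ≤ (p : ℕ) := by exact_mod_cast hp.two_le
        have h3 : ((p : ℕ) : ℝ) - 1 ≠ 0 := by linarith
        have h4 : ((p : ℕ) : ℝ) ≠ 0 := by linarith
        push_cast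
        field_simp
        ring
    · intro e he
      simp only [Finset.mem_insert, Finset.mem_singleton, not_or] at he
      rw [singularCoeff_eq, ArithmeticFunction.moebius_apply_prime_pow hp he.1, if_neg he.2]
      simp
  simp only [hlocal] at hprod
  -- This finite product restores the factors missing at p ∣ m, completing the product to
  -- `eulerConst`.
  have hfin : HasProd (fun p : Nat.Primes => if (p : ℕ) ∣ m then localFactor p else 1)
      (∏ p ∈ m.primeFactors, localFactor p) := by
    have h2 := hasProd_prod_of_ne_finset_one (L := SummationFilter.unconditional Nat.Primes)
      (f := fun p : Nat.Primes => if (p : ℕ) ∣ m then localFactor p else 1)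
      (s := m.primeFactors.subtype Nat.Prime) (fun p hp => if_neg fun h =>
        hp (Finset.mem_subtype.2 (Nat.mem_primeFactors.2 ⟨p.2, h, hm.ne'⟩)))
    have h3 : ∏ p ∈ m.primeFactors.subtype Nat.Prime,
        (if ((p : Nat.Primes) : ℕ) ∣ m then localFactor p else 1) =
        ∏ p ∈ m.primeFactors, localFactor p := by
      rw [← Finset.prod_subtype_of_mem (p := Nat.Prime) (s := m.primeFactors)
        (fun p => localFactor p) fun p hp => Nat.prime_of_mem_primeFactors hp]
      refine Finset.prod_congr rfl fun p hp => ?_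
      rw [Finset.mem_subtype] at hp
      rw [if_pos (Nat.dvd_of_mem_primeFactors hp)]
    exact (congrArg (fun x => HasProd _ x _) h3).mp h2
  have hall := hprod.mul hfin
  have h4 : ∀ p : Nat.Primes, (if (p : ℕ) ∣ m then (1 : ℝ) else localFactor p) *
      (if (p : ℕ) ∣ m then localFactor p else 1) = localFactor p := fun p => by
    split_ifs <;> simp
  simp only [h4] at hall
  have h5 : eulerConst = (∑' c, singularCoeff m c) * ∏ p ∈ m.primeFactors, localFactor p :=
    hall.tprod_eq
  rw [h5, Finset.prod_inv_distrib, mul_assoc, mul_inv_cancel₀, mul_one]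
  exact Finset.prod_ne_zero_iff.2 fun p hp =>
    (localFactor_pos (Nat.prime_of_mem_primeFactors hp)).ne'

/-! ### Smooth sums and the main term -/

theorem hasCompactSupport_of_support_subset {W : ℝ → ℂ}
    (hsupp : Function.support W ⊆ Set.Icc 1 2) : HasCompactSupport W :=
  HasCompactSupport.of_support_subset_isCompact isCompact_Icc hsupp

theorem eq_zero_of_two_lt {W : ℝ → ℂ} (hsupp : Function.support W ⊆ Set.Icc 1 2) {x : ℝ}
    (hx : 2 < x) : W x = 0 := by
  by_contra h
  exact absurd (hsupp h).2 (not_le.2 hx)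

theorem eq_zero_of_lt_one {W : ℝ → ℂ} (hsupp : Function.support W ⊆ Set.Icc 1 2) {x : ℝ}
    (hx : x < 1) : W x = 0 := by
  by_contra h
  exact absurd (hsupp h).1 (not_le.2 hx)

theorem exists_norm_sub_le {W : ℝ → ℂ} (hW : ContDiff ℝ ((⊤ : ℕ∞) : WithTop ℕ∞) W)
    (hsupp : Function.support W ⊆ Set.Icc 1 2) :
    ∃ C : ℝ, 0 ≤ C ∧ ∀ x y, ‖W x - W y‖ ≤ C * |x - y| := by
  obtain ⟨K, hK⟩ := ContDiff.lipschitzWith_of_hasCompactSupport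
    (hasCompactSupport_of_support_subset hsupp) hW (by simp)
  exact ⟨K, K.2, fun x y => by simpa [dist_eq_norm] using hK.dist_le_mul x y⟩

theorem mellin_one_eq {W : ℝ → ℂ} (hsupp : Function.support W ⊆ Set.Icc 1 2) {b : ℝ}
    (hb : 2 ≤ b) : mellin W 1 = ∫ x in (0 : ℝ)..b, W x := by
  rw [mellin, intervalIntegral.integral_of_le (by linarith)]
  simp only [sub_self, Complex.cpow_zero, one_smul]
  refine setIntegral_eq_of_subset_of_forall_sdiff_eq_zero measurableSet_Ioi
    Set.Ioc_subset_Ioi_self fun x hx => ?_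
  apply eq_zero_of_two_lt hsupp
  by_contra h
  exact hx.2 ⟨hx.1, by linarith⟩

/-- The sum `∑ W(k / y)` is well approximated by the integral. -/
theorem exists_norm_sum_weight_sub_le {W : ℝ → ℂ} (hW : ContDiff ℝ ((⊤ : ℕ∞) : WithTop ℕ∞) W)
    (hsupp : Function.support W ⊆ Set.Icc 1 2) {ε : ℝ} (hε : 0 < ε) (hε1 : ε ≤ 1) :
    ∃ C : ℝ, 0 ≤ C ∧ ∀ (y : ℝ) (K : ℕ), 0 < y → ⌊2 * y⌋₊ ≤ K →
      ‖∑ k ∈ Finset.Icc 1 K, W (k / y) - y * mellin W 1‖ ≤ C * y ^ ε := by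
  obtain ⟨A, hA, hLip⟩ := exists_norm_sub_le hW hsupp
  have hcont : Continuous W := hW.continuous
  refine ⟨8 * A + ‖mellin W 1‖, by positivity, fun y K hy hK => ?_⟩
  have hzero : ∀ k : ℕ, ⌊2 * y⌋₊ < k → W (k / y) = 0 := fun k hk => by
    apply eq_zero_of_two_lt hsupp
    rw [lt_div_iff₀ hy]
    exact (Nat.floor_lt (by positivity)).1 hk
  have hred : ∀ K, ⌊2 * y⌋₊ ≤ K → ∑ k ∈ Finset.Icc 1 K, W (k / y) =
      ∑ k ∈ Finset.Icc 1 ⌊2 * y⌋₊, W (k / y) := fun K hK => by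
    symm
    refine Finset.sum_subset (Finset.Icc_subset_Icc_right hK) fun k _ hk' => hzero k ?_
    simp only [Finset.mem_Icc, not_and, not_le] at *
    omega
  rw [hred K hK]
  -- For y < 1/2 the sum is empty and y ≤ y^ε. Otherwise there are at most 4y unit intervals, each
  -- with Lipschitz error A/y, so the total is O(1) = O(y^ε).
  rcases lt_or_ge y (1 / 2) with hy2 | hy2
  · have h0 : ⌊2 * y⌋₊ = 0 := Nat.floor_eq_zero.2 (by linarith)
    have h1 : y ≤ y ^ ε := by
      simpa using Real.rpow_le_rpow_of_exponent_ge hy (by linarith) hε1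
    have h2 : 0 ≤ y ^ ε := by positivity
    rw [h0, Finset.Icc_eq_empty (by norm_num), Finset.sum_empty, zero_sub, norm_neg, norm_mul,
      Complex.norm_real, Real.norm_of_nonneg hy.le]
    calc y * ‖mellin W 1‖ ≤ y ^ ε * ‖mellin W 1‖ := by gcongr
      _ ≤ _ := by nlinarith [mul_nonneg hA h2]
  · rw [← hred (⌊2 * y⌋₊ + 1) (Nat.le_succ _)]
    set N := ⌊2 * y⌋₊ + 1 with hN
    have hN1 : 2 * y ≤ N := by
      rw [hN]
      push_cast
      exact (Nat.lt_floor_add_one _).le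
    have hN2 : (N : ℝ) ≤ 4 * y := by
      rw [hN]
      push_cast
      linarith [Nat.floor_le (show 0 ≤ 2 * y by positivity)]
    have hcy : Continuous fun u : ℝ => W (u / y) := hcont.comp (continuous_id.div_const y)
    have hint : (y : ℂ) * mellin W 1 = ∑ k ∈ Finset.range N,
        ∫ u in (k : ℝ)..((k + 1 : ℕ) : ℝ), W (u / y) := by
      have hb : 2 ≤ (N : ℝ) / y := by rwa [le_div_iff₀ hy]
      rw [intervalIntegral.sum_integral_adjacent_intervals (a := fun k : ℕ => (k : ℝ))
        (f := fun u => W (u / y)) fun k _ =>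
          hcy.intervalIntegrable _ _,
        intervalIntegral.integral_comp_div (f := W) hy.ne', mellin_one_eq hsupp hb]
      simp
    have hshift : ∑ k ∈ Finset.Icc 1 N, W (k / y) = ∑ k ∈ Finset.Ico 0 N, W ((k + 1 : ℕ) / y) := by
      rw [Finset.sum_Ico_add' (fun k : ℕ => W (k / y)) 0 N 1]
      refine Finset.sum_congr ?_ fun _ _ => rfl
      ext k
      simp only [Finset.mem_Icc, Finset.mem_Ico]
      omega
    rw [hint, Finset.range_eq_Ico, hshift, ← Finset.sum_sub_distrib]
    have hterm : ∀ k ∈ Finset.Ico 0 N, ‖W ((k + 1 : ℕ) / y) -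
        ∫ u in (k : ℝ)..((k + 1 : ℕ) : ℝ), W (u / y)‖ ≤ A / y := by
      intro k _
      have h1 : W ((k + 1 : ℕ) / y) = ∫ u in (k : ℝ)..((k + 1 : ℕ) : ℝ), W ((k + 1 : ℕ) / y) := by
        rw [intervalIntegral.integral_const]
        push_cast
        simp
      rw [h1, ← intervalIntegral.integral_sub intervalIntegrable_const
        (hcy.intervalIntegrable _ _)]
      refine (intervalIntegral.norm_integral_le_of_norm_le_const (C := A / y) fun u hu => ?_).trans
        (by push_cast; simp)
      rw [Set.uIoc_of_le (by push_cast; linarith)] at hu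
      refine (hLip _ _).trans ?_
      rw [← sub_div, abs_div, abs_of_pos hy, mul_div_assoc']
      have h3 : |((k + 1 : ℕ) : ℝ) - u| ≤ 1 := by
        have := hu.1
        have := hu.2
        push_cast at *
        rw [abs_le]
        constructor <;> linarith
      gcongr
      nlinarith
    refine (norm_sum_le_of_le _ hterm).trans ?_
    have h5 : (1 : ℝ) ≤ 2 * y ^ ε := by
      have h6 : (1 / 2 : ℝ) ^ ε ≤ y ^ ε := by gcongr
      have h7 : (1 / 2 : ℝ) ≤ (1 / 2 : ℝ) ^ ε := by
        simpa using Real.rpow_le_rpow_of_exponent_ge (show (0 : ℝ) < 1 / 2 by norm_num)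
          (by norm_num) hε1
      linarith
    rw [Finset.sum_const, Nat.card_Ico, nsmul_eq_mul, Nat.sub_zero]
    calc (N : ℝ) * (A / y) ≤ 4 * y * (A / y) := by gcongr
      _ = 4 * A * 1 := by field_simp
      _ ≤ 4 * A * (2 * y ^ ε) := by gcongr
      _ ≤ _ := by
        have : 0 ≤ ‖mellin W 1‖ * y ^ ε := by positivity
        linarith

/-- The contribution of `m` to the diagonal, for a fixed `c`. -/
noncomputable def diagTerm (W : ℝ → ℂ) (Q : ℝ) (L m c : ℕ) : ℂ :=
  if c.Coprime m then ∑ d ∈ Finset.Icc 1 L, if d.Coprime m then divisorWeight W Q c d else 0 else 0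

theorem sum_divisors_moebius_eq_ite_coprime {d m : ℕ} (hm : 0 < m) :
    ∑ a ∈ m.divisors, (if a ∣ d then (ArithmeticFunction.moebius a : ℂ) else 0) =
      if d.Coprime m then 1 else 0 := by
  have h : m.divisors.filter (fun a => a ∣ d) = (d.gcd m).divisors := by
    ext a
    simp only [Finset.mem_filter, Nat.mem_divisors, Nat.dvd_gcd_iff]
    have : d.gcd m ≠ 0 := (Nat.gcd_pos_of_pos_right d hm).ne'
    have := hm.ne'
    tauto
  rw [← Finset.sum_filter, h]
  have h2 := congrArg (Int.cast : ℤ → ℂ) (sum_divisors_moebius (n := d.gcd m))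
  push_cast at h2
  exact h2

theorem divisorWeight_eq (W : ℝ → ℂ) (Q : ℝ) {c d : ℕ} (hc : 0 < c) (hd : 0 < d) :
    divisorWeight W Q c d = (ArithmeticFunction.moebius c : ℂ) / c.totient *
      ∑ b ∈ c.divisors, (ArithmeticFunction.moebius b : ℂ) / b *
        (if b ∣ d then W ((c * d : ℕ) / Q) else 0) := by
  have h := congrArg (Complex.ofReal) (totient_div_totient_mul hc hd)
  push_cast at h
  have h2 : c.divisors.filter (fun b => b ∣ d) = (c.gcd d).divisors := by
    ext a
    simp only [Finset.mem_filter, Nat.mem_divisors, Nat.dvd_gcd_iff]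
    have : c.gcd d ≠ 0 := (Nat.gcd_pos_of_pos_right c hd).ne'
    have := hc.ne'
    tauto
  rw [divisorWeight, h, ← h2, Finset.sum_filter, Finset.mul_sum, Finset.mul_sum, Finset.mul_sum]
  refine Finset.sum_congr rfl fun b _ => ?_
  split_ifs
  · ring
  · ring

/-- The variable a ∣ m detects that d is coprime to m, and b ∣ c comes from φ(d)/φ(cd). As c is
coprime to m, so is a to b; hence the two conditions on d merge into ab ∣ d, and d = abk. -/
theorem diagTerm_eq (W : ℝ → ℂ) {Q : ℝ} {L m c : ℕ} (hm : 0 < m) (hc : 0 < c)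
    (h : c.Coprime m) : diagTerm W Q L m c =
      (ArithmeticFunction.moebius c : ℂ) / c.totient *
        ∑ b ∈ c.divisors, (ArithmeticFunction.moebius b : ℂ) / b *
          ∑ a ∈ m.divisors, (ArithmeticFunction.moebius a : ℂ) *
            ∑ k ∈ Finset.Icc 1 (L / (a * b)), W (k / (Q / (c * (a * b) : ℕ))) := by
  rw [diagTerm, if_pos h]
  have h1 : ∀ d ∈ Finset.Icc 1 L, (if d.Coprime m then divisorWeight W Q c d else 0) =
      (ArithmeticFunction.moebius c : ℂ) / c.totient *
        ∑ b ∈ c.divisors, (ArithmeticFunction.moebius b : ℂ) / b *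
          ∑ a ∈ m.divisors, (ArithmeticFunction.moebius a : ℂ) *
            (if a * b ∣ d then W ((c * d : ℕ) / Q) else 0) := by
    intro d hd
    have h2 : (if d.Coprime m then divisorWeight W Q c d else 0) =
        divisorWeight W Q c d * (if d.Coprime m then 1 else 0) := by
      rw [mul_ite, mul_one, mul_zero]
    rw [h2, divisorWeight_eq W Q hc (Finset.mem_Icc.1 hd).1,
      ← sum_divisors_moebius_eq_ite_coprime hm, mul_assoc, Finset.sum_mul]
    congr 1
    refine Finset.sum_congr rfl fun b hb => ?_
    rw [mul_assoc, Finset.mul_sum]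
    congr 1
    refine Finset.sum_congr rfl fun a ha => ?_
    have hab : a.Coprime b := ((h.coprime_dvd_left (Nat.dvd_of_mem_divisors hb)).coprime_dvd_right
      (Nat.dvd_of_mem_divisors ha)).symm
    have h3 : a * b ∣ d ↔ a ∣ d ∧ b ∣ d :=
      ⟨fun h => ⟨(dvd_mul_right _ _).trans h, (dvd_mul_left _ _).trans h⟩,
        fun h => hab.mul_dvd_of_dvd_of_dvd h.1 h.2⟩
    by_cases hA : a ∣ d <;> by_cases hB : b ∣ d <;> simp only [h3, hA, hB] <;>
      simp [mul_comm]
  rw [Finset.sum_congr rfl h1, ← Finset.mul_sum, Finset.sum_comm]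
  congr 1
  refine Finset.sum_congr rfl fun b hb => ?_
  rw [← Finset.mul_sum, Finset.sum_comm]
  congr 1
  refine Finset.sum_congr rfl fun a ha => ?_
  rw [← Finset.mul_sum, sum_Icc_ite_dvd
    (Nat.mul_pos (Nat.pos_of_mem_divisors ha) (Nat.pos_of_mem_divisors hb)) L
    fun d => W ((c * d : ℕ) / Q)]
  congr 1
  refine Finset.sum_congr rfl fun k _ => ?_
  congr 1
  push_cast
  rw [div_div_eq_mul_div]
  ring

/-- Replacing each sum over k by its integral, the sum over a gives φ(m)/m and the sum over b gives
the singular coefficient. The error y^ε with y = Q/(cab) is at most (Q/c)^ε; the saving c^(-ε) is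
what makes the errors summable over all c. -/
theorem exists_norm_diagTerm_sub_le {W : ℝ → ℂ} (hW : ContDiff ℝ ((⊤ : ℕ∞) : WithTop ℕ∞) W)
    (hsupp : Function.support W ⊆ Set.Icc 1 2) {ε : ℝ} (hε : 0 < ε) (hε1 : ε ≤ 1) :
    ∃ C : ℝ, 0 ≤ C ∧ ∀ (Q : ℝ) (m c : ℕ), 1 ≤ Q → 0 < m →
      ‖diagTerm W Q ⌊2 * Q⌋₊ m c - (Q : ℂ) * mellin W 1 * ((m.totient / m : ℝ) : ℂ) *
        (singularCoeff m c : ℂ)‖ ≤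
      C * Q ^ ε * m.divisors.card * ((c.divisors.card : ℝ) / (c.totient * (c : ℝ) ^ ε)) := by
  obtain ⟨C, hC, hS⟩ := exists_norm_sum_weight_sub_le hW hsupp hε hε1
  refine ⟨C, hC, fun Q m c hQ hm => ?_⟩
  have hQ0 : 0 < Q := by linarith
  rcases Nat.eq_zero_or_pos c with rfl | hc
  · simp [diagTerm, singularCoeff, divisorWeight]
  by_cases h : c.Coprime m
  swap
  · rw [diagTerm, singularCoeff, if_neg h, if_neg h, Complex.ofReal_zero, mul_zero, sub_zero,
      norm_zero]
    positivity
  rw [diagTerm_eq W hm hc h, singularCoeff, if_pos h, ← sum_moebius_div m hm]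
  have hc0 : (c : ℂ) ≠ 0 := by exact_mod_cast hc.ne'
  have hmain : (Q : ℂ) * mellin W 1 *
      ((∑ b ∈ m.divisors, (ArithmeticFunction.moebius b : ℝ) / b : ℝ) : ℂ) *
      (((ArithmeticFunction.moebius c : ℝ) / (c * c.totient) *
        ∑ b ∈ c.divisors, (ArithmeticFunction.moebius b : ℝ) / b ^ 2 : ℝ) : ℂ) =
      (ArithmeticFunction.moebius c : ℂ) / c.totient *
        ∑ b ∈ c.divisors, (ArithmeticFunction.moebius b : ℂ) / b *
          ∑ a ∈ m.divisors, (ArithmeticFunction.moebius a : ℂ) *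
            (((Q / (c * (a * b) : ℕ) : ℝ) : ℂ) * mellin W 1) := by
    push_cast
    simp only [Finset.mul_sum, Finset.sum_mul]
    refine Finset.sum_congr rfl fun b _ => Finset.sum_congr rfl fun a _ => ?_
    simp only [div_eq_mul_inv, mul_inv]
    ring
  rw [hmain, ← mul_sub, ← Finset.sum_sub_distrib]
  simp only [← mul_sub, ← Finset.sum_sub_distrib]
  have hterm : ∀ a ∈ m.divisors, ∀ b ∈ c.divisors,
      ‖∑ k ∈ Finset.Icc 1 (⌊2 * Q⌋₊ / (a * b)), W (k / (Q / (c * (a * b) : ℕ))) -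
        ((Q / (c * (a * b) : ℕ) : ℝ) : ℂ) * mellin W 1‖ ≤ C * (Q ^ ε / (c : ℝ) ^ ε) := by
    intro a ha b hb
    have ha0 := Nat.pos_of_mem_divisors ha
    have hb0 := Nat.pos_of_mem_divisors hb
    have hab : 0 < a * b := Nat.mul_pos ha0 hb0
    have hcab : 0 < c * (a * b) := Nat.mul_pos hc hab
    have hcab' : (0 : ℝ) < (c * (a * b) : ℕ) := by exact_mod_cast hcab
    refine (hS _ _ (by positivity) ?_).trans ?_
    -- The range of k reaches ⌊2Q⌋/(ab) ≥ ⌊2y⌋ with y = Q/(cab), so it contains the whole support of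
    -- the weight.
    · rw [← Nat.floor_div_natCast]
      apply Nat.floor_le_floor
      rw [mul_div_assoc']
      have : (a * b : ℕ) ≤ c * (a * b) := Nat.le_mul_of_pos_left _ hc
      gcongr
    · rw [← Real.div_rpow hQ0.le (Nat.cast_nonneg c)]
      have : c ≤ c * (a * b) := Nat.le_mul_of_pos_right _ hab
      gcongr
  have hmu : ∀ n : ℕ, ‖(ArithmeticFunction.moebius n : ℂ)‖ ≤ 1 := fun n => by
    rw [Complex.norm_intCast]
    exact_mod_cast ArithmeticFunction.abs_moebius_le_one
  have hb : ∀ b ∈ c.divisors, ‖(ArithmeticFunction.moebius b : ℂ) / b *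
      ∑ a ∈ m.divisors, (ArithmeticFunction.moebius a : ℂ) *
        (∑ k ∈ Finset.Icc 1 (⌊2 * Q⌋₊ / (a * b)), W (k / (Q / (c * (a * b) : ℕ))) -
        ((Q / (c * (a * b) : ℕ) : ℝ) : ℂ) * mellin W 1)‖ ≤
      m.divisors.card * (C * (Q ^ ε / (c : ℝ) ^ ε)) := by
    intro b hb
    have h1 : ‖(ArithmeticFunction.moebius b : ℂ) / b‖ ≤ 1 := by
      rw [norm_div, Complex.norm_natCast]
      have : (1 : ℝ) ≤ b := by exact_mod_cast Nat.pos_of_mem_divisors hb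
      exact (div_le_one (by positivity)).2 ((hmu b).trans this)
    rw [norm_mul]
    refine (mul_le_of_le_one_left (norm_nonneg _) h1).trans ?_
    refine (norm_sum_le_of_le _ (n := fun _ => C * (Q ^ ε / (c : ℝ) ^ ε)) fun a ha => ?_).trans
      (by simp)
    rw [norm_mul]
    exact (mul_le_of_le_one_left (norm_nonneg _) (hmu a)).trans (hterm a ha b hb)
  rw [norm_mul, norm_div, Complex.norm_natCast]
  calc _ ≤ 1 / (c.totient : ℝ) * ∑ b ∈ c.divisors, m.divisors.card * (C * (Q ^ ε / (c : ℝ) ^ ε)) :=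
        mul_le_mul (div_le_div_of_nonneg_right (hmu c) (Nat.cast_nonneg _))
          (norm_sum_le_of_le _ hb) (norm_nonneg _) (by positivity)
    _ = _ := by
        rw [Finset.sum_const, nsmul_eq_mul]
        simp only [div_eq_mul_inv, mul_inv]
        ring

theorem sum_inv_sqrt_le (N : ℕ) : ∑ m ∈ Finset.Icc 1 N, 1 / √(m : ℝ) ≤ 2 * √N := by
  induction N with
  | zero => simp
  | succ N ih =>
    rw [Finset.sum_Icc_succ_top (by omega)]
    have h1 : 0 < √((N + 1 : ℕ) : ℝ) := Real.sqrt_pos.2 (by positivity)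
    have h2 : √((N + 1 : ℕ) : ℝ) ^ 2 = N + 1 := by
      rw [Real.sq_sqrt (Nat.cast_nonneg _)]
      push_cast
      ring
    have h3 : √(N : ℝ) ^ 2 = N := Real.sq_sqrt (Nat.cast_nonneg _)
    have h4 : 1 / √((N + 1 : ℕ) : ℝ) ≤ 2 * √((N + 1 : ℕ) : ℝ) - 2 * √(N : ℝ) := by
      rw [div_le_iff₀ h1]
      nlinarith [sq_nonneg (√((N + 1 : ℕ) : ℝ) - √(N : ℝ))]
    linarith

/-- The diagonal terms give the main term. -/
theorem exists_norm_diagonal_sub_mainTerm_le {W : ℝ → ℂ}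
    (hW : ContDiff ℝ ((⊤ : ℕ∞) : WithTop ℕ∞) W) (hsupp : Function.support W ⊆ Set.Icc 1 2)
    {ε : ℝ} (hε : 0 < ε) (hε1 : ε ≤ 1) :
    ∃ C : ℝ, 0 ≤ C ∧ ∀ Q X : ℝ, 1 ≤ Q → 1 ≤ X →
      ‖∑ c ∈ Finset.Icc 1 ⌊2 * Q⌋₊, ∑ d ∈ Finset.Icc 1 ⌊2 * Q⌋₊,
        divisorWeight W Q c d * (diagSum (c * d) ⌊X⌋₊ : ℂ) - mainTerm W Q X‖ ≤
      C * (Q ^ ε * √X) := by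
  obtain ⟨C, hC, hterm⟩ := exists_norm_diagTerm_sub_le hW hsupp hε hε1
  obtain ⟨C', hC', hdiv⟩ := exists_card_divisors_le (show (0 : ℝ) < 1 / 2 by norm_num)
  set B := ∑' c : ℕ, (c.divisors.card : ℝ) / (c.totient * (c : ℝ) ^ ε) with hB
  have hB0 : 0 ≤ B := tsum_nonneg fun c => by positivity
  refine ⟨C * C' * B * 2, by positivity, fun Q X hQ hX => ?_⟩
  set L := ⌊2 * Q⌋₊ with hL
  set N := ⌊X⌋₊ with hN
  have hdiag : ∑ c ∈ Finset.Icc 1 L, ∑ d ∈ Finset.Icc 1 L,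
      divisorWeight W Q c d * (diagSum (c * d) N : ℂ) =
      ∑ m ∈ Finset.Icc 1 N, (((ArithmeticFunction.moebius m : ℝ) ^ 2 / m : ℝ) : ℂ) *
        ∑ c ∈ Finset.Icc 1 L, diagTerm W Q L m c := by
    simp only [diagSum, diagTerm]
    push_cast
    simp only [Finset.mul_sum]
    rw [Finset.sum_comm (s := Finset.Icc 1 N)]
    refine Finset.sum_congr rfl fun c _ => ?_
    rw [Finset.sum_comm]
    refine Finset.sum_congr rfl fun m hm => ?_
    have hsq : √(m : ℝ) ^ 2 = m := Real.sq_sqrt (Nat.cast_nonneg m)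
    by_cases hcm : c.Coprime m
    · rw [if_pos hcm, Finset.mul_sum]
      refine Finset.sum_congr rfl fun d _ => ?_
      by_cases hdm : d.Coprime m
      · rw [if_pos hdm, coef, if_pos (Nat.Coprime.mul_left hcm hdm).symm, ← Complex.ofReal_pow,
          div_pow, hsq]
        push_cast
        ring
      · rw [if_neg hdm, coef, if_neg fun h => hdm (Nat.coprime_mul_iff_right.1 h).2.symm]
        simp
    · rw [if_neg hcm, mul_zero]
      refine Finset.sum_eq_zero fun d _ => ?_
      rw [coef, if_neg fun h => hcm (Nat.coprime_mul_iff_right.1 h).1.symm]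
      simp
  have hmain : mainTerm W Q X =
      ∑ m ∈ Finset.Icc 1 N, (((ArithmeticFunction.moebius m : ℝ) ^ 2 / m : ℝ) : ℂ) *
        ((Q : ℂ) * mellin W 1 * ((m.totient / m : ℝ) : ℂ) *
          ((∑' c, singularCoeff m c : ℝ) : ℂ)) := by
    rw [mainTerm, diagonalSum]
    push_cast
    rw [Finset.mul_sum]
    refine Finset.sum_congr rfl fun m hm => ?_
    rw [← Complex.ofReal_tsum, tsum_singularCoeff (Finset.mem_Icc.1 hm).1]
    push_cast
    simp only [div_eq_mul_inv, pow_two, mul_inv]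
    ring
  have hm : ∀ m ∈ Finset.Icc 1 N, ‖(((ArithmeticFunction.moebius m : ℝ) ^ 2 / m : ℝ) : ℂ) *
      ∑ c ∈ Finset.Icc 1 L, diagTerm W Q L m c -
      (((ArithmeticFunction.moebius m : ℝ) ^ 2 / m : ℝ) : ℂ) *
        ((Q : ℂ) * mellin W 1 * ((m.totient / m : ℝ) : ℂ) *
          ((∑' c, singularCoeff m c : ℝ) : ℂ))‖ ≤ C * C' * B * Q ^ ε * (1 / √(m : ℝ)) := by
    intro m hm
    have hm1 := (Finset.mem_Icc.1 hm).1
    have hm0 : (0 : ℝ) < m := by exact_mod_cast hm1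
    -- Because of this vanishing, the finite sum over c is a full series, compared termwise with the
    -- singular series; no tail needs separate treatment.
    have hzero : ∀ c ∉ Finset.Icc 1 L, diagTerm W Q L m c = 0 := by
      intro c hc
      rcases Nat.eq_zero_or_pos c with rfl | hc0
      · simp [diagTerm, divisorWeight]
      · have hcL : L < c := by
          simp only [Finset.mem_Icc, not_and, not_le] at hc
          exact hc hc0
        rw [diagTerm]
        split_ifs
        · refine Finset.sum_eq_zero fun d hd => ?_
          have hd0 : 0 < d := (Finset.mem_Icc.1 hd).1
          rw [divisorWeight, weight_eq_zero hsupp hQ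
            (hcL.trans_le (Nat.le_mul_of_pos_right c hd0))]
          simp
        · rfl
    have hs1 : Summable fun c => diagTerm W Q L m c :=
      summable_of_ne_finset_zero (s := Finset.Icc 1 L) hzero
    have hs2 : Summable fun c => (Q : ℂ) * mellin W 1 * ((m.totient / m : ℝ) : ℂ) *
        (singularCoeff m c : ℂ) := by
      apply Summable.mul_left
      exact_mod_cast (summable_singularCoeff m).of_norm
    rw [← mul_sub, ← tsum_eq_sum (L := SummationFilter.unconditional ℕ) (s := Finset.Icc 1 L) hzero,
      Complex.ofReal_tsum, ← tsum_mul_left,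
      ← hs1.tsum_sub hs2, norm_mul, Complex.norm_real]
    have h1 : ‖∑' c, (diagTerm W Q L m c - (Q : ℂ) * mellin W 1 * ((m.totient / m : ℝ) : ℂ) *
        (singularCoeff m c : ℂ))‖ ≤ C * Q ^ ε * m.divisors.card * B :=
      tsum_of_norm_bounded ((summable_card_divisors_div hε).hasSum.mul_left _)
        fun c => hterm Q m c hQ hm1
    have h2 : ‖(ArithmeticFunction.moebius m : ℝ) ^ 2 / m‖ ≤ 1 / m := by
      rw [Real.norm_of_nonneg (by positivity)]
      have h : ((ArithmeticFunction.moebius m : ℤ) : ℝ) ^ 2 ≤ 1 := by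
        rw [sq_le_one_iff_abs_le_one]
        exact_mod_cast ArithmeticFunction.abs_moebius_le_one
      gcongr
    -- This crude bound suffices: the sum of 1/√m up to X is O(√X), already the size of the allowed
    -- error.
    have h3 : (m.divisors.card : ℝ) ≤ C' * √(m : ℝ) := by
      rw [Real.sqrt_eq_rpow]
      exact hdiv m (by omega)
    have hQε : 0 ≤ Q ^ ε := by positivity
    calc _ ≤ 1 / (m : ℝ) * (C * Q ^ ε * m.divisors.card * B) :=
          mul_le_mul h2 h1 (norm_nonneg _) (by positivity)
      _ ≤ 1 / (m : ℝ) * (C * Q ^ ε * (C' * √(m : ℝ)) * B) := by gcongr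
      _ = C * C' * B * Q ^ ε * (√(m : ℝ) / m) := by ring
      _ = _ := by rw [Real.sqrt_div_self']
  rw [hdiag, hmain, ← Finset.sum_sub_distrib]
  refine (norm_sum_le_of_le _ hm).trans ?_
  rw [← Finset.mul_sum]
  have hNX : √(N : ℝ) ≤ √X := Real.sqrt_le_sqrt (Nat.floor_le (by linarith))
  calc _ ≤ C * C' * B * Q ^ ε * (2 * √X) := by
        have := sum_inv_sqrt_le N
        gcongr
        linarith
    _ = _ := by ring

/-! ### Partial summation against a smooth weight in m - n -/

theorem exists_norm_second_difference_le {W : ℝ → ℂ}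
    (hW : ContDiff ℝ ((⊤ : ℕ∞) : WithTop ℕ∞) W) (hsupp : Function.support W ⊆ Set.Icc 1 2) :
    ∃ C : ℝ, 0 ≤ C ∧ ∀ x δ, ‖(W (x + δ) - W x) - (W x - W (x - δ))‖ ≤ C * δ ^ 2 := by
  have hc := hasCompactSupport_of_support_subset hsupp
  have hW' : ContDiff ℝ ((⊤ : ℕ∞) : WithTop ℕ∞) (deriv W) := (contDiff_infty_iff_deriv.1 hW).2
  obtain ⟨K, hK⟩ := ContDiff.lipschitzWith_of_hasCompactSupport hc.deriv hW' (by simp)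
  refine ⟨K, K.2, fun x δ => ?_⟩
  have hd : ∀ y, HasDerivAt W (deriv W y) y := fun y =>
    ((contDiff_infty_iff_deriv.1 hW).1 y).hasDerivAt
  have h := convex_univ.norm_image_sub_le_of_norm_hasDerivWithin_le (𝕜 := ℝ) (C := K * |δ|)
    (f := fun y => W (y + δ) - W y) (f' := fun y => deriv W (y + δ) - deriv W y)
    (x := x - δ) (y := x)
    (fun y _ => (((hd (y + δ)).comp_add_const y δ).sub (hd y)).hasDerivWithinAt)
    (fun y _ => by simpa [dist_eq_norm] using hK.dist_le_mul (y + δ) y) trivial trivial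
  simp only [sub_add_cancel, sub_sub_cancel, Real.norm_eq_abs] at h
  rwa [mul_assoc, abs_mul_abs_self, ← pow_two] at h

theorem sum_mul_by_parts {R : Type*} [CommRing R] (a v : ℕ → R) (M : ℕ) :
    ∑ m ∈ Finset.Icc 1 M, a m * v m = (∑ m ∈ Finset.Icc 1 M, a m) * v (M + 1) +
      ∑ m ∈ Finset.Icc 1 M, (∑ j ∈ Finset.Icc 1 m, a j) * (v m - v (m + 1)) := by
  induction M with
  | zero => simp
  | succ M ih =>
    rw [Finset.sum_Icc_succ_top (by omega), ih, Finset.sum_Icc_succ_top (b := M) (by omega)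
      (fun m => (∑ j ∈ Finset.Icc 1 m, a j) * (v m - v (m + 1))),
      Finset.sum_Icc_succ_top (b := M) (by omega) a]
    ring

theorem sum_sum_mul_by_parts {R : Type*} [CommRing R] (a v : ℕ → ℕ → R) (M N : ℕ) :
    ∑ m ∈ Finset.Icc 1 M, ∑ n ∈ Finset.Icc 1 N, a m n * v m n =
      (∑ i ∈ Finset.Icc 1 M, ∑ j ∈ Finset.Icc 1 N, a i j) * v (M + 1) (N + 1) +
      ∑ m ∈ Finset.Icc 1 M, (∑ i ∈ Finset.Icc 1 m, ∑ j ∈ Finset.Icc 1 N, a i j) *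
        (v m (N + 1) - v (m + 1) (N + 1)) +
      ∑ n ∈ Finset.Icc 1 N, (∑ i ∈ Finset.Icc 1 M, ∑ j ∈ Finset.Icc 1 n, a i j) *
        (v (M + 1) n - v (M + 1) (n + 1)) +
      ∑ m ∈ Finset.Icc 1 M, ∑ n ∈ Finset.Icc 1 N,
        (∑ i ∈ Finset.Icc 1 m, ∑ j ∈ Finset.Icc 1 n, a i j) *
          ((v m n - v (m + 1) n) - (v m (n + 1) - v (m + 1) (n + 1))) := by
  have h1 : ∀ n M, ∑ m ∈ Finset.Icc 1 M, a m n * v m n = _ := fun n M =>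
    sum_mul_by_parts (fun m => a m n) (fun m => v m n) M
  rw [Finset.sum_comm]
  simp only [h1]
  rw [Finset.sum_add_distrib, sum_mul_by_parts (fun n => ∑ i ∈ Finset.Icc 1 M, a i n)
    (fun n => v (M + 1) n) N, Finset.sum_comm (f := fun n m =>
      (∑ j ∈ Finset.Icc 1 m, a j n) * (v m n - v (m + 1) n))]
  have h2 : ∀ m, ∑ n ∈ Finset.Icc 1 N, (∑ j ∈ Finset.Icc 1 m, a j n) * (v m n - v (m + 1) n) = _ :=
    fun m => sum_mul_by_parts (fun n => ∑ j ∈ Finset.Icc 1 m, a j n)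
      (fun n => v m n - v (m + 1) n) N
  simp only [h2]
  rw [Finset.sum_add_distrib]
  have h3 : ∀ i k, ∑ m ∈ Finset.Icc 1 i, ∑ n ∈ Finset.Icc 1 k, a m n =
      ∑ n ∈ Finset.Icc 1 k, ∑ m ∈ Finset.Icc 1 i, a m n := fun i k => Finset.sum_comm
  simp only [h3]
  ring

/-- A sum against a smooth function of `m - n`, in terms of the partial sums. -/
theorem exists_norm_sum_weight_sub_mul_le {W : ℝ → ℂ}
    (hW : ContDiff ℝ ((⊤ : ℕ∞) : WithTop ℕ∞) W) (hsupp : Function.support W ⊆ Set.Icc 1 2) :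
    ∃ C : ℝ, 0 ≤ C ∧ ∀ (a : ℕ → ℕ → ℂ) (M : ℕ) (B H : ℝ), 0 < H →
      (∀ i j, i ≤ M → j ≤ M → ‖∑ m ∈ Finset.Icc 1 i, ∑ n ∈ Finset.Icc 1 j, a m n‖ ≤ B) →
      ‖∑ m ∈ Finset.Icc 1 M, ∑ n ∈ Finset.Icc 1 M, a m n * W (((m : ℝ) - n) / H)‖ ≤
        C * B * (M / H) := by
  obtain ⟨A₁, hA₁, h₁⟩ := exists_norm_sub_le hW hsupp
  obtain ⟨A₂, hA₂, h₂⟩ := exists_norm_second_difference_le hW hsupp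
  refine ⟨4 * A₁ + 6 * A₂, by positivity, fun a M B H hH hB => ?_⟩
  have hB0 : 0 ≤ B := (norm_nonneg _).trans (hB 0 0 (Nat.zero_le _) (Nat.zero_le _))
  set V : ℕ → ℕ → ℂ := fun m n => W (((m : ℝ) - n) / H) with hV
  have hV0 : ∀ m n : ℕ, m ≤ n → V m n = 0 := fun m n h => by
    apply eq_zero_of_lt_one hsupp
    have h1 : (m : ℝ) ≤ n := by exact_mod_cast h
    exact (div_nonpos_of_nonpos_of_nonneg (by linarith) hH.le).trans_lt one_pos
  have hV2 : ∀ m n : ℕ, n + ⌊2 * H⌋₊ < m → V m n = 0 := fun m n h => by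
    apply eq_zero_of_two_lt hsupp
    rw [lt_div_iff₀ hH]
    have h1 : 2 * H < ⌊2 * H⌋₊ + 1 := Nat.lt_floor_add_one _
    have h2 : (n : ℝ) + ⌊2 * H⌋₊ + 1 ≤ m := by exact_mod_cast h
    linarith
  have hzero : (∀ m ∈ Finset.Icc 1 M, ∀ n ∈ Finset.Icc 1 M, V m n = 0) →
      ‖∑ m ∈ Finset.Icc 1 M, ∑ n ∈ Finset.Icc 1 M, a m n * W (((m : ℝ) - n) / H)‖ ≤
        (4 * A₁ + 6 * A₂) * B * (M / H) := fun h => by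
    rw [Finset.sum_eq_zero fun m hm => Finset.sum_eq_zero fun n hn => by
      rw [show W (((m : ℝ) - n) / H) = 0 from h m hm n hn, mul_zero], norm_zero]
    positivity
  -- If M < H, or if H < 1/2, no pair satisfies 1 ≤ (m - n)/H ≤ 2 and the sum is zero. What remains
  -- has M/H ≥ 1, so O(B) is admissible, and 1 ≤ 2H, which absorbs the rounding in K.
  rcases lt_or_ge (M : ℝ) H with hM | hM
  · refine hzero fun m hm n _ => ?_
    apply eq_zero_of_lt_one hsupp
    rw [div_lt_one hH]
    have h1 : (m : ℝ) ≤ M := by exact_mod_cast (Finset.mem_Icc.1 hm).2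
    have h2 : (0 : ℝ) ≤ n := Nat.cast_nonneg _
    linarith
  rcases lt_or_ge H (1 / 2) with hH2 | hH2
  · refine hzero fun m _ n _ => ?_
    rcases le_or_gt m n with h | h
    · exact hV0 m n h
    · apply hV2
      rwa [Nat.floor_eq_zero.2 (by linarith)]
  set K := ⌊2 * H⌋₊ with hK
  have hK2 : (K : ℝ) ≤ 2 * H := Nat.floor_le (by positivity)
  have hd1 : ∀ n : ℕ, ‖V (M + 1) n - V (M + 1) (n + 1)‖ ≤ A₁ / H := fun n => by
    refine (h₁ _ _).trans (le_of_eq ?_)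
    push_cast
    rw [← sub_div, show (M : ℝ) + 1 - n - (M + 1 - (n + 1)) = 1 by ring,
      abs_of_pos (by positivity)]
    ring
  have hd2 : ∀ m n : ℕ, ‖(V m n - V (m + 1) n) - (V m (n + 1) - V (m + 1) (n + 1))‖ ≤
      A₂ / H ^ 2 := fun m n => by
    have h := h₂ (((m : ℝ) - n) / H) (1 / H)
    have e1 : ((m : ℝ) - n) / H + 1 / H = (((m + 1 : ℕ) : ℝ) - n) / H := by
      push_cast
      ring
    have e2 : ((m : ℝ) - n) / H - 1 / H = ((m : ℝ) - (n + 1 : ℕ)) / H := by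
      push_cast
      ring
    have e3 : (((m + 1 : ℕ) : ℝ) - (n + 1 : ℕ)) / H = ((m : ℝ) - n) / H := by
      push_cast
      ring
    rw [e1, e2] at h
    simp only [hV, e3]
    rw [← norm_neg]
    refine (le_of_eq (congrArg norm (by ring))).trans (h.trans (le_of_eq (by ring)))
  have hcard : ∀ u k : ℕ, ((Finset.Icc 1 M).filter fun n => n ≤ u ∧ u ≤ n + k).card ≤ k + 1 :=
    fun u k => by
      calc _ ≤ (Finset.Icc (u - k) u).card := Finset.card_le_card fun n hn => by
            simp only [Finset.mem_filter, Finset.mem_Icc] at hn ⊢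
            omega
        _ ≤ k + 1 := by
            rw [Nat.card_Icc]
            omega
  have hS1 : ‖∑ n ∈ Finset.Icc 1 M, (∑ i ∈ Finset.Icc 1 M, ∑ j ∈ Finset.Icc 1 n, a i j) *
      (V (M + 1) n - V (M + 1) (n + 1))‖ ≤ (K + 1 : ℕ) * (B * (A₁ / H)) := by
    rw [← Finset.sum_filter_of_ne (p := fun n => n ≤ M ∧ M ≤ n + K)]
    · refine (norm_sum_le_of_le _ (n := fun _ => B * (A₁ / H)) fun n hn => ?_).trans ?_
      · rw [norm_mul]
        simp only [Finset.mem_filter, Finset.mem_Icc] at hn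
        exact mul_le_mul (hB M n le_rfl hn.1.2) (hd1 n) (norm_nonneg _) hB0
      · rw [Finset.sum_const, nsmul_eq_mul]
        have := hcard M K
        gcongr
    · intro n hn hne
      refine ⟨(Finset.mem_Icc.1 hn).2, ?_⟩
      by_contra hlt
      apply hne
      rw [hV2 (M + 1) n (by omega), hV2 (M + 1) (n + 1) (by omega), sub_zero, mul_zero]
  -- For each m only O(H) values of n lie near the support, and each mixed second difference is
  -- O(H⁻²); the total is O(B M/H).
  have hS2 : ‖∑ m ∈ Finset.Icc 1 M, ∑ n ∈ Finset.Icc 1 M,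
      (∑ i ∈ Finset.Icc 1 m, ∑ j ∈ Finset.Icc 1 n, a i j) *
        ((V m n - V (m + 1) n) - (V m (n + 1) - V (m + 1) (n + 1)))‖ ≤
      M * ((K + 1 + 1 : ℕ) * (B * (A₂ / H ^ 2))) := by
    refine (norm_sum_le_of_le _ (n := fun _ => (K + 1 + 1 : ℕ) * (B * (A₂ / H ^ 2)))
      fun m hm => ?_).trans (by simp)
    rw [← Finset.sum_filter_of_ne (p := fun n => n ≤ m ∧ m ≤ n + (K + 1))]
    · refine (norm_sum_le_of_le _ (n := fun _ => B * (A₂ / H ^ 2)) fun n hn => ?_).trans ?_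
      · rw [norm_mul]
        simp only [Finset.mem_filter, Finset.mem_Icc] at hn
        exact mul_le_mul (hB m n (Finset.mem_Icc.1 hm).2 hn.1.2) (hd2 m n) (norm_nonneg _) hB0
      · rw [Finset.sum_const, nsmul_eq_mul]
        have := hcard m (K + 1)
        gcongr
    · intro n hn hne
      by_contra hlt
      apply hne
      rcases not_and_or.1 hlt with h | h
      · rw [hV0 m n (by omega), hV0 (m + 1) n (by omega), hV0 m (n + 1) (by omega),
          hV0 (m + 1) (n + 1) (by omega)]
        ring
      · rw [hV2 m n (by omega), hV2 (m + 1) n (by omega), hV2 m (n + 1) (by omega),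
          hV2 (m + 1) (n + 1) (by omega)]
        ring
  have hparts := sum_sum_mul_by_parts a V M M
  -- The weight vanishes for m ≤ n, so the corner and the edge n = M + 1 disappear; only the edge m
  -- = M + 1 survives.
  rw [hV0 (M + 1) (M + 1) le_rfl, mul_zero, zero_add, Finset.sum_eq_zero (s := Finset.Icc 1 M)
    (f := fun m => (∑ i ∈ Finset.Icc 1 m, ∑ j ∈ Finset.Icc 1 M, a i j) *
        (V m (M + 1) - V (m + 1) (M + 1))) fun m hm => by
      have := (Finset.mem_Icc.1 hm).2
      rw [hV0 m (M + 1) (by omega), hV0 (m + 1) (M + 1) (by omega), sub_zero, mul_zero],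
    zero_add] at hparts
  rw [hparts]
  refine (norm_add_le_of_le hS1 hS2).trans ?_
  have hMH : 1 ≤ M / H := (one_le_div hH).2 hM
  have e1 : ((K + 1 : ℕ) : ℝ) * (B * (A₁ / H)) ≤ 4 * A₁ * B * (M / H) := by
    have : ((K + 1 : ℕ) : ℝ) ≤ 4 * H := by
      push_cast
      linarith
    calc _ ≤ 4 * H * (B * (A₁ / H)) := by gcongr
      _ = 4 * A₁ * B * 1 := by field_simp
      _ ≤ _ := by gcongr
  have e2 : (M : ℝ) * ((K + 1 + 1 : ℕ) * (B * (A₂ / H ^ 2))) ≤ 6 * A₂ * B * (M / H) := by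
    have : ((K + 1 + 1 : ℕ) : ℝ) ≤ 6 * H := by
      push_cast
      linarith
    calc _ ≤ (M : ℝ) * (6 * H * (B * (A₂ / H ^ 2))) := by gcongr
      _ = _ := by field_simp
  linarith

/-! ### Off-diagonal terms -/

/-- The off-diagonal terms with a given `c`. -/
noncomputable def offTerm (W : ℝ → ℂ) (Q : ℝ) (L N c : ℕ) : ℂ :=
  ∑ d ∈ Finset.Icc 1 L, divisorWeight W Q c d * (upperPairSum d (c * d) N : ℂ)

theorem moment_eq_diag_add_off {W : ℝ → ℂ} (hsupp : Function.support W ⊆ Set.Icc 1 2) {Q : ℝ}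
    (X : ℝ) (hQ : 1 ≤ Q) :
    moment W Q X = ∑ c ∈ Finset.Icc 1 ⌊2 * Q⌋₊, ∑ d ∈ Finset.Icc 1 ⌊2 * Q⌋₊,
      divisorWeight W Q c d * (diagSum (c * d) ⌊X⌋₊ : ℂ) +
      2 * ∑ c ∈ Finset.Icc 1 ⌊2 * Q⌋₊, offTerm W Q ⌊2 * Q⌋₊ ⌊X⌋₊ c := by
  rw [moment_eq hsupp X hQ, Finset.mul_sum, ← Finset.sum_add_distrib]
  refine Finset.sum_congr rfl fun c _ => ?_
  rw [offTerm, Finset.mul_sum, ← Finset.sum_add_distrib]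
  refine Finset.sum_congr rfl fun d _ => ?_
  rw [pairSum_eq_diag_add_upper]
  push_cast
  ring

/-- Passing from a divisor `e` of `m - n` to the complementary divisor `k`. -/
theorem sum_weight_complementary_divisor {W : ℝ → ℂ} (hsupp : Function.support W ⊆ Set.Icc 1 2)
    {Q : ℝ} (hQ : 1 ≤ Q) {c f b m n N : ℕ} (hc : 0 < c) (hf : 0 < f) (hm : m ≤ N) (x : ℂ) :
    ∑ e ∈ Finset.Icc 1 ⌊2 * Q⌋₊, (if b ∣ e then W ((c * (e * f) : ℕ) / Q) else 0) *
        (if n < m ∧ m ≡ n [MOD e] then x else 0) =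
      ∑ k ∈ Finset.Icc 1 N, (if m ≡ n [MOD b * k] then x else 0) *
        W (((m : ℝ) - n) / (k * Q / (c * f))) := by
  have hQ0 : 0 < Q := by linarith
  have hc0 : (0 : ℝ) < c := by exact_mod_cast hc
  have hf0 : (0 : ℝ) < f := by exact_mod_cast hf
  rcases le_or_gt m n with hmn | hmn
  · rw [Finset.sum_eq_zero fun e _ => by
        rw [if_neg (show ¬ (n < m ∧ m ≡ n [MOD e]) from
          fun h => absurd h.1 (not_lt.2 hmn)), mul_zero],
      Finset.sum_eq_zero fun k _ => ?_]
    rw [eq_zero_of_lt_one hsupp, mul_zero]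
    have h1 : (m : ℝ) ≤ n := by exact_mod_cast hmn
    exact (div_nonpos_of_nonpos_of_nonneg (by linarith) (by positivity)).trans_lt one_pos
  obtain ⟨h, rfl⟩ := Nat.exists_eq_add_of_lt hmn
  have hmod : ∀ e, n + h + 1 ≡ n [MOD e] ↔ e ∣ h + 1 := fun e => by
    rw [Nat.ModEq.comm, Nat.modEq_iff_dvd' (by omega)]
    rw [show n + h + 1 - n = h + 1 by omega]
  have hcast : ((n + h + 1 : ℕ) : ℝ) - n = (h + 1 : ℕ) := by
    push_cast
    ring
  simp only [hmod, hcast, hmn, true_and]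
  have hleft : ∑ e ∈ Finset.Icc 1 ⌊2 * Q⌋₊, (if b ∣ e then W ((c * (e * f) : ℕ) / Q) else 0) *
        (if e ∣ h + 1 then x else 0) =
      ∑ e ∈ (h + 1).divisors, (if b ∣ e then W ((c * (e * f) : ℕ) / Q) else 0) * x := by
    simp only [mul_ite, mul_zero]
    rw [← Finset.sum_filter]
    refine Finset.sum_subset (fun e he => ?_) fun e he he' => ?_
    · rw [Finset.mem_filter] at he
      exact Nat.mem_divisors.2 ⟨he.2, by omega⟩
    · have h1 : ⌊2 * Q⌋₊ < e := by
        by_contra h2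
        exact he' (Finset.mem_filter.2 ⟨Finset.mem_Icc.2
          ⟨Nat.pos_of_mem_divisors he, not_lt.1 h2⟩, Nat.dvd_of_mem_divisors he⟩)
      rw [weight_eq_zero hsupp hQ]
      · simp
      · exact h1.trans_le ((Nat.le_mul_of_pos_right _ hf).trans (Nat.le_mul_of_pos_left _ hc))
  have hright : ∑ k ∈ Finset.Icc 1 N, (if b * k ∣ h + 1 then x else 0) *
        W ((h + 1 : ℕ) / (k * Q / (c * f))) =
      ∑ k ∈ (h + 1).divisors, (if b * k ∣ h + 1 then x else 0) *
        W ((h + 1 : ℕ) / (k * Q / (c * f))) := by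
    symm
    refine Finset.sum_subset (fun k hk => ?_) fun k hk hk' => ?_
    · have h1 := Nat.pos_of_mem_divisors hk
      have h2 := Nat.le_of_dvd (by omega) (Nat.dvd_of_mem_divisors hk)
      rw [Finset.mem_Icc]
      omega
    · rw [if_neg, zero_mul]
      exact fun h1 => hk' (Nat.mem_divisors.2 ⟨(dvd_mul_left _ _).trans h1, by omega⟩)
  -- Here m - n = h + 1, and the divisors are reindexed by e = (h + 1)/k. Both ranges lose nothing:
  -- e is limited by the support of W, k by m ≤ N.
  rw [hleft, hright, ← Nat.sum_div_divisors (h + 1)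
    fun e => (if b ∣ e then W ((c * (e * f) : ℕ) / Q) else 0) * x]
  refine Finset.sum_congr rfl fun k hk => ?_
  have hk1 := Nat.dvd_of_mem_divisors hk
  have hk0 : (k : ℝ) ≠ 0 := by exact_mod_cast (Nat.pos_of_mem_divisors hk).ne'
  have hdvd : b ∣ (h + 1) / k ↔ b * k ∣ h + 1 := by
    rw [Nat.dvd_div_iff_mul_dvd hk1, mul_comm]
  have harg : ((c * ((h + 1) / k * f) : ℕ) : ℝ) / Q = (h + 1 : ℕ) / (k * Q / (c * f)) := by
    rw [Nat.cast_mul, Nat.cast_mul, Nat.cast_div hk1 hk0]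
    field_simp
  rw [harg]
  by_cases hb : b * k ∣ h + 1
  · rw [if_pos hb, if_pos (hdvd.2 hb), mul_comm]
  · rw [if_neg hb, if_neg fun h' => hb (hdvd.1 h'), zero_mul, zero_mul]

/-- Coprimality to d is traded for f, with d = ef, and φ(d)/φ(cd) for b ∣ c. Only f coprime to c
contribute, so b ∣ ef means b ∣ e. Exchanging e for k = (m - n)/e turns this into m ≡ n mod bk, and
the weight becomes smooth in m - n. -/
theorem offTerm_eq {W : ℝ → ℂ} (hsupp : Function.support W ⊆ Set.Icc 1 2) {Q : ℝ} (hQ : 1 ≤ Q)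
    {c : ℕ} (hc : 0 < c) (N : ℕ) :
    offTerm W Q ⌊2 * Q⌋₊ N c = ∑ f ∈ Finset.Icc 1 ⌊2 * Q⌋₊,
      (ArithmeticFunction.moebius f : ℂ) * (coef c f : ℂ) ^ 2 *
        ((ArithmeticFunction.moebius c : ℂ) / c.totient *
          ∑ b ∈ c.divisors, (ArithmeticFunction.moebius b : ℂ) / b *
            ∑ k ∈ Finset.Icc 1 N, ∑ m ∈ Finset.Icc 1 (N / f), ∑ n ∈ Finset.Icc 1 (N / f),
              (if m ≡ n [MOD b * k] then ((coef (c * f) m * coef (c * f) n : ℝ) : ℂ) else 0) *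
                W (((m : ℝ) - n) / (k * Q / (c * f)))) := by
  set L := ⌊2 * Q⌋₊ with hL
  have h1 : offTerm W Q L N c = ∑ d ∈ Finset.Icc 1 L, ∑ f ∈ d.divisors,
      divisorWeight W Q c (d / f * f) * ((ArithmeticFunction.moebius f : ℂ) * (coef c f : ℂ) ^ 2 *
        (upperPairSum (d / f) (c * f) (N / f) : ℂ)) := by
    refine Finset.sum_congr rfl fun d hd => ?_
    rw [upperPairSum_eq_sum_divisors (Finset.mem_Icc.1 hd).1]
    push_cast
    rw [Finset.mul_sum]
    refine Finset.sum_congr rfl fun f hf => ?_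
    rw [Nat.div_mul_cancel (Nat.dvd_of_mem_divisors hf)]
  rw [h1, sum_Icc_sum_divisors L (fun e f => divisorWeight W Q c (e * f) *
    ((ArithmeticFunction.moebius f : ℂ) * (coef c f : ℂ) ^ 2 *
        (upperPairSum e (c * f) (N / f) : ℂ))) fun e f h => by
      rw [divisorWeight, weight_eq_zero hsupp hQ (h.trans_le (Nat.le_mul_of_pos_left _ hc))]
      simp, Finset.sum_comm]
  refine Finset.sum_congr rfl fun f hf => ?_
  have hf0 := (Finset.mem_Icc.1 hf).1
  by_cases hfc : f.Coprime c
  swap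
  · rw [coef, if_neg hfc]
    simp
  have h2 : ∀ e ∈ Finset.Icc 1 L, divisorWeight W Q c (e * f) *
      ((ArithmeticFunction.moebius f : ℂ) * (coef c f : ℂ) ^ 2 *
        (upperPairSum e (c * f) (N / f) : ℂ)) =
      (ArithmeticFunction.moebius f : ℂ) * (coef c f : ℂ) ^ 2 *
        ((ArithmeticFunction.moebius c : ℂ) / c.totient *
          ∑ b ∈ c.divisors, (ArithmeticFunction.moebius b : ℂ) / b *
            ∑ m ∈ Finset.Icc 1 (N / f), ∑ n ∈ Finset.Icc 1 (N / f),
              (if b ∣ e then W ((c * (e * f) : ℕ) / Q) else 0) *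
              (if n < m ∧ m ≡ n [MOD e] then
                ((coef (c * f) m * coef (c * f) n : ℝ) : ℂ) else 0)) := by
    intro e he
    rw [divisorWeight_eq W Q hc (Nat.mul_pos (Finset.mem_Icc.1 he).1 hf0), mul_comm, mul_assoc,
      mul_left_comm (upperPairSum e (c * f) (N / f) : ℂ), mul_comm (upperPairSum _ _ _ : ℂ),
      Finset.sum_mul]
    congr 2
    refine Finset.sum_congr rfl fun b hb => ?_
    have hbf : b ∣ e * f ↔ b ∣ e :=
      (hfc.symm.coprime_dvd_left (Nat.dvd_of_mem_divisors hb)).dvd_mul_right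
    rw [mul_assoc]
    congr 1
    simp only [hbf, ← Finset.mul_sum]
    congr 1
    rw [upperPairSum]
    push_cast
    refine Finset.sum_congr rfl fun m _ => Finset.sum_congr rfl fun n _ => ?_
    split_ifs
    · rw [Complex.ofReal_mul]
    · rw [Complex.ofReal_zero]
  rw [Finset.sum_congr rfl h2, ← Finset.mul_sum, ← Finset.mul_sum, Finset.sum_comm]
  congr 2
  refine Finset.sum_congr rfl fun b _ => ?_
  rw [← Finset.mul_sum, Finset.sum_comm, Finset.sum_comm (s := Finset.Icc 1 N)]
  congr 1
  refine Finset.sum_congr rfl fun m hm => ?_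
  rw [Finset.sum_comm, Finset.sum_comm (s := Finset.Icc 1 N)]
  refine Finset.sum_congr rfl fun n _ => ?_
  exact sum_weight_complementary_divisor hsupp hQ hc hf0
    ((Finset.mem_Icc.1 hm).2.trans (Nat.div_le_self _ _)) _

/-- The limit 16(QX)⁴ covers both uses: modulus d with r = cd (at most 8Q³), and modulus bk with r =
cf (at most 16Q⁴X²). Four fifths of ε pay for it and one fifth for X. -/
theorem exists_abs_pairSum_le_rpow (hGRH : GRH) {ε : ℝ} (hε : 0 < ε) :
    ∃ C : ℝ, 0 < C ∧ ∀ (d r M N : ℕ) (Q X : ℝ), 0 < d → 0 < r → 1 ≤ Q → 1 ≤ X →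
      (d : ℝ) * (r * d) ≤ 16 * (Q * X) ^ 4 → (M : ℝ) ≤ X → (N : ℝ) ≤ X →
        |pairSum d r M N| ≤ C * (Q * X) ^ ε := by
  obtain ⟨C, hC, h⟩ := exists_abs_pairSum_le hGRH (show 0 < ε / 5 by positivity)
  refine ⟨C * 16 ^ (ε / 5), by positivity, fun d r M N Q X hd hr hQ hX hdr hM hN => ?_⟩
  refine (h d r M N _ X hd hr hdr hX hM hN).trans ?_
  have hQX : 1 ≤ Q * X := one_le_mul_of_one_le_of_one_le hQ hX
  have hQX0 : 0 < Q * X := by linarith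
  have h1 : X ^ (ε / 5) ≤ (Q * X) ^ (ε / 5) := by
    have : X ≤ Q * X := le_mul_of_one_le_left (by linarith) hQ
    gcongr
  have h2 : ((Q * X) ^ 4) ^ (ε / 5) = (Q * X) ^ (4 * (ε / 5)) := by
    rw [Real.rpow_mul hQX0.le]
    norm_num
  rw [Real.mul_rpow (by norm_num) (by positivity), h2, mul_assoc C]
  have h3 : (Q * X) ^ ε = (Q * X) ^ (4 * (ε / 5)) * (Q * X) ^ (ε / 5) := by
    rw [← Real.rpow_add hQX0]
    ring_nf
  rw [h3, mul_assoc]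
  gcongr

theorem norm_moebius_le_one (n : ℕ) : ‖(ArithmeticFunction.moebius n : ℂ)‖ ≤ 1 := by
  rw [Complex.norm_intCast]
  exact_mod_cast ArithmeticFunction.abs_moebius_le_one

theorem cast_le_of_mem_Icc_floor {Q : ℝ} (hQ : 1 ≤ Q) {c : ℕ} (hc : c ∈ Finset.Icc 1 ⌊2 * Q⌋₊) :
    (c : ℝ) ≤ 2 * Q :=
  (Nat.le_floor_iff (by linarith)).1 (Finset.mem_Icc.1 hc).2

/-- The support of W leaves at most 2Q/c values of d. Each has weight O(1/φ(c)) and a pair sum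
bounded by a small power under GRH; this bound is efficient for large c. -/
theorem exists_norm_offTerm_le (hGRH : GRH) {W : ℝ → ℂ}
    (hW : ContDiff ℝ ((⊤ : ℕ∞) : WithTop ℕ∞) W) (hsupp : Function.support W ⊆ Set.Icc 1 2)
    {ε : ℝ} (hε : 0 < ε) :
    ∃ C : ℝ, 0 ≤ C ∧ ∀ (Q X : ℝ) (c : ℕ), 1 ≤ Q → 1 ≤ X → c ∈ Finset.Icc 1 ⌊2 * Q⌋₊ →
      ‖offTerm W Q ⌊2 * Q⌋₊ ⌊X⌋₊ c‖ ≤ C * (Q * X) ^ ε * (Q / c ^ 2) := by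
  obtain ⟨C₁, hC₁, h₁⟩ := exists_abs_pairSum_le_rpow hGRH (half_pos hε)
  obtain ⟨C₂, hC₂, h₂⟩ := exists_sum_inv_le (half_pos hε)
  obtain ⟨C₃, hC₃, h₃⟩ := exists_inv_totient_le (half_pos hε)
  obtain ⟨A, hA⟩ := hW.continuous.bounded_above_of_compact_support
    (hasCompactSupport_of_support_subset hsupp)
  have hA0 : 0 ≤ A := (norm_nonneg _).trans (hA 0)
  refine ⟨2 * (A * (C₃ * 2 ^ (ε / 2)) * (C₁ + C₂)), by positivity, fun Q X c hQ hX hc => ?_⟩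
  have hQ0 : 0 < Q := by linarith
  have hX0 : 0 < X := by linarith
  have hQX : 1 ≤ Q * X := one_le_mul_of_one_le_of_one_le hQ hX
  have hc1 : 0 < c := (Finset.mem_Icc.1 hc).1
  have hc0 : (0 : ℝ) < c := by exact_mod_cast hc1
  have hcQ := cast_le_of_mem_Icc_floor hQ hc
  have hNX : (⌊X⌋₊ : ℝ) ≤ X := Nat.floor_le hX0.le
  have hupper : ∀ d : ℕ, 0 < d → ((c * d : ℕ) : ℝ) ≤ 2 * Q →
      |upperPairSum d (c * d) ⌊X⌋₊| ≤ (C₁ + C₂) * (Q * X) ^ (ε / 2) := by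
    intro d hd hcd
    have hd1 : (1 : ℝ) ≤ d := by exact_mod_cast hd
    have hdQ : (d : ℝ) ≤ 2 * Q := by
      refine le_trans ?_ hcd
      exact_mod_cast Nat.le_mul_of_pos_left _ hc1
    have hp := h₁ d (c * d) ⌊X⌋₊ ⌊X⌋₊ Q X hd (Nat.mul_pos hc1 hd) hQ hX (by
      calc (d : ℝ) * ((c * d : ℕ) * d) ≤ 2 * Q * (2 * Q * (2 * Q)) := by gcongr
        _ = 8 * Q ^ 3 := by ring
        _ ≤ 16 * (Q * X) ^ 4 := by
          have h5 : Q ≤ Q * X := le_mul_of_one_le_right hQ0.le hX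
          have h4 : Q ^ 3 ≤ Q ^ 4 := pow_le_pow_right₀ hQ (by norm_num)
          have h6 : Q ^ 4 ≤ (Q * X) ^ 4 := by gcongr
          have h7 : 0 ≤ Q ^ 3 := by positivity
          linarith) hNX hNX
    have hdg : |diagSum (c * d) ⌊X⌋₊| ≤ C₂ * (Q * X) ^ (ε / 2) := by
      rw [diagSum, abs_of_nonneg (Finset.sum_nonneg fun m _ => sq_nonneg _)]
      refine ((Finset.sum_le_sum fun m _ => coef_sq_le _ m).trans (h₂ X hX _ hNX)).trans ?_
      have : X ≤ Q * X := le_mul_of_one_le_left hX0.le hQ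
      gcongr
    have heq := pairSum_eq_diag_add_upper d (c * d) ⌊X⌋₊
    have h4 : upperPairSum d (c * d) ⌊X⌋₊ =
        (pairSum d (c * d) ⌊X⌋₊ ⌊X⌋₊ - diagSum (c * d) ⌊X⌋₊) / 2 := by linarith
    rw [h4, abs_div, abs_two]
    have h5 := abs_sub (pairSum d (c * d) ⌊X⌋₊ ⌊X⌋₊) (diagSum (c * d) ⌊X⌋₊)
    have h6 : 0 ≤ (C₁ + C₂) * (Q * X) ^ (ε / 2) := by positivity
    linarith
  have htot : 1 / (c.totient : ℝ) ≤ C₃ * 2 ^ (ε / 2) * (Q * X) ^ (ε / 2) / c := by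
    refine (h₃ c hc1.ne').trans ?_
    have h4 : (c : ℝ) ^ (ε / 2) ≤ 2 ^ (ε / 2) * (Q * X) ^ (ε / 2) := by
      rw [← Real.mul_rpow (by norm_num) (by positivity)]
      have : Q ≤ Q * X := le_mul_of_one_le_right hQ0.le hX
      have h5 : (c : ℝ) ≤ 2 * (Q * X) := by linarith
      gcongr
    rw [mul_assoc]
    gcongr
  set B := A * (C₃ * 2 ^ (ε / 2) * (Q * X) ^ (ε / 2) / c) * ((C₁ + C₂) * (Q * X) ^ (ε / 2)) with hB
  have hB0 : 0 ≤ B := by positivity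
  rw [offTerm, ← Finset.sum_filter_of_ne (p := fun d => d ≤ ⌊2 * Q⌋₊ / c)]
  · refine (norm_sum_le_of_le _ (n := fun _ => B) fun d hd => ?_).trans ?_
    · rw [Finset.mem_filter] at hd
      have hd0 := (Finset.mem_Icc.1 hd.1).1
      have hcd : c * d ≤ ⌊2 * Q⌋₊ := by
        rw [mul_comm]
        exact (Nat.le_div_iff_mul_le hc1).1 hd.2
      have hcd' : ((c * d : ℕ) : ℝ) ≤ 2 * Q := (Nat.le_floor_iff (by linarith)).1 hcd
      rw [norm_mul, divisorWeight, norm_mul, norm_mul, norm_div, Complex.norm_natCast,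
        Complex.norm_natCast, Complex.norm_real, Real.norm_eq_abs]
      refine mul_le_mul (mul_le_mul ?_ ((totient_div_totient_mul_le hc1 hd0).trans htot)
        (by positivity) hA0) (hupper d hd0 hcd') (abs_nonneg _) (by positivity)
      exact (mul_le_of_le_one_left (norm_nonneg _) (norm_moebius_le_one c)).trans (hA _)
    · rw [Finset.sum_const, nsmul_eq_mul]
      have hcard : ((Finset.Icc 1 ⌊2 * Q⌋₊).filter fun d => d ≤ ⌊2 * Q⌋₊ / c).card ≤
          ⌊2 * Q⌋₊ / c := by
        calc _ ≤ (Finset.Icc 1 (⌊2 * Q⌋₊ / c)).card := Finset.card_le_card fun d hd => by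
              rw [Finset.mem_filter, Finset.mem_Icc] at hd
              exact Finset.mem_Icc.2 ⟨hd.1.1, hd.2⟩
          _ = _ := by simp
      have h4 : ((((Finset.Icc 1 ⌊2 * Q⌋₊).filter fun d => d ≤ ⌊2 * Q⌋₊ / c).card : ℕ) : ℝ) ≤
          2 * Q / c := by
        refine (Nat.cast_le.2 hcard).trans (Nat.cast_div_le.trans ?_)
        have := Nat.floor_le (show 0 ≤ 2 * Q by linarith)
        gcongr
      calc _ ≤ 2 * Q / c * B := by gcongr
        _ = 2 * (A * (C₃ * 2 ^ (ε / 2)) * (C₁ + C₂)) *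
            ((Q * X) ^ (ε / 2) * (Q * X) ^ (ε / 2)) * (Q / c ^ 2) := by
          rw [hB]
          ring
        _ = _ := by
          rw [← Real.rpow_add (by positivity), add_halves]
  · intro d _ hne
    by_contra hlt
    apply hne
    rw [divisorWeight, weight_eq_zero hsupp hQ]
    · simp
    · rw [Nat.le_div_iff_mul_le hc1, not_le] at hlt
      rwa [mul_comm c d]

theorem exists_norm_offTerm_le' (hGRH : GRH) {W : ℝ → ℂ}
    (hW : ContDiff ℝ ((⊤ : ℕ∞) : WithTop ℕ∞) W) (hsupp : Function.support W ⊆ Set.Icc 1 2)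
    {ε : ℝ} (hε : 0 < ε) :
    ∃ C : ℝ, 0 ≤ C ∧ ∀ (Q X : ℝ) (c : ℕ), 1 ≤ Q → 1 ≤ X → c ∈ Finset.Icc 1 ⌊2 * Q⌋₊ →
      ‖offTerm W Q ⌊2 * Q⌋₊ ⌊X⌋₊ c‖ ≤ C * (Q * X) ^ ε * (X / Q) := by
  -- Five small powers are lost: in the pair sums, the sums over k and f, 1/φ(c), and the number of
  -- divisors of c.
  obtain ⟨η, hη⟩ : ∃ η, η = ε / 5 := ⟨_, rfl⟩
  have hη0 : 0 < η := by rw [hη]; positivity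
  obtain ⟨C₁, hC₁, h₁⟩ := exists_abs_pairSum_le_rpow hGRH hη0
  obtain ⟨C₂, hC₂, h₂⟩ := exists_sum_inv_le hη0
  obtain ⟨C₃, hC₃, h₃⟩ := exists_inv_totient_le hη0
  obtain ⟨C₄, hC₄, h₄⟩ := exists_card_divisors_le hη0
  obtain ⟨A, hA0, hA⟩ := exists_norm_sum_weight_sub_mul_le hW hsupp
  set P : ℝ := 2 ^ η with hP
  have hP0 : 0 < P := by positivity
  refine ⟨C₂ * P * (C₃ * P) * (C₄ * P) * (A * C₁ * C₂), by positivity,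
    fun Q X c hQ hX hc => ?_⟩
  have hQ0 : 0 < Q := by linarith
  have hX0 : 0 < X := by linarith
  have hQX : 1 ≤ Q * X := one_le_mul_of_one_le_of_one_le hQ hX
  have hQX0 : 0 < Q * X := by linarith
  have hQQX : Q ≤ Q * X := le_mul_of_one_le_right hQ0.le hX
  have hXQX : X ≤ Q * X := le_mul_of_one_le_left hX0.le hQ
  have hc1 : 0 < c := (Finset.mem_Icc.1 hc).1
  have hc0 : (0 : ℝ) < c := by exact_mod_cast hc1
  have hcQ := cast_le_of_mem_Icc_floor hQ hc
  have hNX : (⌊X⌋₊ : ℝ) ≤ X := Nat.floor_le hX0.le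
  set E : ℝ := (Q * X) ^ η with hE
  have hE0 : 0 < E := by positivity
  have hcE : (c : ℝ) ^ η ≤ P * E := by
    rw [hP, hE, ← Real.mul_rpow (by norm_num) (by positivity)]
    have h5 : (c : ℝ) ≤ 2 * (Q * X) := by linarith
    gcongr
  have hXE : X ^ η ≤ E := by
    rw [hE]
    gcongr
  have hQE : (2 * Q) ^ η ≤ P * E := by
    rw [hP, hE, ← Real.mul_rpow (by norm_num) (by positivity)]
    gcongr
  have hk : ∀ f ∈ Finset.Icc 1 ⌊2 * Q⌋₊, ∀ b ∈ c.divisors, ∀ k ∈ Finset.Icc 1 ⌊X⌋₊,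
      ‖∑ m ∈ Finset.Icc 1 (⌊X⌋₊ / f), ∑ n ∈ Finset.Icc 1 (⌊X⌋₊ / f),
        (if m ≡ n [MOD b * k] then ((coef (c * f) m * coef (c * f) n : ℝ) : ℂ) else 0) *
          W (((m : ℝ) - n) / (k * Q / (c * f)))‖ ≤ A * (C₁ * E) * (X * c / Q) * (1 / k) := by
    intro f hf b hb k hk
    have hf1 := (Finset.mem_Icc.1 hf).1
    have hf0 : (0 : ℝ) < f := by exact_mod_cast hf1
    have hfQ := cast_le_of_mem_Icc_floor hQ hf
    have hb1 := Nat.pos_of_mem_divisors hb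
    have hbQ : (b : ℝ) ≤ 2 * Q := by
      refine le_trans ?_ hcQ
      exact_mod_cast Nat.le_of_dvd hc1 (Nat.dvd_of_mem_divisors hb)
    have hk1 := (Finset.mem_Icc.1 hk).1
    have hk0 : (0 : ℝ) < k := by exact_mod_cast hk1
    have hkX : (k : ℝ) ≤ X := (Nat.cast_le.2 (Finset.mem_Icc.1 hk).2).trans hNX
    have hMX : ((⌊X⌋₊ / f : ℕ) : ℝ) ≤ X := (Nat.cast_le.2 (Nat.div_le_self _ _)).trans hNX
    refine (hA (fun m n => if m ≡ n [MOD b * k] then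
      ((coef (c * f) m * coef (c * f) n : ℝ) : ℂ) else 0) (⌊X⌋₊ / f) (C₁ * E)
      (k * Q / (c * f)) (by positivity) fun i j hi hj => ?_).trans ?_
    · have h5 := h₁ (b * k) (c * f) i j Q X (Nat.mul_pos hb1 hk1) (Nat.mul_pos hc1 hf1) hQ hX (by
        push_cast
        calc (b : ℝ) * k * (c * f * (b * k)) ≤ 2 * Q * X * (2 * Q * (2 * Q) * (2 * Q * X)) := by
              gcongr
          _ = 16 * (Q * X) ^ 2 * Q ^ 2 := by ring
          _ ≤ 16 * (Q * X) ^ 2 * (Q * X) ^ 2 := by gcongr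
          _ = _ := by ring) ((Nat.cast_le.2 hi).trans hMX) ((Nat.cast_le.2 hj).trans hMX)
      refine le_trans (le_of_eq ?_) h5
      rw [← Real.norm_eq_abs, ← Complex.norm_real, pairSum]
      push_cast
      congr 1
      refine Finset.sum_congr rfl fun m _ => Finset.sum_congr rfl fun n _ => ?_
      split_ifs
      · rw [Complex.ofReal_mul]
      · rw [Complex.ofReal_zero]
    · have h5 : ((⌊X⌋₊ / f : ℕ) : ℝ) ≤ X / f := Nat.cast_div_le.trans (by gcongr)
      rw [mul_assoc (A * (C₁ * E))]
      refine mul_le_mul_of_nonneg_left ?_ (by positivity)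
      -- The ratio of length to scale is Xc/(kQ): f cancels here, and c will cancel against 1/φ(c).
      calc ((⌊X⌋₊ / f : ℕ) : ℝ) / (k * Q / (c * f)) ≤ X / f / (k * Q / (c * f)) := by gcongr
        _ = _ := by field_simp
  have hb : ∀ f ∈ Finset.Icc 1 ⌊2 * Q⌋₊, ∀ b ∈ c.divisors,
      ‖(ArithmeticFunction.moebius b : ℂ) / b *
        ∑ k ∈ Finset.Icc 1 ⌊X⌋₊, ∑ m ∈ Finset.Icc 1 (⌊X⌋₊ / f), ∑ n ∈ Finset.Icc 1 (⌊X⌋₊ / f),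
        (if m ≡ n [MOD b * k] then ((coef (c * f) m * coef (c * f) n : ℝ) : ℂ) else 0) *
          W (((m : ℝ) - n) / (k * Q / (c * f)))‖ ≤ A * (C₁ * E) * (X * c / Q) * (C₂ * E) := by
    intro f hf b hb
    have h5 : ‖(ArithmeticFunction.moebius b : ℂ) / b‖ ≤ 1 := by
      rw [norm_div, Complex.norm_natCast]
      have : (1 : ℝ) ≤ b := by exact_mod_cast Nat.pos_of_mem_divisors hb
      exact (div_le_one (by positivity)).2 ((norm_moebius_le_one b).trans this)
    rw [norm_mul]
    refine (mul_le_of_le_one_left (norm_nonneg _) h5).trans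
      ((norm_sum_le_of_le _ (hk f hf b hb)).trans ?_)
    rw [← Finset.mul_sum]
    refine mul_le_mul_of_nonneg_left ((h₂ X hX _ hNX).trans ?_) (by positivity)
    gcongr
  have hf : ∀ f ∈ Finset.Icc 1 ⌊2 * Q⌋₊,
      ‖(ArithmeticFunction.moebius f : ℂ) * (coef c f : ℂ) ^ 2 *
        ((ArithmeticFunction.moebius c : ℂ) / c.totient *
          ∑ b ∈ c.divisors, (ArithmeticFunction.moebius b : ℂ) / b *
            ∑ k ∈ Finset.Icc 1 ⌊X⌋₊, ∑ m ∈ Finset.Icc 1 (⌊X⌋₊ / f),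
              ∑ n ∈ Finset.Icc 1 (⌊X⌋₊ / f),
              (if m ≡ n [MOD b * k] then ((coef (c * f) m * coef (c * f) n : ℝ) : ℂ) else 0) *
                W (((m : ℝ) - n) / (k * Q / (c * f))))‖ ≤
      1 / (f : ℝ) * (C₃ * (P * E) / c *
        ((C₄ * (P * E)) * (A * (C₁ * E) * (X * c / Q) * (C₂ * E)))) := by
    intro f hf
    have h5 : ‖(ArithmeticFunction.moebius f : ℂ) * (coef c f : ℂ) ^ 2‖ ≤ 1 / (f : ℝ) := by
      rw [norm_mul, ← Complex.ofReal_pow, Complex.norm_real, Real.norm_of_nonneg (sq_nonneg _)]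
      exact (mul_le_of_le_one_left (sq_nonneg _) (norm_moebius_le_one f)).trans (coef_sq_le c f)
    have h6 : ‖(ArithmeticFunction.moebius c : ℂ) / c.totient‖ ≤ C₃ * (P * E) / c := by
      rw [norm_div, Complex.norm_natCast]
      refine ((div_le_div_of_nonneg_right (norm_moebius_le_one c) (Nat.cast_nonneg _)).trans
        (h₃ c hc1.ne')).trans ?_
      gcongr
    have h7 := (norm_sum_le_of_le _ (hb f hf))
    rw [Finset.sum_const, nsmul_eq_mul] at h7
    have h8 : (c.divisors.card : ℝ) ≤ C₄ * (P * E) := (h₄ c hc1.ne').trans (by gcongr)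
    refine (norm_mul_le _ _).trans (mul_le_mul h5 ((norm_mul_le _ _).trans
      (mul_le_mul h6 (h7.trans ?_) (norm_nonneg _) (by positivity)))
      (norm_nonneg _) (by positivity))
    gcongr
  rw [offTerm_eq hsupp hQ hc1]
  refine (norm_sum_le_of_le _ hf).trans ?_
  rw [← Finset.sum_mul]
  have hsum := (h₂ (2 * Q) (by linarith) ⌊2 * Q⌋₊ (Nat.floor_le (by linarith))).trans
    (mul_le_mul_of_nonneg_left hQE (by linarith))
  have hE5 : E * E * E * E * E = (Q * X) ^ ε := by
    rw [hE, ← Real.rpow_add hQX0, ← Real.rpow_add hQX0, ← Real.rpow_add hQX0,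
      ← Real.rpow_add hQX0, hη]
    ring_nf
  calc _ ≤ C₂ * (P * E) * (C₃ * (P * E) / c *
        ((C₄ * (P * E)) * (A * (C₁ * E) * (X * c / Q) * (C₂ * E)))) := by gcongr
    _ = C₂ * P * (C₃ * P) * (C₄ * P) * (A * C₁ * C₂) * (E * E * E * E * E) * (X / Q) := by
      field_simp
    _ = _ := by rw [hE5]

/-! ### Combining the two off-diagonal bounds -/

/-- This removes the dependence on X^δ. If X ≤ Q², then X^δ ≤ Q^(2δ). Otherwise Q^(1-2δ) ≤
X^(1/2-δ), so the gap between Q and √X absorbs X^δ. -/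
theorem min_mul_rpow_le {δ Q X : ℝ} (hδ : 0 < δ) (hδ2 : δ ≤ 1 / 2) (hQ : 1 ≤ Q) (hX : 1 ≤ X) :
    min √X Q * (Q * X) ^ δ ≤ √X * Q ^ (3 * δ) := by
  have hQ0 : 0 < Q := by linarith
  have hX0 : 0 < X := by linarith
  rw [Real.mul_rpow hQ0.le hX0.le]
  have h3 : Q ^ (3 * δ) = Q ^ δ * Q ^ (2 * δ) := by
    rw [← Real.rpow_add hQ0]
    ring_nf
  have hsq : Q ^ (2 * δ) = (Q ^ 2) ^ δ := by
    rw [Real.rpow_mul hQ0.le]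
    norm_num
  rw [h3]
  rcases le_total X (Q ^ 2) with h | h
  · have h4 : X ^ δ ≤ Q ^ (2 * δ) := by
      rw [hsq]
      gcongr
    calc _ ≤ √X * (Q ^ δ * X ^ δ) := by
          gcongr
          exact min_le_left _ _
      _ ≤ _ := by gcongr
  · have h4 : Q * X ^ δ ≤ √X * Q ^ (2 * δ) := by
      have h5 : (Q ^ 2) ^ (1 / 2 - δ) ≤ X ^ (1 / 2 - δ) :=
        Real.rpow_le_rpow (by positivity) h (by linarith)
      have h6 : √X = X ^ (1 / 2 - δ) * X ^ δ := by
        rw [← Real.rpow_add hX0, Real.sqrt_eq_rpow]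
        ring_nf
      have h7 : Q = (Q ^ 2) ^ (1 / 2 - δ) * Q ^ (2 * δ) := by
        rw [hsq, ← Real.rpow_add (by positivity), sub_add_cancel, ← Real.sqrt_eq_rpow,
          Real.sqrt_sq hQ0.le]
      calc Q * X ^ δ = (Q ^ 2) ^ (1 / 2 - δ) * Q ^ (2 * δ) * X ^ δ := by rw [← h7]
        _ ≤ X ^ (1 / 2 - δ) * Q ^ (2 * δ) * X ^ δ := by gcongr
        _ = _ := by
          rw [h6]
          ring
    calc _ ≤ Q * (Q ^ δ * X ^ δ) := by
          gcongr
          exact min_le_right _ _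
      _ = Q ^ δ * (Q * X ^ δ) := by ring
      _ ≤ Q ^ δ * (√X * Q ^ (2 * δ)) := by gcongr
      _ = _ := by ring

theorem exists_norm_sum_offTerm_le (hGRH : GRH) {W : ℝ → ℂ}
    (hW : ContDiff ℝ ((⊤ : ℕ∞) : WithTop ℕ∞) W) (hsupp : Function.support W ⊆ Set.Icc 1 2)
    {ε : ℝ} (hε : 0 < ε) (hε1 : ε ≤ 1) :
    ∃ C : ℝ, 0 ≤ C ∧ ∀ Q X : ℝ, 1 ≤ Q → 1 ≤ X →
      ‖∑ c ∈ Finset.Icc 1 ⌊2 * Q⌋₊, offTerm W Q ⌊2 * Q⌋₊ ⌊X⌋₊ c‖ ≤ C * (Q ^ ε * √X) := by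
  -- Three shares go to `min_mul_rpow_le`, one to the harmonic sum over c.
  obtain ⟨δ, hδ⟩ : ∃ δ, δ = ε / 4 := ⟨_, rfl⟩
  have hδ0 : 0 < δ := by rw [hδ]; positivity
  obtain ⟨C₁, hC₁, h₁⟩ := exists_norm_offTerm_le hGRH hW hsupp hδ0
  obtain ⟨C₂, hC₂, h₂⟩ := exists_norm_offTerm_le' hGRH hW hsupp hδ0
  obtain ⟨C₃, hC₃, h₃⟩ := exists_sum_inv_le hδ0
  refine ⟨(C₁ + C₂) * (C₃ * 2 ^ δ), by positivity, fun Q X hQ hX => ?_⟩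
  have hQ0 : 0 < Q := by linarith
  have hX0 : 0 < X := by linarith
  have hterm : ∀ c ∈ Finset.Icc 1 ⌊2 * Q⌋₊, ‖offTerm W Q ⌊2 * Q⌋₊ ⌊X⌋₊ c‖ ≤
      (C₁ + C₂) * (√X * Q ^ (3 * δ)) * (1 / (c : ℝ)) := by
    intro c hc
    have hc1 : (1 : ℝ) ≤ c := by exact_mod_cast (Finset.mem_Icc.1 hc).1
    have hc0 : (0 : ℝ) < c := by linarith
    -- The minimum is at most the geometric mean √X/c, and also at most Q/c² ≤ Q/c.
    have hmin : min (X / Q) (Q / c ^ 2) ≤ min √X Q * (1 / c) := by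
      rw [min_mul_of_nonneg _ _ (by positivity)]
      refine le_min ?_ ?_
      · by_contra! hlt
        obtain ⟨ha, hb⟩ := lt_min_iff.1 hlt
        have h4 : √X * (1 / c) * (√X * (1 / c)) < X / Q * (Q / c ^ 2) :=
          mul_lt_mul'' ha hb (by positivity) (by positivity)
        have h5 : X / Q * (Q / c ^ 2) = √X * √X * (1 / c * (1 / c)) := by
          rw [Real.mul_self_sqrt hX0.le]
          field_simp
        rw [h5] at h4
        linarith
      · refine (min_le_right _ _).trans ?_
        rw [mul_one_div]
        gcongr
        nlinarith
    have hE : 0 ≤ (Q * X) ^ δ := by positivity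
    have h4 : ‖offTerm W Q ⌊2 * Q⌋₊ ⌊X⌋₊ c‖ ≤
        (C₁ + C₂) * (Q * X) ^ δ * min (X / Q) (Q / c ^ 2) := by
      rw [mul_min_of_nonneg _ _ (by positivity)]
      refine le_min ((h₂ Q X c hQ hX hc).trans ?_) ((h₁ Q X c hQ hX hc).trans ?_)
      · gcongr
        linarith
      · gcongr
        linarith
    calc _ ≤ (C₁ + C₂) * (Q * X) ^ δ * (min √X Q * (1 / c)) := h4.trans (by gcongr)
      _ = (C₁ + C₂) * (min √X Q * (Q * X) ^ δ) * (1 / c) := by ring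
      _ ≤ _ := by
        have := min_mul_rpow_le hδ0 (by linarith) hQ hX
        gcongr
  refine (norm_sum_le_of_le _ hterm).trans ?_
  rw [← Finset.mul_sum]
  have h5 : Q ^ ε = Q ^ (3 * δ) * Q ^ δ := by
    rw [← Real.rpow_add hQ0, hδ]
    ring_nf
  calc _ ≤ (C₁ + C₂) * (√X * Q ^ (3 * δ)) * (C₃ * (2 * Q) ^ δ) := by
        have := h₃ (2 * Q) (by linarith) ⌊2 * Q⌋₊ (Nat.floor_le (by linarith))
        gcongr
    _ = _ := by
        rw [h5, Real.mul_rpow (by norm_num) hQ0.le]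
        ring

end MoebiusSieve

theorem mainTheorem3 (hGRH : MoebiusSieve.GRH) (W : ℝ → ℂ)
    (hW : ContDiff ℝ ((⊤ : ℕ∞) : WithTop ℕ∞) W) (hsupp : Function.support W ⊆ Set.Icc 1 2)
    (ε : ℝ) (hε : 0 < ε) :
    ∃ C : ℝ, ∀ Q X : ℝ, 1 ≤ Q → 1 ≤ X →
      ‖MoebiusSieve.moment W Q X - MoebiusSieve.mainTerm W Q X‖ ≤ C * (Q ^ ε * √X) := by
  -- Both estimates need an exponent at most 1; as Q ≥ 1, shrinking ε only strengthens the bound.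
  have hη : 0 < min ε 1 := lt_min hε one_pos
  obtain ⟨C₁, hC₁, h₁⟩ :=
    MoebiusSieve.exists_norm_diagonal_sub_mainTerm_le hW hsupp hη (min_le_right ε 1)
  obtain ⟨C₂, hC₂, h₂⟩ :=
    MoebiusSieve.exists_norm_sum_offTerm_le hGRH hW hsupp hη (min_le_right ε 1)
  refine ⟨C₁ + 2 * C₂, fun Q X hQ hX => ?_⟩
  rw [MoebiusSieve.moment_eq_diag_add_off hsupp X hQ, add_sub_right_comm]
  refine (norm_add_le_of_le (h₁ Q X hQ hX)
    ((norm_mul_le _ _).trans (mul_le_mul_of_nonneg_left (h₂ Q X hQ hX) (norm_nonneg _)))).trans ?_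
  have hpow : Q ^ min ε 1 ≤ Q ^ ε := Real.rpow_le_rpow_of_exponent_le hQ (min_le_left ε 1)
  rw [RCLike.norm_ofNat]
  calc _ = (C₁ + 2 * C₂) * (Q ^ min ε 1 * √X) := by ring
    _ ≤ _ := by gcongr
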